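/- For decision problems $P$ on $X$ and $Q$ on $Y$ write $P \preceq Q$ if there is a computable function $f : X \to Y$ with $P(x) \leftrightarrow Q(f(x))$ for all $x \in X$ (a many-one reduction). Here finite objects are given by their codes, and an instance that contains a valuation $\nu : \mathbb N \to \mathbb N$ is given by the code of its finite part together with $\nu$ as an oracle (if the output of $f$ contains a valuation, its values have to be uniformly computable from the input); for problems whose instances are finite objects this is ordinary computability. Consider the following problems. - $\mathrm{Halt}$: given a single-tape Turing machine with finitely many states and symbols, and a tape with finitely many non-blank cells, does the machine halt when started in its initial state on this tape? - $\mathrm{PCP}$: given a list $C$ of pairs of strings over $\mathbb N$, is there a non-empty finite sequence $(u_1,v_1),\dots,(u_k,v_k)$ of elements of $C$ with $u_1\cdots u_k = v_1\cdots v_k$? - $\mathrm{MM}$: given $n$, a Minsky machine with $n$ registers, i.e. a list of instructions $\mathrm{INC}\,\alpha$ (increment register $\alpha$ and go to the next instruction) and $\mathrm{DEC}\,\alpha\,p$ (if register $\alpha$ is positive, decrement it and go to the next instruction, otherwise jump to label $p$) labelled $1,2,\dots$, and $\vec v \in \mathbb N^n$, does the machine, started at label $1$ with register values $\vec v$, reach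 a label outside of its code? - $\mathrm{FRACTRAN}$: given a list $Q$ of pairs $(p,q) \in \mathbb N^2$ (standing for fractions $p/q$) and $s \in \mathbb N$, does $Q$ terminate from $s$? In state $x$ a step uses the first pair $(p,q)$ with $q \mid p x$ and leads to any $y$ with $q y = p x$; $Q$ terminates from $s$ if some state from which no step is possible can be reached from $s$. $\mathrm{FRACTRAN_{reg}}$ is the restriction to regular programs, in which all $q$ are non-zero. - $\mathrm{DIO\_FORM}$: given a formula $A$ built from atoms $x_i = n$, $x_i = x_j$, $x_i = x_j + x_k$, $x_i = x_j \times x_k$ ($n\in\mathbb N$) by conjunction, disjunction and existential quantification over $\mathbb N$ (in de Bruijn syntax), and a valuation $\nu : \mathbb N \to \mathbb N$, does $A$ hold under $\nu$? - $\mathrm{DIO\_ELEM}$: given a list of constraints of the forms $u = n$, $u = v$, $u = x_i$, $u = v + w$, $u = v \times w$ with existential variables $u,v,w$ and parameters $x_i$, and a valuation $\nu : \mathbb N \to \mathbb N$ of the parameters, is there a valuation $\varphi$ of the existential variables in $\mathbb N$ that satisfies all constraints? - $\mathrm{DIO\_SINGLE}$: given an equation $p = q$ between polynomial expressions with coefficients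 in $\mathbb N$, variables $u_0,u_1,\dots$ and parameters $x_0,x_1,\dots$, and a valuation $\nu : \mathbb N \to \mathbb N$ of the parameters, is $p = q$ solvable in $\mathbb N$ under $\nu$? - $\mathrm{H10}$: given $n$ and an equation $p = q$ between polynomial expressions with coefficients in $\mathbb N$, in $n$ variables and without parameters, does it have a solution in $\mathbb N^n$? Theorem (Hilbert's tenth problem). We have the chain of many-one reductions $$\mathrm{Halt} \preceq \mathrm{PCP} \preceq \mathrm{MM} \preceq \mathrm{FRACTRAN_{reg}} \preceq \mathrm{FRACTRAN} \preceq \mathrm{DIO\_FORM} \preceq \mathrm{DIO\_ELEM} \preceq \mathrm{DIO\_SINGLE} \preceq \mathrm{H10},$$ and as a consequence $\mathrm{H10}$ is undecidable: no algorithm decides whether a single polynomial equation over $\mathbb N$ without parameters is solvable. -/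

import Mathlib

namespace HilbertTenth

/-! ## Computable maps and many-one reductions

Instances of some of the problems below contain a valuation `ℕ → ℕ`, which is an infinite object.
Every instance is therefore named by a sequence of natural numbers. A finite object has as name
the constant sequence with value its code, and a pair of a finite object and a valuation `ν` has
as name the code of the finite object followed by `ν 0, ν 1, …`. Computability of a map is then
computability on names in the usual sense (with the name as an oracle, only finitely many entries
of which are read before an answer is given). For maps between types of finite objects this is
ordinary computability on codes. -/

/-- A type whose elements are named by sequences of natural numbers. -/
class Named (X : Type) where
  name : X → ℕ → ℕ
  name_injective : Function.Injective name

instance namedOfEncodable (X : Type) [Encodable X] : Named X where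
  name x := fun _ => Encodable.encode x
  name_injective _ _ h := Encodable.encode_injective (congrFun h 0)

instance namedValuation (X : Type) [Encodable X] : Named (X × (ℕ → ℕ)) where
  name x := fun m => Nat.casesOn m (Encodable.encode x.1) x.2
  name_injective := by
    rintro ⟨x, ν⟩ ⟨y, μ⟩ h
    have h0 : x = y := Encodable.encode_injective (congrFun h 0)
    have h1 : ν = μ := funext fun m => congrFun h (m + 1)
    rw [h0, h1]

/-- `f` is computable: there is an algorithm `φ` that, given a finite initial segment of the name
of `x` and a position `m`, may or may not give an answer. All its answers are equal to the entry
at position `m` of the name of `f x`, and it does answer on some initial segment. -/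
def ComputableMap {X Y : Type} [Named X] [Named Y] (f : X → Y) : Prop :=
  ∃ φ : List ℕ → ℕ → Option ℕ, Computable₂ φ ∧ ∀ (x : X) (m : ℕ),
    (∀ k y, φ ((List.range k).map (Named.name x)) m = some y → y = Named.name (f x) m) ∧
    ∃ k, (φ ((List.range k).map (Named.name x)) m).isSome

/-- Many-one reducibility of `P` to `Q`. -/
def Reduces {X Y : Type} [Named X] [Named Y] (P : X → Prop) (Q : Y → Prop) : Prop :=
  ∃ f : X → Y, ComputableMap f ∧ ∀ x, P x ↔ Q (f x)

/-- A problem on finite objects is decidable: an algorithm answers it correctly on the code of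
every instance. -/
def AlgorithmicallyDecidable {X : Type} [Encodable X] (P : X → Prop) : Prop :=
  ∃ d : ℕ → Bool, Computable d ∧ ∀ x, P x ↔ d (Encodable.encode x) = true

/-! ## The halting problem of single-tape Turing machines -/

/-- A Turing machine with states `0, …, states` (initial state `0`) and tape symbols
`0, …, symbols` (blank `0`), and a tape, given by the symbols to the left of the head (nearest
first) and the symbols from the head onwards, all other cells being blank. -/
structure HaltInstance where
  states : ℕ
  symbols : ℕ
  machine : Turing.TM0.Machine (Fin (symbols + 1)) (Fin (states + 1))
  left : List (Fin (symbols + 1))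
  right : List (Fin (symbols + 1))

def Halt (I : HaltInstance) : Prop :=
  ∃ c : Turing.TM0.Cfg (Fin (I.symbols + 1)) (Fin (I.states + 1)),
    Turing.TM0.Reaches I.machine ⟨0, Turing.Tape.mk₂ I.left I.right⟩ c ∧
      Turing.TM0.step I.machine c = none

def stmtCode {k : ℕ} : Turing.TM0.Stmt (Fin k) → Bool ⊕ ℕ
  | .move .left => Sum.inl false
  | .move .right => Sum.inl true
  | .write a => Sum.inr a

theorem stmtCode_injective {k : ℕ} : Function.Injective (stmtCode (k := k)) := by
  intro a b h
  rcases a with (_ | _) | a <;> rcases b with (_ | _) | b <;> simp_all [stmtCode, Fin.ext_iff]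

/-- The transition table of a machine, as a list of rows, one row per state. -/
def tableCode {s k : ℕ} (M : Turing.TM0.Machine (Fin (k + 1)) (Fin (s + 1))) :
    List (List (Option (ℕ × (Bool ⊕ ℕ)))) :=
  List.ofFn fun q => List.ofFn fun a => (M q a).map fun t => (t.1.val, stmtCode t.2)

theorem tableCode_injective {s k : ℕ} : Function.Injective (tableCode (s := s) (k := k)) := by
  intro M N h
  funext q a
  have h1 := congrFun (List.ofFn_injective (congrFun (List.ofFn_injective h) q)) a
  refine Option.map_injective ?_ h1
  rintro ⟨q₁, t₁⟩ ⟨q₂, t₂⟩ h2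
  simp only [Prod.mk.injEq] at h2
  rw [Fin.ext h2.1, stmtCode_injective h2.2]

def HaltInstance.code (I : HaltInstance) :
    ℕ × ℕ × List (List (Option (ℕ × (Bool ⊕ ℕ)))) × List ℕ × List ℕ :=
  (I.states, I.symbols, tableCode I.machine, I.left.map Fin.val, I.right.map Fin.val)

theorem HaltInstance.code_injective : Function.Injective HaltInstance.code := by
  rintro ⟨s, k, M, L, R⟩ ⟨s', k', M', L', R'⟩ h
  simp only [HaltInstance.code, Prod.mk.injEq] at h
  obtain ⟨rfl, rfl, h1, h2, h3⟩ := h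
  rw [tableCode_injective h1, List.map_injective_iff.2 Fin.val_injective h2,
    List.map_injective_iff.2 Fin.val_injective h3]

noncomputable instance : Encodable HaltInstance :=
  Encodable.ofInj HaltInstance.code HaltInstance.code_injective

/-! ## The Post correspondence problem -/

/-- Given a list of cards (pairs of strings), is there a non-empty sequence of cards, possibly with
repetitions, whose upper strings and whose lower strings concatenate to the same string? -/
def PCP (C : List (List ℕ × List ℕ)) : Prop :=
  ∃ A : List (List ℕ × List ℕ), A ≠ [] ∧ (∀ c ∈ A, c ∈ C) ∧
    (A.map Prod.fst).flatten = (A.map Prod.snd).flatten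

/-! ## Minsky machines -/

/-- Instructions of Minsky machines with `n` registers. -/
inductive MMInstr (n : ℕ) : Type
  | inc (a : Fin n)
  | dec (a : Fin n) (p : ℕ)

def MMInstr.code {n : ℕ} : MMInstr n → ℕ ⊕ (ℕ × ℕ)
  | .inc a => Sum.inl a
  | .dec a p => Sum.inr (a, p)

theorem MMInstr.code_injective {n : ℕ} : Function.Injective (MMInstr.code (n := n)) := by
  intro a b h
  cases a <;> cases b <;> simp_all [MMInstr.code, Fin.ext_iff]

/-- One step of the machine `(s, P)`, whose instructions are labelled `s, s + 1, …`; a state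
consists of the program counter and the values of the registers. -/
inductive MMStep {n : ℕ} (s : ℕ) (P : List (MMInstr n)) :
    ℕ × (Fin n → ℕ) → ℕ × (Fin n → ℕ) → Prop
  | inc (j : ℕ) (a : Fin n) (v : Fin n → ℕ) (h : P[j]? = some (.inc a)) :
      MMStep s P (s + j, v) (s + j + 1, Function.update v a (v a + 1))
  | dec_succ (j : ℕ) (a : Fin n) (p k : ℕ) (v : Fin n → ℕ) (h : P[j]? = some (.dec a p))
      (hv : v a = k + 1) : MMStep s P (s + j, v) (s + j + 1, Function.update v a k)
  | dec_zero (j : ℕ) (a : Fin n) (p : ℕ) (v : Fin n → ℕ) (h : P[j]? = some (.dec a p))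
      (hv : v a = 0) : MMStep s P (s + j, v) (p, v)

/-- The machine `(s, P)` terminates from the state `c`: it reaches a state whose program counter
is outside of the code. -/
def MMTerminates {n : ℕ} (s : ℕ) (P : List (MMInstr n)) (c : ℕ × (Fin n → ℕ)) : Prop :=
  ∃ d : ℕ × (Fin n → ℕ), Relation.ReflTransGen (MMStep s P) c d ∧
    (d.1 < s ∨ P.length + s ≤ d.1)

structure MMInstance where
  registers : ℕ
  program : List (MMInstr registers)
  input : Fin registers → ℕ

def MM (I : MMInstance) : Prop := MMTerminates 1 I.program (1, I.input)

def MMInstance.code (I : MMInstance) : ℕ × List (ℕ ⊕ (ℕ × ℕ)) × List ℕ :=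
  (I.registers, I.program.map MMInstr.code, List.ofFn I.input)

theorem MMInstance.code_injective : Function.Injective MMInstance.code := by
  rintro ⟨n, P, v⟩ ⟨n', P', v'⟩ h
  simp only [MMInstance.code, Prod.mk.injEq] at h
  obtain ⟨rfl, h1, h2⟩ := h
  rw [List.map_injective_iff.2 MMInstr.code_injective h1, List.ofFn_injective h2]

noncomputable instance : Encodable MMInstance :=
  Encodable.ofInj MMInstance.code MMInstance.code_injective

/-! ## FRACTRAN -/

/-- One step of a FRACTRAN program; the pair `(p, q)` stands for the fraction `p / q`. -/
inductive FractranStep : List (ℕ × ℕ) → ℕ → ℕ → Prop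
  | head (p q : ℕ) (Q : List (ℕ × ℕ)) (x y : ℕ) (h : q * y = p * x) :
      FractranStep ((p, q) :: Q) x y
  | tail (p q : ℕ) (Q : List (ℕ × ℕ)) (x y : ℕ) (h : ¬ q ∣ p * x) (hQ : FractranStep Q x y) :
      FractranStep ((p, q) :: Q) x y

def FractranTerminates (Q : List (ℕ × ℕ)) (s : ℕ) : Prop :=
  ∃ x, Relation.ReflTransGen (FractranStep Q) s x ∧ ∀ y, ¬ FractranStep Q x y

/-- A program is regular if no denominator is zero. -/
def FractranRegular (Q : List (ℕ × ℕ)) : Prop := ∀ f ∈ Q, f.2 ≠ 0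

instance : DecidablePred FractranRegular := fun Q =>
  inferInstanceAs (Decidable (∀ f ∈ Q, f.2 ≠ 0))

/-- Termination of arbitrary FRACTRAN programs. -/
def FRACTRAN (I : List (ℕ × ℕ) × ℕ) : Prop := FractranTerminates I.1 I.2

/-- Termination of regular FRACTRAN programs. -/
def FRACTRAN_REG (I : {Q : List (ℕ × ℕ) // FractranRegular Q} × ℕ) : Prop :=
  FractranTerminates I.1.1 I.2

/-! ## Diophantine logic -/

/-- Formulas of Diophantine logic, with de Bruijn indices. -/
inductive DioForm : Type
  | const (i n : ℕ)
  | var (i j : ℕ)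
  | add (i j k : ℕ)
  | mul (i j k : ℕ)
  | and (A B : DioForm)
  | or (A B : DioForm)
  | ex (A : DioForm)

/-- The valuation `ν` with `n` pushed in front. -/
def liftVal (ν : ℕ → ℕ) (n : ℕ) : ℕ → ℕ := fun i => Nat.casesOn i n ν

def DioForm.Holds : DioForm → (ℕ → ℕ) → Prop
  | .const i n, ν => ν i = n
  | .var i j, ν => ν i = ν j
  | .add i j k, ν => ν i = ν j + ν k
  | .mul i j k, ν => ν i = ν j * ν k
  | .and A B, ν => A.Holds ν ∧ B.Holds ν
  | .or A B, ν => A.Holds ν ∨ B.Holds ν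
  | .ex A, ν => ∃ n, A.Holds (liftVal ν n)

def DioForm.code : DioForm → ℕ
  | .const i n => Nat.pair 0 (Nat.pair i n)
  | .var i j => Nat.pair 1 (Nat.pair i j)
  | .add i j k => Nat.pair 2 (Nat.pair i (Nat.pair j k))
  | .mul i j k => Nat.pair 3 (Nat.pair i (Nat.pair j k))
  | .and A B => Nat.pair 4 (Nat.pair A.code B.code)
  | .or A B => Nat.pair 5 (Nat.pair A.code B.code)
  | .ex A => Nat.pair 6 A.code

theorem DioForm.code_injective : Function.Injective DioForm.code := by
  intro A
  induction A with
  | and A B hA hB =>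
    intro C h
    cases C <;> simp only [DioForm.code, Nat.pair_eq_pair] at h <;> try omega
    rw [hA h.2.1, hB h.2.2]
  | or A B hA hB =>
    intro C h
    cases C <;> simp only [DioForm.code, Nat.pair_eq_pair] at h <;> try omega
    rw [hA h.2.1, hB h.2.2]
  | ex A hA =>
    intro C h
    cases C <;> simp only [DioForm.code, Nat.pair_eq_pair] at h <;> try omega
    rw [hA h.2]
  | _ =>
    intro C h
    cases C <;> simp_all [DioForm.code, Nat.pair_eq_pair]

noncomputable instance : Encodable DioForm :=
  Encodable.ofInj DioForm.code DioForm.code_injective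

/-- Does the formula hold under the valuation? -/
def DIO_FORM (I : DioForm × (ℕ → ℕ)) : Prop := I.1.Holds I.2

/-! ## Elementary Diophantine constraints -/

/-- Elementary constraints on the existential variable `u`; `v`, `w` are existential variables
too, and `i` is a parameter. -/
inductive DioCstr : Type
  | const (u n : ℕ)
  | var (u v : ℕ)
  | param (u i : ℕ)
  | add (u v w : ℕ)
  | mul (u v w : ℕ)

def DioCstr.Holds (ν φ : ℕ → ℕ) : DioCstr → Prop
  | .const u n => φ u = n
  | .var u v => φ u = φ v
  | .param u i => φ u = ν i
  | .add u v w => φ u = φ v + φ w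
  | .mul u v w => φ u = φ v * φ w

def DioCstr.code : DioCstr → ℕ
  | .const u n => Nat.pair 0 (Nat.pair u n)
  | .var u v => Nat.pair 1 (Nat.pair u v)
  | .param u i => Nat.pair 2 (Nat.pair u i)
  | .add u v w => Nat.pair 3 (Nat.pair u (Nat.pair v w))
  | .mul u v w => Nat.pair 4 (Nat.pair u (Nat.pair v w))

theorem DioCstr.code_injective : Function.Injective DioCstr.code := by
  intro a b h
  cases a <;> cases b <;> simp_all [DioCstr.code, Nat.pair_eq_pair]

noncomputable instance : Encodable DioCstr :=
  Encodable.ofInj DioCstr.code DioCstr.code_injective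

/-- Is the list of constraints simultaneously satisfiable, for the given values of the
parameters? -/
def DIO_ELEM (I : List DioCstr × (ℕ → ℕ)) : Prop :=
  ∃ φ : ℕ → ℕ, ∀ c ∈ I.1, c.Holds I.2 φ

/-! ## Single Diophantine equations -/

/-- Diophantine polynomials with variables from `U` and parameters from `V`. -/
inductive DioPoly (U V : Type) : Type
  | var (u : U)
  | param (x : V)
  | const (n : ℕ)
  | add (p q : DioPoly U V)
  | mul (p q : DioPoly U V)

def DioPoly.eval {U V : Type} (ν : V → ℕ) (φ : U → ℕ) : DioPoly U V → ℕ
  | .var u => φ u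
  | .param x => ν x
  | .const n => n
  | .add p q => p.eval ν φ + q.eval ν φ
  | .mul p q => p.eval ν φ * q.eval ν φ

def DioPoly.code {U V : Type} [Encodable U] [Encodable V] : DioPoly U V → ℕ
  | .var u => Nat.pair 0 (Encodable.encode u)
  | .param x => Nat.pair 1 (Encodable.encode x)
  | .const n => Nat.pair 2 n
  | .add p q => Nat.pair 3 (Nat.pair p.code q.code)
  | .mul p q => Nat.pair 4 (Nat.pair p.code q.code)

theorem DioPoly.code_injective {U V : Type} [Encodable U] [Encodable V] :
    Function.Injective (DioPoly.code (U := U) (V := V)) := by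
  intro p
  induction p with
  | add p q hp hq =>
    intro r h
    cases r <;> simp only [DioPoly.code, Nat.pair_eq_pair] at h <;> try omega
    rw [hp h.2.1, hq h.2.2]
  | mul p q hp hq =>
    intro r h
    cases r <;> simp only [DioPoly.code, Nat.pair_eq_pair] at h <;> try omega
    rw [hp h.2.1, hq h.2.2]
  | _ =>
    intro r h
    cases r <;> simp_all [DioPoly.code, Nat.pair_eq_pair]

noncomputable instance {U V : Type} [Encodable U] [Encodable V] : Encodable (DioPoly U V) :=
  Encodable.ofInj DioPoly.code DioPoly.code_injective

/-- The equation `p = q`, given as the pair `(p, q)`. -/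
abbrev DioSingle (U V : Type) : Type := DioPoly U V × DioPoly U V

/-- Is the equation solvable, for the given values of the parameters? -/
def DIO_SINGLE (I : DioSingle ℕ ℕ × (ℕ → ℕ)) : Prop :=
  ∃ φ : ℕ → ℕ, I.1.1.eval I.2 φ = I.1.2.eval I.2 φ

/-- Hilbert's tenth problem over the natural numbers: is the given equation in `n` variables,
without parameters, solvable? -/
def H10 (I : Σ n : ℕ, DioSingle (Fin n) (Fin 0)) : Prop :=
  ∃ φ : Fin I.1 → ℕ, I.2.1.eval Fin.elim0 φ = I.2.2.eval Fin.elim0 φ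

end HilbertTenth

/-!
The reductions are not built as direct translations of one problem into the next. Each of the
problems is recursively enumerable (`RecEnum`), and for each of the targets every recursively
enumerable predicate of numbers reduces to it (`RecEnumHard`); by `RecEnum.reduces` this gives every
link of the chain except for the inclusion of the regular FRACTRAN programs. Since hardness concerns
one fixed predicate `p` at a time, the program, the formula, or the polynomial may depend on `p` in
any way, and only the input has to be computed from the number. An instance with a valuation `ν` is
no obstacle to recursive enumerability, because the code of its finite part bounds the indices `i`
for which `ν i` matters. `H10` is undecidable because the halting problem for partial recursive
functions is recursively enumerable (`RecEnumHard.not_decidable`).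

*Diophantine problems.* A recursively enumerable set is Diophantine
(`IsSigmaOne.exists_dioPoly`). Starting from Matiyasevich's theorem that exponentiation is
Diophantine, binomial coefficients are digits of powers, and factorials are quotients of a power by
a binomial coefficient. A bounded universal quantifier is eliminated with the moduli
`N / (k + 1) - 1`, `k < n`, where `N = (W !) ^ 2`: they are pairwise coprime, have only prime factors
larger than `W`, satisfy `N - 1 ≡ k`, and their product is `(N - 1).choose n`, so that one congruence
modulo this binomial coefficient expresses the equations for all `k < n` at once
(`forall_lt_exists_iff`). Together with Gödel's `β` function this represents primitive recursion
(`primrec'_dioph`). The polynomial equation can be split into elementary constraints, and these can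
be written as a formula; if the parameter is replaced by a constant, the result is an instance of
`H10`.

*Machines.* A primitive recursive function is computed by a structured loop program
(`computed_of_primrec'`), and such programs compile to Minsky machines with a register that is
always `0`. The machine that searches for a witness halts exactly on the predicate
(`IsSigmaOne.exists_mm`). Since no `DEC` jumps to itself, the usual coding of registers as exponents
of primes gives a FRACTRAN program that simulates the machine step by step (`fractranStep_iff`).

*Matching.* A state of a Minsky machine is represented by a word that has one letter for each unit
of each register, a marker, and a letter for the label. Rules that remove a prefix `u` and append
a suffix `v` let this word behave as a queue. The order of the register letters is irrelevant; a
register is recognized as zero if, between two encounters of the marker, no letter for it is met. A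
rule becomes the card `(u, v)`: in a partial match the queue is the part of the lower word that the
upper word has yet to match. To force the start card to be the first one, letters come in two
colours, and a card appends the colour opposite to that of the first letter it removes. Then the
two words of every other card differ in their first letters (`exists_match_iff`).

*Recursive enumerability.* Truth of formulas and values of polynomials are described by primitive
recursive rules of inference, and runs of machines by a primitive recursive step relation; what can
be derived, or reached, is recursively enumerable since a derivation is a finite list
(`IsSigmaOne.derives`, `IsSigmaOne.reflTransGen`).
-/

namespace HilbertTenth

open Encodable

/-! ### Recursively enumerable problems and hard problems -/

/-- `p` is recursively enumerable, in Kleene's normal form: `p a` says that a primitive recursive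
search for a witness succeeds. -/
def IsSigmaOne {α : Type} [Primcodable α] (p : α → Prop) : Prop :=
  ∃ R : α → ℕ → Prop, PrimrecRel R ∧ ∀ a, p a ↔ ∃ n, R a n

theorem _root_.Primrec.primrecPred_eq_true {α : Type} [Primcodable α] {f : α → Bool}
    (hf : Primrec f) : PrimrecPred fun a => f a = true :=
  Primrec.eq.comp hf (Primrec.const true)

/-- The witness of a recursively enumerable predicate may be any finite object. -/
theorem IsSigmaOne.of_exists {α β : Type} [Primcodable α] [Primcodable β] {p : α → Prop}
    {R : α → β → Prop} (hR : PrimrecRel R) (h : ∀ a, p a ↔ ∃ b, R a b) : IsSigmaOne p := by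
  classical
  refine ⟨fun a n => (decode (α := β) n).any (fun b => decide (R a b)) = true, ?_, fun a => ?_⟩
  · have hd : Primrec₂ fun (q : α × ℕ) (b : β) => decide (R q.1 b) :=
      (primrecRel_iff_primrec_decide.1 hR).comp (Primrec.fst.comp Primrec.fst) Primrec.snd
    refine Primrec.primrecPred_eq_true ((Primrec.option_casesOn
      (Primrec.decode.comp Primrec.snd) (Primrec.const false) hd).of_eq fun q => ?_)
    cases decode (α := β) q.2 <;> rfl
  · rw [h a]
    constructor
    · rintro ⟨b, hb⟩
      exact ⟨encode b, by simpa using hb⟩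
    · rintro ⟨n, hn⟩
      simp only [Option.any_eq_true, decide_eq_true_eq] at hn
      obtain ⟨b, -, hb⟩ := hn
      exact ⟨b, hb⟩

/-- Recursive enumerability of a predicate on codes: a number is to code a member of `p`. -/
theorem IsSigmaOne.on_codes {α : Type} [Primcodable α] {p : α → Prop} (hp : IsSigmaOne p) :
    IsSigmaOne fun n : ℕ => ∃ a ∈ decode (α := α) n, p a := by
  classical
  obtain ⟨R, hR, h⟩ := hp
  refine IsSigmaOne.of_exists (β := ℕ)
    (R := fun n k => (decode (α := α) n).any (fun a => decide (R a k)) = true) ?_ fun n => ?_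
  · have hd : Primrec₂ fun (q : ℕ × ℕ) (a : α) => decide (R a q.2) :=
      (primrecRel_iff_primrec_decide.1 hR).comp Primrec.snd (Primrec.snd.comp Primrec.fst)
    refine Primrec.primrecPred_eq_true ((Primrec.option_casesOn
      (Primrec.decode.comp Primrec.fst) (Primrec.const false) hd).of_eq fun q => ?_)
    cases decode (α := α) q.1 <;> rfl
  · simp only [Option.any_eq_true, decide_eq_true_eq, h]
    constructor
    · rintro ⟨a, ha, k, hk⟩
      exact ⟨k, a, ha, hk⟩
    · rintro ⟨k, a, ha, hk⟩
      exact ⟨a, ha, k, hk⟩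

/-- `P` is recursively enumerable on instances that may contain a valuation: after reading a
computably determined part of the name of an instance, its answer is that of a recursively
enumerable predicate of a number `r x` computed from that part. -/
def RecEnum {X : Type} [Named X] (P : X → Prop) : Prop :=
  ∃ (φ : List ℕ → Option ℕ) (r : X → ℕ) (p : ℕ → Prop), Computable φ ∧ IsSigmaOne p ∧
    (∀ x, (∀ k y, φ ((List.range k).map (Named.name x)) = some y → y = r x) ∧
      ∃ k, (φ ((List.range k).map (Named.name x))).isSome) ∧
    ∀ x, P x ↔ p (r x)

/-- Every recursively enumerable predicate of numbers is many-one reducible to `Q`. -/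
def RecEnumHard {Y : Type} [Named Y] (Q : Y → Prop) : Prop :=
  ∀ p : ℕ → Prop, IsSigmaOne p →
    ∃ g : ℕ → Y, (Computable₂ fun n m => Named.name (g n) m) ∧ ∀ n, p n ↔ Q (g n)

theorem RecEnum.reduces {X Y : Type} [Named X] [Named Y] {P : X → Prop} {Q : Y → Prop}
    (hP : RecEnum P) (hQ : RecEnumHard Q) : Reduces P Q := by
  obtain ⟨φ, r, p, hφ, hp, hr, hPp⟩ := hP
  obtain ⟨g, hg, hpg⟩ := hQ p hp
  refine ⟨fun x => g (r x), ⟨fun l m => (φ l).map fun n => Named.name (g n) m, ?_, ?_⟩,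
    fun x => (hPp x).trans (hpg _)⟩
  · refine Computable.option_map (hφ.comp Computable.fst) ?_
    exact hg.comp Computable.snd (Computable.snd.comp Computable.fst)
  · refine fun x m => ⟨fun k y h => ?_, ?_⟩
    · obtain ⟨n, hn, rfl⟩ := Option.map_eq_some_iff.1 h
      rw [(hr x).1 k n hn]
    · obtain ⟨k, hk⟩ := (hr x).2
      exact ⟨k, by simpa using hk⟩

theorem RecEnum.of_code {X α : Type} [Encodable X] [Primcodable α] {P : X → Prop} {p : α → Prop}
    (hp : IsSigmaOne p) (c : X → α) (hc : ∀ x, encode x = encode (c x))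
    (h : ∀ x, P x ↔ p (c x)) : RecEnum P := by
  refine ⟨List.head?, fun x => encode x, _, Primrec.list_head?.to_comp, hp.on_codes,
    fun x => ⟨fun k y hy => ?_, 1, ?_⟩, fun x => ?_⟩
  · cases k with
    | zero => simp at hy
    | succ k =>
      rw [List.range_succ_eq_map] at hy
      simpa [Named.name, eq_comm] using hy
  · simp [List.range_succ_eq_map]
  · simp [hc, h]

/-- The part of the name of `(x, ν)` that consists of the code `n` of `x` and of `ν i` for
`i ≤ n`. -/
def namePrefix {X : Type} [Encodable X] (x : X × (ℕ → ℕ)) : List ℕ :=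
  (List.range (encode x.1 + 2)).map (Named.name x)

theorem RecEnum.of_namePrefix {X : Type} [Encodable X] {P : X × (ℕ → ℕ) → Prop}
    {p : List ℕ → Prop} (hp : IsSigmaOne p) (h : ∀ x, P x ↔ p (namePrefix x)) : RecEnum P := by
  refine ⟨fun l => if l.headI + 2 ≤ l.length then some (encode (l.take (l.headI + 2))) else none,
    fun x => encode (namePrefix x), _, ?_, hp.on_codes, fun x => ?_, fun x => ?_⟩
  · have h2 : Primrec fun l : List ℕ => l.headI + 2 :=
      Primrec.nat_add.comp Primrec.list_headI (Primrec.const 2)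
    exact (Primrec.ite (Primrec.nat_le.comp h2 Primrec.list_length)
      (Primrec.option_some.comp (Primrec.encode.comp (Primrec.list_take.comp h2 Primrec.id)))
      (Primrec.const none)).to_comp
  · have hh : ∀ k, ((List.range (k + 1)).map (Named.name x)).headI = encode x.1 := fun k => by
      rw [List.range_succ_eq_map]; rfl
    constructor
    · intro k y hy
      cases k with
      | zero => simp at hy
      | succ k =>
        simp only [hh, List.length_map, List.length_range, Option.ite_none_right_eq_some,
          Option.some.injEq] at hy
        simp only [← hy.2, namePrefix, ← List.map_take, List.take_range, min_eq_left hy.1]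
    · refine ⟨encode x.1 + 1 + 1, ?_⟩
      simp only [hh]
      simp
  · simp [h]

/-- Every recursively enumerable predicate of numbers is the projection of a primitive recursive
function of two arguments, in the form that has no coding of pairs. -/
theorem IsSigmaOne.exists_primrec' {p : ℕ → Prop} (hp : IsSigmaOne p) :
    ∃ f : List.Vector ℕ 2 → ℕ, Nat.Primrec' f ∧
      ∀ x, p x ↔ ∃ k, f (List.Vector.ofFn ![x, k]) = 0 := by
  classical
  obtain ⟨R, hR, h⟩ := hp
  refine ⟨fun v => if R (v.get 0) (v.get 1) then 0 else 1, Nat.Primrec'.of_prim ?_, fun x => ?_⟩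
  · refine Primrec.ite (hR.comp ?_ ?_) (Primrec.const 0) (Primrec.const 1)
    · exact Primrec.vector_get.comp Primrec.id (Primrec.const 0)
    · exact Primrec.vector_get.comp Primrec.id (Primrec.const 1)
  · simp [h]

/-- A hard problem on finite objects is undecidable, because the halting problem is recursively
enumerable and undecidable. -/
theorem RecEnumHard.not_decidable {Y : Type} [Encodable Y] {Q : Y → Prop} (hQ : RecEnumHard Q) :
    ¬ AlgorithmicallyDecidable Q := by
  rintro ⟨d, hd, hdQ⟩
  have hK : IsSigmaOne fun c : Nat.Partrec.Code => (c.eval 0).Dom := by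
    refine IsSigmaOne.of_exists (β := ℕ)
      (R := fun c k => (Nat.Partrec.Code.evaln k c 0).isSome = true) ?_ fun c => ?_
    · exact Primrec.primrecPred_eq_true (Primrec.option_isSome.comp
        (Nat.Partrec.Code.primrec_evaln.comp
          (Primrec.pair (Primrec.pair Primrec.snd Primrec.fst) (Primrec.const 0))))
    · simp only [Part.dom_iff_mem, Nat.Partrec.Code.evaln_complete, Option.isSome_iff_exists]
      exact exists_comm
  obtain ⟨g, hg, hgQ⟩ := hQ _ hK.on_codes
  have hiff : ∀ c : Nat.Partrec.Code,
      d (Named.name (g (encode c)) 0) = true ↔ (c.eval 0).Dom := fun c => by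
    change d (encode (g (encode c))) = true ↔ _
    rw [← hdQ, ← hgQ]
    simp
  exact ComputablePred.halting_problem 0 (ComputablePred.computable_iff.2
    ⟨_, hd.comp (hg.comp Computable.encode (Computable.const 0)),
      funext fun c => propext (hiff c).symm⟩)

end HilbertTenth

namespace HilbertTenth

open Encodable

/-! ### Binomial coefficients and factorials are Diophantine -/

theorem digit_sum_lt {B : ℕ} {a : ℕ → ℕ} (ha : ∀ i, a i < B) (k : ℕ) :
    ∑ i ∈ Finset.range k, a i * B ^ i < B ^ k := by
  induction k with
  | zero => simp
  | succ k ih =>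
    rw [Finset.sum_range_succ, pow_succ]
    have := Nat.mul_le_mul_right (B ^ k) (Nat.succ_le_of_lt (ha k))
    rw [Nat.succ_mul] at this
    rw [mul_comm (B ^ k)]
    omega

theorem digit_sum_div_mod {B : ℕ} {a : ℕ → ℕ} (ha : ∀ i, a i < B) (k m : ℕ) :
    (∑ i ∈ Finset.range (k + 1 + m), a i * B ^ i) / B ^ k % B = a k := by
  have hB : 0 < B := (Nat.zero_le _).trans_lt (ha 0)
  rw [Finset.sum_range_add, Finset.sum_range_succ]
  have h : ∑ x ∈ Finset.range m, a (k + 1 + x) * B ^ (k + 1 + x) =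
      B ^ k * (B * ∑ x ∈ Finset.range m, a (k + 1 + x) * B ^ x) := by
    rw [Finset.mul_sum, Finset.mul_sum]
    refine Finset.sum_congr rfl fun i _ => ?_
    rw [pow_add, pow_succ]
    ring
  rw [h, mul_comm (a k), add_assoc, ← mul_add, Nat.add_mul_div_left _ _ (by positivity),
    Nat.div_eq_of_lt (digit_sum_lt ha k), zero_add, Nat.add_mul_mod_self_left,
    Nat.mod_eq_of_lt (ha k)]

/-- A binomial coefficient is a digit of `(1 + B) ^ n` in a large base `B`. -/
theorem choose_eq_digit (n k : ℕ) :
    n.choose k = (1 + (2 ^ n + 1)) ^ n / (2 ^ n + 1) ^ k % (2 ^ n + 1) := by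
  have ha : ∀ i, n.choose i < 2 ^ n + 1 := fun i => Nat.lt_succ_of_le (Nat.choose_le_two_pow _ _)
  have h : ∀ m, (1 + (2 ^ n + 1)) ^ n =
      ∑ i ∈ Finset.range (n + 1 + m), n.choose i * (2 ^ n + 1) ^ i := fun m => by
    rw [Finset.sum_range_add, Finset.sum_eq_zero (s := Finset.range m), add_zero, add_comm 1,
      add_pow]
    · simp [mul_comm]
    · intro i _
      rw [Nat.choose_eq_zero_of_lt (by omega), zero_mul]
  rw [h k, show n + 1 + k = k + 1 + n by ring, digit_sum_div_mod ha]

/-- For large `r`, the quotient `r ^ n / r.choose n` is close to `n!`. -/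
theorem factorial_eq_div (n : ℕ) :
    n.factorial = ((n ^ n + 1) * n ^ 2 + 1) ^ n / ((n ^ n + 1) * n ^ 2 + 1).choose n := by
  set r := (n ^ n + 1) * n ^ 2 + 1 with hr
  have hnr : n ≤ r := by nlinarith [Nat.zero_le (n ^ n), sq_nonneg n]
  have hc : 0 < r.choose n := Nat.choose_pos hnr
  have hd : n.factorial * r.choose n = r.descFactorial n :=
    (Nat.descFactorial_eq_factorial_mul_choose r n).symm
  symm
  rw [Nat.div_eq_iff hc]
  refine ⟨by rw [hd]; exact Nat.descFactorial_le_pow r n, ?_⟩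
  refine Nat.le_sub_one_of_lt ?_
  -- Bernoulli's inequality gives `r ^ n * (1 - n ^ 2 / r) ≤ r.descFactorial n`.
  have hr0 : (0 : ℚ) < r := by rw [hr]; positivity
  have hF : (n.factorial : ℚ) ≤ n ^ n := by exact_mod_cast Nat.factorial_le_pow n
  have hb : (1 : ℚ) + n * (-(n / r)) ≤ (1 + -(n / r)) ^ n := by
    apply one_add_mul_le_pow
    have : (n : ℚ) / r ≤ 1 := (div_le_one hr0).2 (by exact_mod_cast hnr)
    linarith
  have hq : ((r : ℚ) - n) ^ n ≤ r.descFactorial n := by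
    have h1 : (r - n) ^ n ≤ r.descFactorial n :=
      (Nat.pow_le_pow_left (by omega) n).trans (Nat.pow_sub_le_descFactorial r n)
    have h2 : ((r - n : ℕ) : ℚ) = r - n := Nat.cast_sub hnr
    rw [← h2]
    exact_mod_cast h1
  have h3 : (r : ℚ) ^ n * (1 - n ^ 2 / r) ≤ r.descFactorial n := by
    refine le_trans ?_ hq
    have : ((r : ℚ) - n) ^ n = r ^ n * (1 + -(n / r)) ^ n := by
      rw [← mul_pow]
      congr 1
      field_simp
      ring
    rw [this]
    refine mul_le_mul_of_nonneg_left (le_trans (le_of_eq ?_) hb) (by positivity)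
    ring
  have h4 : (n.factorial : ℚ) < (n.factorial + 1) * (1 - n ^ 2 / r) := by
    have h5 : ((n.factorial : ℚ) + 1) * (n ^ 2 / r) < 1 := by
      rw [← mul_div_assoc, div_lt_one hr0, hr]
      push_cast
      have : ((n.factorial : ℚ) + 1) * n ^ 2 ≤ (n ^ n + 1) * n ^ 2 := by gcongr
      linarith
    linarith
  have h6 : (n.factorial : ℚ) * r ^ n < (n.factorial + 1) * r.descFactorial n := by
    calc (n.factorial : ℚ) * r ^ n < (n.factorial + 1) * (1 - n ^ 2 / r) * r ^ n :=
          mul_lt_mul_of_pos_right h4 (by positivity)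
      _ = (n.factorial + 1) * (r ^ n * (1 - n ^ 2 / r)) := by ring
      _ ≤ _ := by gcongr
  have h7 : n.factorial * r ^ n < (n.factorial + 1) * r.descFactorial n := by exact_mod_cast h6
  rw [← hd, mul_left_comm] at h7
  have h8 := Nat.lt_of_mul_lt_mul_left h7
  rwa [add_mul, one_mul] at h8

section

open Dioph

variable {α : Type} {f g : (α → ℕ) → ℕ}

theorem choose_dioph (df : DiophFn f) (dg : DiophFn g) :
    DiophFn fun v => (f v).choose (g v) := by
  have h2 : DiophFn fun v => 2 ^ f v + 1 :=
    add_dioph (pow_dioph (const_dioph 2) df) (const_dioph 1)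
  have := mod_dioph (div_dioph (pow_dioph (add_dioph (const_dioph 1) h2) df) (pow_dioph h2 dg)) h2
  simp only [choose_eq_digit]
  exact this

theorem factorial_dioph (df : DiophFn f) : DiophFn fun v => (f v).factorial := by
  have hr : DiophFn fun v => (f v ^ f v + 1) * f v ^ 2 + 1 :=
    add_dioph (mul_dioph (add_dioph (pow_dioph df df) (const_dioph 1))
      (pow_dioph df (const_dioph 2))) (const_dioph 1)
  simp only [factorial_eq_div]
  exact div_dioph (pow_dioph hr df) (choose_dioph hr df)

theorem descFactorial_dioph (df : DiophFn f) (dg : DiophFn g) :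
    DiophFn fun v => (f v).descFactorial (g v) := by
  simp only [Nat.descFactorial_eq_factorial_mul_choose]
  exact mul_dioph (factorial_dioph dg) (choose_dioph df dg)

theorem forall_list_dioph {ι : Type} (l : List ι) (S : ι → Set (α → ℕ)) (h : ∀ i, Dioph (S i)) :
    Dioph {v | ∀ i ∈ l, v ∈ S i} := by
  induction l with
  | nil => exact Dioph.ext (eq_dioph (const_dioph 0) (const_dioph 0)) fun v => by simp
  | cons i l ih => exact Dioph.ext (Dioph.inter (h i) ih) fun v => by simp

end

/-! ### Diophantine sets and polynomial expressions -/

namespace DioPoly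

variable {U V : Type}

/-- Renaming of variables and parameters. -/
def rename {U' V' : Type} (f : U → U') (g : V → V') : DioPoly U V → DioPoly U' V'
  | .var u => .var (f u)
  | .param x => .param (g x)
  | .const n => .const n
  | .add p q => .add (p.rename f g) (q.rename f g)
  | .mul p q => .mul (p.rename f g) (q.rename f g)

theorem eval_rename {U' V' : Type} (f : U → U') (g : V → V') (p : DioPoly U V) (ν : V' → ℕ)
    (φ : U' → ℕ) : (p.rename f g).eval ν φ = p.eval (ν ∘ g) (φ ∘ f) := by
  induction p <;> simp_all [rename, eval]

/-- The list of the variables that occur. -/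
def vars : DioPoly U V → List U
  | .var u => [u]
  | .param _ => []
  | .const _ => []
  | .add p q => p.vars ++ q.vars
  | .mul p q => p.vars ++ q.vars

theorem eval_congr (p : DioPoly U V) {ν : V → ℕ} {φ ψ : U → ℕ} (h : ∀ u ∈ p.vars, φ u = ψ u) :
    p.eval ν φ = p.eval ν ψ := by
  induction p with
  | add p q hp hq | mul p q hp hq =>
    simp only [vars, List.mem_append] at h
    simp only [eval, hp fun u hu => h u (Or.inl hu), hq fun u hu => h u (Or.inr hu)]
  | _ => simp_all [vars, eval]

theorem eval_mono (p : DioPoly U V) {ν μ : V → ℕ} {φ ψ : U → ℕ} (h : ν ≤ μ)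
    (h' : ∀ u ∈ p.vars, φ u ≤ ψ u) : p.eval ν φ ≤ p.eval μ ψ := by
  induction p with
  | add p q hp hq =>
    simp only [vars, List.mem_append] at h'
    exact add_le_add (hp fun u hu => h' u (Or.inl hu)) (hq fun u hu => h' u (Or.inr hu))
  | mul p q hp hq =>
    simp only [vars, List.mem_append] at h'
    exact mul_le_mul' (hp fun u hu => h' u (Or.inl hu)) (hq fun u hu => h' u (Or.inr hu))
  | param x => exact h x
  | _ => simp_all [vars, eval]

theorem eval_modEq (p : DioPoly U V) {d : ℕ} {ν μ : V → ℕ} {φ ψ : U → ℕ}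
    (h : ∀ x, ν x ≡ μ x [MOD d]) (h' : ∀ u ∈ p.vars, φ u ≡ ψ u [MOD d]) :
    p.eval ν φ ≡ p.eval μ ψ [MOD d] := by
  induction p with
  | add p q hp hq =>
    simp only [vars, List.mem_append] at h'
    exact (hp fun u hu => h' u (Or.inl hu)).add (hq fun u hu => h' u (Or.inr hu))
  | mul p q hp hq =>
    simp only [vars, List.mem_append] at h'
    exact (hp fun u hu => h' u (Or.inl hu)).mul (hq fun u hu => h' u (Or.inr hu))
  | param x => exact h x
  | const n => rfl
  | var u => exact h' u (by simp [vars])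

theorem eval_dioph {α : Type} (p : DioPoly U V) {ν : V → (α → ℕ) → ℕ} {φ : U → (α → ℕ) → ℕ}
    (hν : ∀ x, Dioph.DiophFn (ν x)) (hφ : ∀ u, Dioph.DiophFn (φ u)) :
    Dioph.DiophFn fun v => p.eval (fun x => ν x v) fun u => φ u v := by
  induction p with
  | add p q hp hq => exact Dioph.add_dioph hp hq
  | mul p q hp hq => exact Dioph.mul_dioph hp hq
  | param x => exact hν x
  | const n => exact Dioph.const_dioph n
  | var u => exact hφ u

/-- A polynomial with integer coefficients is the difference of two expressions with natural
coefficients. -/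
theorem exists_sub_eq {α β : Type} {f : (α ⊕ β → ℕ) → ℤ} (hf : IsPoly f) :
    ∃ p q : DioPoly β α, ∀ ν φ, f (Sum.elim ν φ) = p.eval ν φ - q.eval ν φ := by
  induction hf with
  | proj i =>
    rcases i with x | u
    · exact ⟨.param x, .const 0, fun ν φ => by simp [eval]⟩
    · exact ⟨.var u, .const 0, fun ν φ => by simp [eval]⟩
  | const n => exact ⟨.const n.toNat, .const (-n).toNat, fun ν φ => by simp only [eval]; omega⟩
  | sub _ _ ihf ihg =>
    obtain ⟨p, q, h⟩ := ihf
    obtain ⟨p', q', h'⟩ := ihg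
    exact ⟨.add p q', .add q p', fun ν φ => by simp only [h, h', eval]; push_cast; ring⟩
  | mul _ _ ihf ihg =>
    obtain ⟨p, q, h⟩ := ihf
    obtain ⟨p', q', h'⟩ := ihg
    exact ⟨.add (.mul p p') (.mul q q'), .add (.mul p q') (.mul q p'),
      fun ν φ => by simp only [h, h', eval]; push_cast; ring⟩

/-- A Diophantine set is given by an equation between expressions with natural coefficients, in
finitely many of the variables `0, 1, …`. -/
theorem exists_of_dioph {α : Type} {S : Set (α → ℕ)} (hS : Dioph S) :
    ∃ p q : DioPoly ℕ α, ∀ ν, ν ∈ S ↔ ∃ φ : ℕ → ℕ, p.eval ν φ = q.eval ν φ := by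
  classical
  obtain ⟨β, f, hf⟩ := hS
  obtain ⟨p, q, h⟩ := exists_sub_eq f.isPoly
  have h' : ∀ ν, ν ∈ S ↔ ∃ φ, p.eval ν φ = q.eval ν φ := fun ν => by
    rw [hf]
    refine exists_congr fun φ => ?_
    rw [h]
    omega
  -- the finitely many variables that occur are numbered by their position in a list
  let l := p.vars ++ q.vars
  refine ⟨p.rename l.idxOf id, q.rename l.idxOf id, fun ν => ?_⟩
  simp only [eval_rename, Function.comp_id]
  rw [h']
  constructor
  · rintro ⟨φ, hφ⟩
    have key : ∀ u ∈ l, ((fun i => (l[i]?.map φ).getD 0) ∘ l.idxOf) u = φ u := fun u hu => by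
      simp [List.idxOf_lt_length_iff.2 hu]
    refine ⟨fun i => (l[i]?.map φ).getD 0, ?_⟩
    rw [eval_congr p fun u hu => key u (List.mem_append_left _ hu),
      eval_congr q fun u hu => key u (List.mem_append_right _ hu), hφ]
  · rintro ⟨φ, hφ⟩
    exact ⟨_, hφ⟩

end DioPoly

end HilbertTenth

namespace HilbertTenth

open Encodable

/-! ### Elimination of bounded universal quantifiers -/

/-- For `N` divisible by `1, …, n`, a binomial coefficient is the product of the moduli
`N / (k + 1) - 1`, `k < n`. -/
theorem choose_pred_eq_prod {N n : ℕ} (h : ∀ k < n, k + 1 ∣ N) :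
    (N - 1).choose n = ∏ k ∈ Finset.range n, (N / (k + 1) - 1) := by
  induction n with
  | zero => simp
  | succ n ih =>
    rw [Finset.prod_range_succ, ← ih fun k hk => h k (by omega)]
    refine Nat.eq_of_mul_eq_mul_right (show 0 < n + 1 by omega) ?_
    rw [Nat.choose_succ_right_eq, mul_assoc]
    congr 1
    obtain ⟨c, rfl⟩ := h n (Nat.lt_succ_self n)
    rw [Nat.mul_div_cancel_left _ (Nat.succ_pos n), Nat.sub_mul]
    rw [mul_comm c]
    omega

/-- The moduli `N / (k + 1) - 1` for `N = (W !) ^ 2`. -/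
def modulus (W k : ℕ) : ℕ := W.factorial * W.factorial / (k + 1) - 1

section

variable {W k : ℕ}

theorem mul_succ_modulus (hk : k + 1 ≤ W) :
    (modulus W k + 1) * (k + 1) = W.factorial * W.factorial := by
  have hd : k + 1 ∣ W.factorial := Nat.dvd_factorial (Nat.succ_pos k) hk
  have h1 : 1 ≤ W.factorial * W.factorial / (k + 1) :=
    Nat.div_pos (Nat.le_of_dvd (by positivity) (hd.mul_right _)) (Nat.succ_pos k)
  rw [modulus, Nat.sub_add_cancel h1, Nat.div_mul_cancel (hd.mul_right _)]

theorem dvd_succ_modulus (hk : k + 1 ≤ W) {d : ℕ} (hd : d ≠ 0) (hdW : d ≤ W) :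
    d ∣ modulus W k + 1 := by
  obtain ⟨c, hc⟩ : k + 1 ∣ W.factorial := Nat.dvd_factorial (Nat.succ_pos k) hk
  have h : modulus W k + 1 = c * W.factorial := by
    refine Nat.eq_of_mul_eq_mul_right (show 0 < k + 1 by omega) ?_
    rw [mul_succ_modulus hk]
    nth_rw 1 [hc]
    ring
  rw [h]
  exact (Nat.dvd_factorial (Nat.pos_of_ne_zero hd) hdW).mul_left _

theorem lt_of_dvd_modulus (hk : k + 1 ≤ W) {d : ℕ} (hd : d.Prime) (h : d ∣ modulus W k) :
    W < d := by
  by_contra hle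
  have h1 := dvd_succ_modulus hk hd.ne_zero (not_lt.1 hle)
  exact hd.one_lt.ne' (Nat.dvd_one.1 ((Nat.dvd_add_right h).1 h1))

theorem modulus_modEq (hk : k + 1 ≤ W) :
    W.factorial * W.factorial - 1 ≡ k [MOD modulus W k] := by
  rw [← mul_succ_modulus hk]
  have : (modulus W k + 1) * (k + 1) - 1 = k + modulus W k * (k + 1) := by
    rw [add_mul, one_mul]
    omega
  rw [this]
  simp [Nat.ModEq]

theorem one_lt_modulus (hW : 2 ≤ W) (hk : k + 2 ≤ W) : 1 < modulus W k := by
  have h1 := mul_succ_modulus (W := W) (k := k) (by omega)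
  have h2 : W ≤ W.factorial := Nat.self_le_factorial W
  by_contra h
  have h3 : modulus W k + 1 ≤ 2 := by omega
  have h4 : (modulus W k + 1) * (k + 1) ≤ 2 * (k + 1) := Nat.mul_le_mul_right _ h3
  nlinarith

theorem modulus_pairwise_coprime {n : ℕ} (hn : n < W) :
    (Finset.range n : Set ℕ).Pairwise (Function.onFun Nat.Coprime (modulus W)) := by
  intro i hi j hj hij
  simp only [Finset.coe_range, Set.mem_Iio] at hi hj
  refine Nat.Coprime.symm (Nat.coprime_of_dvd fun d hd hdj hdi => ?_)
  have h1 : i ≡ j [MOD d] :=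
    ((modulus_modEq (by omega)).of_dvd hdi).symm.trans ((modulus_modEq (by omega)).of_dvd hdj)
  have h2 := lt_of_dvd_modulus (by omega) hd hdi
  exact hij (Nat.ModEq.eq_of_lt_of_lt h1 (by omega) (by omega))

end

/-- The digits `φ k u` of a number `Z` in the residue number system of the moduli are bounded by
`b` if the product of the moduli divides `Z * (Z - 1) * ⋯ * (Z - b)`. The equation between `p`
and `q` for all `k < n` is then one congruence modulo the product of the moduli. -/
theorem forall_lt_exists_iff {α : Type} (p q : DioPoly ℕ (Option α)) (m n : ℕ) (ν : α → ℕ)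
    (hp : ∀ u ∈ p.vars, u < m) (hq : ∀ u ∈ q.vars, u < m) :
    (∀ k < n, ∃ φ : ℕ → ℕ,
        p.eval (fun o => o.elim k ν) φ = q.eval (fun o => o.elim k ν) φ) ↔
      ∃ (b : ℕ) (Z : ℕ → ℕ), ∃ W N M,
        W = p.eval (fun o => o.elim n ν) (fun _ => b) + q.eval (fun o => o.elim n ν) (fun _ => b) +
          b + n + 2 ∧ N = W.factorial * W.factorial ∧ M = (N - 1).choose n ∧
        p.eval (fun o => o.elim (N - 1) ν) Z ≡ q.eval (fun o => o.elim (N - 1) ν) Z [MOD M] ∧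
        ∀ i ∈ List.range m, M ∣ (Z i).descFactorial (b + 1) := by
  have hM : ∀ W, n < W → (W.factorial * W.factorial - 1).choose n =
      ∏ k ∈ Finset.range n, modulus W k := fun W hW => by
    refine choose_pred_eq_prod fun k hk => ?_
    exact (Nat.dvd_factorial (Nat.succ_pos k) (by omega)).mul_right _
  constructor
  · intro h
    choose φ hφ using h
    -- extend the choice of witnesses by `0`, and bound it
    let ψ : ℕ → ℕ → ℕ := fun k i => if hk : k < n then φ k hk i else 0
    have hψ : ∀ k < n, p.eval (fun o => o.elim k ν) (ψ k) = q.eval (fun o => o.elim k ν) (ψ k) :=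
      fun k hk => by simpa [ψ, hk] using hφ k hk
    let b := ∑ k ∈ Finset.range n, ∑ i ∈ Finset.range m, ψ k i
    have hb : ∀ k < n, ∀ i < m, ψ k i ≤ b := fun k hk i hi =>
      (Finset.single_le_sum (f := fun i => ψ k i) (fun _ _ => Nat.zero_le _)
        (Finset.mem_range.2 hi)).trans
      (Finset.single_le_sum (f := fun k => ∑ i ∈ Finset.range m, ψ k i) (fun _ _ => Nat.zero_le _)
        (Finset.mem_range.2 hk))
    let W := p.eval (fun o => o.elim n ν) (fun _ => b) +
      q.eval (fun o => o.elim n ν) (fun _ => b) + b + n + 2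
    have hn : n < W := by simp only [W]; omega
    have hcop := modulus_pairwise_coprime hn
    have hne : ∀ k ∈ Finset.range n, modulus W k ≠ 0 := fun k hk => by
      have := one_lt_modulus (W := W) (k := k) (by omega) (by simp at hk; omega)
      omega
    let Z : ℕ → ℕ := fun i =>
      (Nat.chineseRemainderOfFinset (fun k => ψ k i) (modulus W) (Finset.range n) hne hcop).1
    have hZ : ∀ i, ∀ k < n, Z i ≡ ψ k i [MOD modulus W k] := fun i k hk =>
      (Nat.chineseRemainderOfFinset (fun k => ψ k i) (modulus W) (Finset.range n) hne hcop).2 k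
        (Finset.mem_range.2 hk)
    have hprod : ∀ z : ℤ, (∀ k < n, (modulus W k : ℤ) ∣ z) →
        (((W.factorial * W.factorial - 1).choose n : ℕ) : ℤ) ∣ z := fun z hz => by
      rw [hM W hn, Nat.cast_prod]
      refine Finset.prod_dvd_of_coprime (fun i hi j hj hij => ?_)
        fun k hk => hz k (Finset.mem_range.1 hk)
      exact Nat.isCoprime_iff_coprime.2 (hcop hi hj hij)
    refine ⟨b, Z, W, _, _, rfl, rfl, rfl, ?_, fun i hi => ?_⟩
    · refine Nat.modEq_iff_dvd.2 (hprod _ fun k hk => Nat.modEq_iff_dvd.1 ?_)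
      have hν : ∀ o : Option α, o.elim (W.factorial * W.factorial - 1) ν ≡ o.elim k ν
          [MOD modulus W k] := fun o => by
        cases o with
        | none => exact modulus_modEq (by omega)
        | some x => rfl
      have h1 := p.eval_modEq hν fun u _ => hZ u k hk
      have h2 := q.eval_modEq hν fun u _ => hZ u k hk
      rw [hψ k hk] at h1
      exact h1.trans h2.symm
    · rw [← Int.natCast_dvd_natCast]
      refine hprod _ fun k hk => Int.natCast_dvd_natCast.2 ?_
      have hle := hb k hk i (List.mem_range.1 hi)
      rw [Nat.descFactorial_eq_prod_range]
      rcases Nat.lt_or_ge (Z i) (ψ k i) with hlt | hge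
      · have : ∏ j ∈ Finset.range (b + 1), (Z i - j) = 0 :=
          Finset.prod_eq_zero (i := Z i) (Finset.mem_range.2 (by omega)) (Nat.sub_self _)
        rw [this]
        exact dvd_zero _
      · exact ((Nat.modEq_iff_dvd' hge).1 (hZ i k hk).symm).trans
          (Finset.dvd_prod_of_mem (fun j => Z i - j) (Finset.mem_range.2 (by omega)))
  · rintro ⟨b, Z, W, N, M, hW, rfl, rfl, hmod, hZ⟩ k hk
    have hn : n < W := by omega
    rw [hM W hn] at hmod hZ
    -- a prime divisor of the modulus exceeds all values involved
    obtain ⟨d, hd, hdk⟩ := Nat.exists_prime_and_dvd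
      (one_lt_modulus (W := W) (k := k) (by omega) (by omega)).ne'
    have hdW := lt_of_dvd_modulus (by omega) hd hdk
    have hdM : d ∣ ∏ k ∈ Finset.range n, modulus W k :=
      hdk.trans (Finset.dvd_prod_of_mem _ (Finset.mem_range.2 hk))
    have hφ : ∀ i < m, Z i % d ≤ b := fun i hi => by
      have h1 := hdM.trans (hZ i (List.mem_range.2 hi))
      rw [Nat.descFactorial_eq_prod_range, hd.prime.dvd_finsetProd_iff] at h1
      obtain ⟨j, hj, hdj⟩ := h1
      have hj := Finset.mem_range.1 hj
      rcases Nat.lt_or_ge (Z i) j with hlt | hge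
      · exact (Nat.mod_le _ _).trans (by omega)
      · have h2 : j % d = Z i % d := (Nat.modEq_iff_dvd' hge).2 hdj
        rw [← h2]
        exact (Nat.mod_le _ _).trans (by omega)
    refine ⟨fun i => Z i % d, ?_⟩
    have hν : ∀ o : Option α, o.elim (W.factorial * W.factorial - 1) ν ≡ o.elim k ν
        [MOD d] := fun o => by
      cases o with
      | none => exact (modulus_modEq (by omega)).of_dvd hdk
      | some x => rfl
    have h1 := p.eval_modEq (φ := Z) (ψ := fun i => Z i % d) hν
      fun u _ => (Nat.mod_modEq _ _).symm
    have h2 := q.eval_modEq (φ := Z) (ψ := fun i => Z i % d) hν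
      fun u _ => (Nat.mod_modEq _ _).symm
    have hle : (fun o : Option α => o.elim k ν) ≤ fun o => o.elim n ν := fun o => by
      cases o with
      | none => exact hk.le
      | some x => exact le_rfl
    have hp' := p.eval_mono (φ := fun i => Z i % d) (ψ := fun _ => b) hle
      fun u hu => hφ u (hp u hu)
    have hq' := q.eval_mono (φ := fun i => Z i % d) (ψ := fun _ => b) hle
      fun u hu => hφ u (hq u hu)
    exact Nat.ModEq.eq_of_lt_of_lt (h1.symm.trans ((hmod.of_dvd hdM).trans h2))
      (by omega) (by omega)

open Dioph in
/-- Diophantine sets are closed under bounded universal quantification. -/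
theorem forall_lt_dioph {α : Type} {S : Set (Option α → ℕ)} (hS : Dioph S) {f : (α → ℕ) → ℕ}
    (df : DiophFn f) : Dioph {v : α → ℕ | ∀ k < f v, (fun o => o.elim k v) ∈ S} := by
  obtain ⟨p, q, h⟩ := DioPoly.exists_of_dioph hS
  obtain ⟨m, hm⟩ : ∃ m, ∀ u ∈ p.vars ++ q.vars, u < m :=
    ⟨(p.vars ++ q.vars).sum + 1, fun u hu => Nat.lt_succ_of_le (List.single_le_sum (by simp) u hu)⟩
  -- the coordinate `none` is the bound on the witnesses, `some i` holds the digits of the `i`-th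
  have hx : ∀ x : α, DiophFn fun w : α ⊕ Option ℕ → ℕ => w (Sum.inl x) :=
    fun x => proj_dioph (Sum.inl x)
  have hb : DiophFn fun w : α ⊕ Option ℕ → ℕ => w (Sum.inr none) := proj_dioph (Sum.inr none)
  have hZ : ∀ i : ℕ, DiophFn fun w : α ⊕ Option ℕ → ℕ => w (Sum.inr (some i)) :=
    fun i => proj_dioph (Sum.inr (some i))
  have hn : DiophFn fun w : α ⊕ Option ℕ → ℕ => f fun x => w (Sum.inl x) :=
    reindex_diophFn Sum.inl df
  have hν : ∀ {g : (α ⊕ Option ℕ → ℕ) → ℕ}, DiophFn g →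
      ∀ o : Option α, DiophFn fun w => o.elim (g w) fun x => w (Sum.inl x) := fun hg o => by
    cases o with
    | none => exact hg
    | some x => exact hx x
  have hW := add_dioph (add_dioph (add_dioph (add_dioph (p.eval_dioph (hν hn) fun _ => hb)
    (q.eval_dioph (hν hn) fun _ => hb)) hb) hn) (const_dioph 2)
  have hN := mul_dioph (factorial_dioph hW) (factorial_dioph hW)
  have hN1 := sub_dioph hN (const_dioph 1)
  have hM := choose_dioph hN1 hn
  have hmod := modEq_dioph (p.eval_dioph (hν hN1) hZ) (q.eval_dioph (hν hN1) hZ) hM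
  have hdvd := forall_list_dioph (List.range m) _ fun i =>
    dvd_dioph hM (descFactorial_dioph (hZ i) (add_dioph hb (const_dioph 1)))
  refine Dioph.ext (ex_dioph (hmod.inter hdvd)) fun v => ?_
  simp only [Set.mem_ofPred_eq, h]
  rw [forall_lt_exists_iff p q m (f v) v (fun u hu => hm u (List.mem_append_left _ hu))
    fun u hu => hm u (List.mem_append_right _ hu)]
  constructor
  · rintro ⟨x, h1, h2⟩
    exact ⟨x none, fun i => x (some i), _, _, _, rfl, rfl, rfl, h1, h2⟩
  · rintro ⟨b, Z, _, _, _, rfl, rfl, rfl, h1, h2⟩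
    exact ⟨fun o => o.elim b Z, h1, h2⟩

end HilbertTenth

namespace HilbertTenth

open Encodable

/-! ### Recursively enumerable sets are Diophantine -/

open Dioph in
/-- Primitive recursive functions are Diophantine. A recursion is unfolded into the sequence of its
values, coded by Gödel's `β` function, and a bounded quantifier. -/
theorem primrec'_dioph {n : ℕ} {f : List.Vector ℕ n → ℕ} (hf : Nat.Primrec' f) :
    ∀ {α : Type} (g : Fin n → (α → ℕ) → ℕ), (∀ i, DiophFn (g i)) →
      DiophFn fun v => f (List.Vector.ofFn fun i => g i v) := by
  induction hf with
  | zero => exact fun _ _ => const_dioph 0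
  | succ =>
    intro α g hg
    refine (add_dioph (hg 0) (const_dioph 1) : DiophFn fun v => g 0 v + 1)
  | get i =>
    intro α g hg
    simpa using hg i
  | comp h _ _ ihf ihh =>
    intro α g hg
    exact ihf _ fun i => ihh i g hg
  | @prec n f h _ _ ihf ihh =>
    intro α g hg
    -- `F v k` is the `k`-th value of the recursion
    let F : (α → ℕ) → ℕ → ℕ := fun v k =>
      k.rec (f (List.Vector.ofFn fun i => g i.succ v))
        fun y IH => h (y ::ᵥ IH ::ᵥ List.Vector.ofFn fun i => g i.succ v)
    have hF : DiophFn fun v => F v (g 0 v) := by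
      let β : ℕ → ℕ → ℕ → ℕ := fun a b i => a % ((i + 1) * b + 1)
      have hβ : ∀ {γ : Type} {a b i : (γ → ℕ) → ℕ}, DiophFn a → DiophFn b → DiophFn i →
          DiophFn fun w => β (a w) (b w) (i w) := fun ha hb hi =>
        mod_dioph ha (add_dioph (mul_dioph (add_dioph hi (const_dioph 1)) hb) (const_dioph 1))
      -- the parameters are joined by the value (`none`) and the two numbers that code the sequence
      let γ := Option α ⊕ Bool
      have ha : DiophFn fun w : γ → ℕ => w (Sum.inr true) := proj_dioph (Sum.inr true)
      have hb : DiophFn fun w : γ → ℕ => w (Sum.inr false) := proj_dioph (Sum.inr false)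
      have hy : DiophFn fun w : γ → ℕ => w (Sum.inl none) := proj_dioph (Sum.inl none)
      have hg' : ∀ i, DiophFn fun w : γ → ℕ => g i fun x => w (Sum.inl (some x)) := fun i =>
        reindex_diophFn (fun x => Sum.inl (some x)) (hg i)
      have h0 := eq_dioph (hβ ha hb (const_dioph 0)) (ihf _ fun i => hg' i.succ)
      have h1 := eq_dioph (hβ ha hb (hg' 0)) hy
      have hk : DiophFn fun w : Option γ → ℕ => w none := proj_dioph none
      have ha' : DiophFn fun w : Option γ → ℕ => w (some (Sum.inr true)) := proj_dioph _
      have hb' : DiophFn fun w : Option γ → ℕ => w (some (Sum.inr false)) := proj_dioph _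
      have hs := eq_dioph (hβ ha' hb' (add_dioph hk (const_dioph 1)))
        (ihh (Fin.cons (fun w : Option γ → ℕ => w none)
          (Fin.cons (fun w => β (w (some (Sum.inr true))) (w (some (Sum.inr false))) (w none))
            fun i w => g i.succ fun x => w (some (Sum.inl (some x)))))
          (Fin.cases hk (Fin.cases (hβ ha' hb' hk)
            fun i => reindex_diophFn (fun x => some (Sum.inl (some x))) (hg i.succ))))
      refine Dioph.ext (ex_dioph ((h0.inter h1).inter (forall_lt_dioph hs (hg' 0)))) fun v => ?_
      constructor
      · rintro ⟨x, ⟨h0, h1⟩, hs⟩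
        have key : ∀ k ≤ g 0 (v ∘ some), β (x true) (x false) k = F (v ∘ some) k := by
          intro k hk
          induction k with
          | zero => exact h0
          | succ k ih =>
            have := hs k hk
            refine this.trans ?_
            change h (k ::ᵥ β (x true) (x false) k ::ᵥ _) = _
            rw [ih (by omega)]
            rfl
        exact (key _ le_rfl).symm.trans h1
      · intro hv
        let l := (List.range (g 0 (v ∘ some) + 1)).map (F (v ∘ some))
        have key : ∀ k ≤ g 0 (v ∘ some),
            β (Nat.unbeta l).unpair.1 (Nat.unbeta l).unpair.2 k = F (v ∘ some) k := fun k hk => by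
          have := Nat.beta_unbeta_coe l ⟨k, by simp [l]; omega⟩
          rw [Nat.beta] at this
          simpa [l] using this
        refine ⟨fun c => bif c then (Nat.unbeta l).unpair.1 else (Nat.unbeta l).unpair.2,
          ⟨key 0 (Nat.zero_le _), (key _ le_rfl).trans hv⟩, fun k hk => ?_⟩
        refine (key (k + 1) hk).trans ?_
        change _ = h (k ::ᵥ β (Nat.unbeta l).unpair.1 (Nat.unbeta l).unpair.2 k ::ᵥ _)
        rw [key k (le_of_lt hk)]
        rfl
    have hcongr : ∀ v, F v (g 0 v) = (List.Vector.ofFn fun i => g i v).head.rec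
        (f (List.Vector.ofFn fun i => g i v).tail)
        fun y IH => h (y ::ᵥ IH ::ᵥ (List.Vector.ofFn fun i => g i v).tail) := fun v => by
      simp [F, List.Vector.ofFn]
    simpa only [hcongr] using hF

/-- **Davis–Putnam–Robinson–Matiyasevich**: a recursively enumerable set of numbers is Diophantine,
with the number as the only parameter. -/
theorem IsSigmaOne.exists_dioPoly {p : ℕ → Prop} (hp : IsSigmaOne p) :
    ∃ P Q : DioPoly ℕ ℕ, ∀ x, p x ↔
      ∃ φ : ℕ → ℕ, P.eval (fun _ => x) φ = Q.eval (fun _ => x) φ := by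
  obtain ⟨f, hf, h⟩ := hp.exists_primrec'
  have h1 := Dioph.eq_dioph (primrec'_dioph hf (α := Option Unit)
    ![fun w => w (some ()), fun w => w none] (by
      intro i
      fin_cases i
      · exact Dioph.proj_dioph (some ())
      · exact Dioph.proj_dioph none)) (Dioph.const_dioph 0)
  obtain ⟨P, Q, h2⟩ := DioPoly.exists_of_dioph (Dioph.ex1_dioph h1)
  refine ⟨P.rename id fun _ => 0, Q.rename id fun _ => 0, fun x => ?_⟩
  simp only [DioPoly.eval_rename, Function.comp_id]
  refine Iff.trans ?_ (h2 fun _ => x)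
  rw [h]
  refine exists_congr fun k => ?_
  have : (fun i => ![fun w : Option Unit → ℕ => w (some ()), fun w => w none] i
      (Option.elim' k fun _ => x)) = ![x, k] := by
    ext i
    fin_cases i <;> rfl
  rw [← this]
  rfl

end HilbertTenth

namespace HilbertTenth

open Encodable

/-! ### Hardness of the Diophantine problems -/

theorem dioSingle_hard : RecEnumHard DIO_SINGLE := by
  intro p hp
  obtain ⟨P, Q, h⟩ := hp.exists_dioPoly
  refine ⟨fun n => ((P, Q), fun _ => n), ?_, h⟩
  exact (Primrec.nat_casesOn (f := fun x : ℕ × ℕ => x.2) (g := fun _ => encode (P, Q))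
    (h := fun x _ => x.1) Primrec.snd (Primrec.const _) (Primrec.fst.comp Primrec.fst)).to_comp

/-- The expression without parameters that arises by giving all parameters the value `n`. The
variables are to be at most `m`. -/
def DioPoly.close (m n : ℕ) : DioPoly ℕ ℕ → DioPoly (Fin (m + 1)) (Fin 0)
  | .var u => .var (Fin.ofNat (m + 1) u)
  | .param _ => .const n
  | .const k => .const k
  | .add p q => .add (p.close m n) (q.close m n)
  | .mul p q => .mul (p.close m n) (q.close m n)

theorem DioPoly.eval_close (m n : ℕ) (p : DioPoly ℕ ℕ) (φ : Fin (m + 1) → ℕ) :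
    (p.close m n).eval Fin.elim0 φ = p.eval (fun _ => n) fun u => φ (Fin.ofNat (m + 1) u) := by
  induction p <;> simp_all [DioPoly.close, DioPoly.eval]

theorem DioPoly.primrec_code_close (m : ℕ) (p : DioPoly ℕ ℕ) :
    Primrec fun n => (p.close m n).code := by
  induction p with
  | var u => exact Primrec.const _
  | const k => exact Primrec.const _
  | param x => exact Primrec₂.natPair.comp (Primrec.const 2) Primrec.id
  | add p q hp hq =>
    exact Primrec₂.natPair.comp (Primrec.const 3) (Primrec₂.natPair.comp hp hq)
  | mul p q hp hq =>
    exact Primrec₂.natPair.comp (Primrec.const 4) (Primrec₂.natPair.comp hp hq)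

theorem h10_hard : RecEnumHard H10 := by
  intro p hp
  obtain ⟨P, Q, h⟩ := hp.exists_dioPoly
  obtain ⟨m, hm⟩ : ∃ m, ∀ u ∈ P.vars ++ Q.vars, u ≤ m :=
    ⟨(P.vars ++ Q.vars).sum, fun u hu => List.single_le_sum (by simp) u hu⟩
  refine ⟨fun n => ⟨m + 1, (P.close m n, Q.close m n)⟩, ?_, fun n => ?_⟩
  · exact (Primrec₂.natPair.comp (Primrec.const (m + 1))
      (Primrec₂.natPair.comp ((P.primrec_code_close m).comp Primrec.fst)
        ((Q.primrec_code_close m).comp Primrec.fst))).to_comp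
  · simp only [H10, DioPoly.eval_close]
    rw [h]
    constructor
    · rintro ⟨φ, hφ⟩
      have key : ∀ u ∈ P.vars ++ Q.vars, φ ↑(Fin.ofNat (m + 1) u) = φ u := fun u hu => by
        rw [Fin.val_ofNat, Nat.mod_eq_of_lt (Nat.lt_succ_of_le (hm u hu))]
      refine ⟨fun i => φ i, ?_⟩
      rw [P.eval_congr fun u hu => key u (List.mem_append_left _ hu),
        Q.eval_congr fun u hu => key u (List.mem_append_right _ hu), hφ]
    · rintro ⟨φ, hφ⟩
      exact ⟨_, hφ⟩

/-- Elementary constraints that describe the evaluation of an expression. The existential variable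
that stands for the value of a subexpression is the code of the subexpression. -/
def DioPoly.cstrs : DioPoly ℕ ℕ → List DioCstr
  | .var _ => []
  | .param x => [.param (DioPoly.param x : DioPoly ℕ ℕ).code x]
  | .const n => [.const (DioPoly.const n : DioPoly ℕ ℕ).code n]
  | .add p q => .add (DioPoly.add p q).code p.code q.code :: (p.cstrs ++ q.cstrs)
  | .mul p q => .mul (DioPoly.mul p q).code p.code q.code :: (p.cstrs ++ q.cstrs)

theorem DioPoly.eval_of_cstrs {ν φ : ℕ → ℕ} (p : DioPoly ℕ ℕ) (h : ∀ c ∈ p.cstrs, c.Holds ν φ) :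
    φ p.code = p.eval ν fun u => φ (DioPoly.var u : DioPoly ℕ ℕ).code := by
  induction p with
  | add p q hp hq | mul p q hp hq =>
    simp only [DioPoly.cstrs, List.mem_cons, List.mem_append] at h
    have := h _ (Or.inl rfl)
    simp only [DioCstr.Holds] at this
    rw [this, hp fun c hc => h c (Or.inr (Or.inl hc)), hq fun c hc => h c (Or.inr (Or.inr hc))]
    rfl
  | var u => rfl
  | _ => simpa [DioPoly.cstrs, DioPoly.eval, DioCstr.Holds] using h

theorem DioPoly.cstrs_hold {ν φ ψ : ℕ → ℕ} (hψ : ∀ p : DioPoly ℕ ℕ, ψ p.code = p.eval ν φ)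
    (p : DioPoly ℕ ℕ) : ∀ c ∈ p.cstrs, c.Holds ν ψ := by
  induction p with
  | add p q hp hq | mul p q hp hq =>
    simp only [DioPoly.cstrs, List.mem_cons, List.mem_append]
    rintro c (rfl | hc | hc)
    · simp only [DioCstr.Holds, hψ, DioPoly.eval]
    · exact hp c hc
    · exact hq c hc
  | _ => simp [DioPoly.cstrs, DioPoly.eval, DioCstr.Holds, hψ]

theorem IsSigmaOne.exists_cstrs {p : ℕ → Prop} (hp : IsSigmaOne p) :
    ∃ E : List DioCstr, ∀ x, p x ↔ DIO_ELEM (E, fun _ => x) := by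
  classical
  obtain ⟨P, Q, h⟩ := hp.exists_dioPoly
  refine ⟨.var P.code Q.code :: (P.cstrs ++ Q.cstrs), fun x => (h x).trans ?_⟩
  simp only [DIO_ELEM, List.mem_cons, List.mem_append]
  constructor
  · rintro ⟨φ, hφ⟩
    -- `ψ` decodes the name of a subexpression and evaluates it
    let ψ : ℕ → ℕ := fun n =>
      if hn : ∃ p : DioPoly ℕ ℕ, p.code = n then hn.choose.eval (fun _ => x) φ else 0
    have hψ : ∀ p : DioPoly ℕ ℕ, ψ p.code = p.eval (fun _ => x) φ := fun p => by
      have hn : ∃ q : DioPoly ℕ ℕ, q.code = p.code := ⟨p, rfl⟩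
      simp only [ψ, dif_pos hn, DioPoly.code_injective hn.choose_spec]
    refine ⟨ψ, ?_⟩
    rintro c (rfl | hc | hc)
    · simp only [DioCstr.Holds, hψ, hφ]
    · exact P.cstrs_hold hψ c hc
    · exact Q.cstrs_hold hψ c hc
  · rintro ⟨ψ, hψ⟩
    have h0 := hψ _ (Or.inl rfl)
    simp only [DioCstr.Holds] at h0
    rw [P.eval_of_cstrs fun c hc => hψ c (Or.inr (Or.inl hc)),
      Q.eval_of_cstrs fun c hc => hψ c (Or.inr (Or.inr hc))] at h0
    exact ⟨_, h0⟩

theorem dioElem_hard : RecEnumHard DIO_ELEM := by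
  intro p hp
  obtain ⟨E, h⟩ := hp.exists_cstrs
  refine ⟨fun n => (E, fun _ => n), ?_, h⟩
  exact (Primrec.nat_casesOn (f := fun x : ℕ × ℕ => x.2) (g := fun _ => encode E)
    (h := fun x _ => x.1) Primrec.snd (Primrec.const _) (Primrec.fst.comp Primrec.fst)).to_comp

/-- A constraint as an atomic formula, the existential variables being the innermost `m` de Bruijn
indices. -/
def DioCstr.toForm (m : ℕ) : DioCstr → DioForm
  | .const u n => .const u n
  | .var u v => .var u v
  | .param u i => .var u (m + i)
  | .add u v w => .add u v w
  | .mul u v w => .mul u v w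

/-- A strict upper bound of the existential variables of a constraint. -/
def DioCstr.bound : DioCstr → ℕ
  | .const u _ => u + 1
  | .var u v => u + v + 1
  | .param u _ => u + 1
  | .add u v w => u + v + w + 1
  | .mul u v w => u + v + w + 1

/-- The valuation `ν` with `φ 0, …, φ (m - 1)` pushed in front. -/
def joinVal (m : ℕ) (φ ν : ℕ → ℕ) : ℕ → ℕ := fun i => if i < m then φ i else ν (i - m)

theorem DioCstr.holds_toForm {m : ℕ} (c : DioCstr) (hc : c.bound ≤ m) (ν φ : ℕ → ℕ) :
    (c.toForm m).Holds (joinVal m φ ν) ↔ c.Holds ν φ := by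
  have key : ∀ u, u < m → joinVal m φ ν u = φ u := fun u hu => if_pos hu
  have key' : ∀ i, joinVal m φ ν (m + i) = ν i := fun i => by simp [joinVal]
  cases c <;> simp only [DioCstr.bound] at hc <;>
    simp only [DioCstr.toForm, DioForm.Holds, DioCstr.Holds, key'] <;>
    repeat rw [key _ (by omega)]

theorem DioForm.holds_foldr_and (l : List DioForm) (ν : ℕ → ℕ) :
    (l.foldr DioForm.and (.var 0 0)).Holds ν ↔ ∀ A ∈ l, A.Holds ν := by
  induction l <;> simp_all [DioForm.Holds]

theorem joinVal_succ (m : ℕ) (φ ν : ℕ → ℕ) :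
    joinVal (m + 1) φ ν = joinVal m φ (liftVal ν (φ m)) := by
  funext i
  simp only [joinVal, liftVal]
  rcases lt_trichotomy i m with hi | rfl | hi
  · simp [hi, Nat.lt_succ_of_lt hi]
  · simp
  · obtain ⟨k, rfl⟩ : ∃ k, i = m + 1 + k := ⟨i - (m + 1), by omega⟩
    rw [if_neg (by omega), if_neg (by omega), show m + 1 + k - m = k + 1 by omega,
      Nat.add_sub_cancel_left]

theorem DioForm.holds_iterate_ex (m : ℕ) (A : DioForm) (ν : ℕ → ℕ) :
    (DioForm.ex^[m] A).Holds ν ↔ ∃ φ, A.Holds (joinVal m φ ν) := by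
  induction m generalizing ν with
  | zero =>
    have : ∀ φ, joinVal 0 φ ν = ν := fun φ => funext fun i => by simp [joinVal]
    simp [this]
  | succ m ih =>
    rw [Function.iterate_succ_apply']
    simp only [DioForm.Holds, ih, joinVal_succ]
    constructor
    · rintro ⟨n, φ, h⟩
      refine ⟨fun i => if i < m then φ i else n, ?_⟩
      convert! h using 1
      funext i
      by_cases hi : i < m <;> simp [joinVal, hi]
    · rintro ⟨φ, h⟩
      exact ⟨φ m, φ, h⟩

theorem dioForm_hard : RecEnumHard DIO_FORM := by
  intro p hp
  obtain ⟨E, h⟩ := hp.exists_cstrs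
  obtain ⟨m, hm⟩ : ∃ m, ∀ c ∈ E, c.bound ≤ m :=
    ⟨(E.map DioCstr.bound).sum, fun c hc =>
      List.single_le_sum (by simp) _ (List.mem_map_of_mem hc)⟩
  let A := DioForm.ex^[m] ((E.map (DioCstr.toForm m)).foldr DioForm.and (.var 0 0))
  refine ⟨fun n => (A, fun _ => n), ?_, fun n => (h n).trans ?_⟩
  · exact (Primrec.nat_casesOn (f := fun x : ℕ × ℕ => x.2) (g := fun _ => encode A)
      (h := fun x _ => x.1) Primrec.snd (Primrec.const _) (Primrec.fst.comp Primrec.fst)).to_comp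
  · simp only [DIO_ELEM, DIO_FORM, A, DioForm.holds_iterate_ex, DioForm.holds_foldr_and,
      List.mem_map, forall_exists_index, and_imp, forall_apply_eq_imp_iff₂]
    exact exists_congr fun φ => forall₂_congr fun c hc => (c.holds_toForm (hm c hc) _ _).symm

end HilbertTenth

namespace HilbertTenth

open Encodable

/-! ### Loop programs for primitive recursive functions -/

/-- Structured programs on registers `0, 1, …`; decrementing leaves the value `0` unchanged, and
`loop r P` repeats `P` while register `r` is positive. -/
inductive Prog : Type
  | inc (r : ℕ)
  | dec (r : ℕ)
  | seq (P Q : Prog)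
  | loop (r : ℕ) (P : Prog)

/-- `Exec P v w`: the program `P`, started on the registers `v`, terminates with `w`. -/
inductive Exec : Prog → (ℕ → ℕ) → (ℕ → ℕ) → Prop
  | inc (r v) : Exec (.inc r) v (Function.update v r (v r + 1))
  | dec (r v) : Exec (.dec r) v (Function.update v r (v r - 1))
  | seq {P Q u v w} : Exec P u v → Exec Q v w → Exec (.seq P Q) u w
  | loop_zero {r P v} : v r = 0 → Exec (.loop r P) v v
  | loop_succ {r P u v w} : u r ≠ 0 → Exec P u v → Exec (.loop r P) v w → Exec (.loop r P) u w

theorem Exec.congr {P : Prog} {u v w : ℕ → ℕ} (h : Exec P u v) (hw : v = w) : Exec P u w := hw ▸ h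

theorem exec_loop {r : ℕ} {P : Prog} (m : ℕ) (s : ℕ → ℕ → ℕ)
    (h : ∀ i < m, s i r ≠ 0 ∧ Exec P (s i) (s (i + 1))) (hm : s m r = 0) :
    Exec (.loop r P) (s 0) (s m) := by
  induction m generalizing s with
  | zero => exact .loop_zero hm
  | succ m ih =>
    exact .loop_succ (h 0 (Nat.succ_pos m)).1 (h 0 (Nat.succ_pos m)).2
      (ih (fun i => s (i + 1)) (fun i hi => h (i + 1) (by omega)) hm)

/-- The program that sets register `r` to `0`. -/
def Prog.clear (r : ℕ) : Prog := .loop r (.dec r)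

theorem exec_clear (r : ℕ) (v : ℕ → ℕ) : Exec (.clear r) v (Function.update v r 0) := by
  have := exec_loop (r := r) (P := .dec r) (v r) (fun i => Function.update v r (v r - i))
    (fun i hi => ⟨by simp; omega, (Exec.dec _ _).congr (by
      funext x; by_cases hx : x = r <;> simp [hx]; omega)⟩) (by simp)
  simpa [Prog.clear] using this

/-- Copying a register to another one, by way of a third register that holds `0`. -/
theorem exists_exec_copy {r s t : ℕ} (hr : r ≠ t) (hs : s ≠ t) :
    ∃ P, ∀ v : ℕ → ℕ, v t = 0 → Exec P v (Function.update v r (v s)) := by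
  by_cases hrs : r = s
  · subst hrs
    exact ⟨.clear t, fun v hv => (exec_clear t v).congr (by simp [← hv])⟩
  refine ⟨.seq (.clear r) (.seq (.loop s (.seq (.dec s) (.seq (.inc r) (.inc t))))
    (.loop t (.seq (.dec t) (.inc s)))), fun v hv => .seq (exec_clear r v) (.seq
      (v := fun x => if x = s then 0 else if x = r then v s else if x = t then v s else v x)
      ?_ ?_)⟩
  · have := exec_loop (r := s) (P := .seq (.dec s) (.seq (.inc r) (.inc t))) (v s)
      (fun i x => if x = s then v s - i else if x = r then i else if x = t then i else v x)
      (fun i hi => ⟨by simp; omega,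
        ((Exec.dec _ _).seq ((Exec.inc _ _).seq (Exec.inc _ _))).congr (by
          funext x; simp only [Function.update_apply]; grind)⟩) (by simp)
    convert! this using 1
    · funext x; simp only [Function.update_apply]; grind
    · funext x; simp
  · have := exec_loop (r := t) (P := .seq (.dec t) (.inc s)) (v s)
      (fun i x => if x = s then i else if x = r then v s else if x = t then v s - i else v x)
      (fun i hi => ⟨by grind, ((Exec.dec _ _).seq (Exec.inc _ _)).congr (by
          funext x; simp only [Function.update_apply]; grind)⟩) (by grind)
    convert! this using 1
    funext x; simp only [Function.update_apply]; grind

/-- `f` can be computed from any input registers `ins` into any output register `out`, with the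
registers from `b` on as scratch memory, which is `0` before and after. -/
def Computed {n : ℕ} (f : List.Vector ℕ n → ℕ) : Prop :=
  ∀ (ins : Fin n → ℕ) (out b : ℕ), (∀ i, ins i < b) → out < b →
    ∃ P, ∀ v : ℕ → ℕ, (∀ r, b ≤ r → v r = 0) →
      Exec P v (Function.update v out (f (List.Vector.ofFn fun i => v (ins i))))

theorem exists_exec_clear_range (b j : ℕ) :
    ∃ P, ∀ v : ℕ → ℕ, Exec P v fun x => if b ≤ x ∧ x < b + j then 0 else v x := by
  induction j with
  | zero =>
    refine ⟨.seq (.inc 0) (.dec 0), fun v => ((Exec.inc _ _).seq (Exec.dec _ _)).congr ?_⟩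
    funext x; simp only [Function.update_apply]; grind
  | succ j ih =>
    obtain ⟨P, hP⟩ := ih
    refine ⟨.seq P (.clear (b + j)), fun v => ((hP v).seq (exec_clear _ _)).congr ?_⟩
    funext x; simp only [Function.update_apply]; grind

theorem Computed.comp {m n : ℕ} {f : List.Vector ℕ m → ℕ} {g : Fin m → List.Vector ℕ n → ℕ}
    (hf : Computed f) (hg : ∀ i, Computed (g i)) :
    Computed fun a => f (List.Vector.ofFn fun i => g i a) := by
  intro ins out b hins hout
  -- the values of the functions `g i` are stored in the registers `b + i`
  have key : ∀ j ≤ m, ∃ P, ∀ v : ℕ → ℕ, (∀ r, b ≤ r → v r = 0) → Exec P v fun x =>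
      if h : b ≤ x ∧ x < b + j ∧ x - b < m then
        g ⟨x - b, h.2.2⟩ (List.Vector.ofFn fun i => v (ins i)) else v x := by
    intro j hj
    induction j with
    | zero =>
      obtain ⟨P, hP⟩ := exists_exec_clear_range b 0
      refine ⟨P, fun v _ => (hP v).congr ?_⟩
      funext x; grind
    | succ j ih =>
      obtain ⟨P, hP⟩ := ih (by omega)
      obtain ⟨Q, hQ⟩ := hg ⟨j, hj⟩ ins (b + j) (b + m) (fun i => (hins i).trans_le (by omega))
        (by omega)
      refine ⟨.seq P Q, fun v hv => ((hP v hv).seq (hQ _ fun r hr => ?_)).congr ?_⟩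
      · rw [dif_neg (by omega), hv r (by omega)]
      · have h1 : ∀ i, ¬ (b ≤ ins i ∧ ins i < b + j ∧ ins i - b < m) := fun i => by
          have := hins i
          omega
        simp only [h1, dif_neg, not_false_eq_true]
        funext x
        rcases lt_trichotomy x (b + j) with hx | rfl | hx
        · rw [Function.update_of_ne (by omega)]
          grind
        · rw [Function.update_self, dif_pos (by omega)]
          congr 1
          simp
        · rw [Function.update_of_ne (by omega)]
          grind
  obtain ⟨P, hP⟩ := key m le_rfl
  obtain ⟨Q, hQ⟩ := hf (fun i => b + i) out (b + m) (fun i => by omega) (by omega)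
  obtain ⟨R, hR⟩ := exists_exec_clear_range b m
  refine ⟨.seq P (.seq Q R), fun v hv =>
    ((hP v hv).seq ((hQ _ fun r hr => ?_).seq (hR _))).congr ?_⟩
  · rw [dif_neg (by omega), hv r (by omega)]
  · have h1 : ∀ i : Fin m, b ≤ b + (i : ℕ) ∧ b + (i : ℕ) < b + m ∧ b + (i : ℕ) - b < m :=
      fun i => by omega
    have h2 : ∀ i : Fin m, (⟨b + (i : ℕ) - b, (h1 i).2.2⟩ : Fin m) = i := fun i =>
      Fin.ext (Nat.add_sub_cancel_left _ _)
    simp only [h1, and_self, dite_true, h2]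
    funext x
    simp only [Function.update_apply]
    split_ifs with h3 h4 h4 h5
    · omega
    · exact (hv x h3.1).symm
    · rfl
    · omega
    · rfl

theorem Computed.prec {n : ℕ} {f : List.Vector ℕ n → ℕ} {g : List.Vector ℕ (n + 2) → ℕ}
    (hf : Computed f) (hg : Computed g) :
    Computed fun v : List.Vector ℕ (n + 1) =>
      v.head.rec (f v.tail) fun y IH => g (y ::ᵥ IH ::ᵥ v.tail) := by
  intro ins out b hins hout
  -- `b` counts down, `b + 1` counts up, `b + 2` holds the value reached, `b + 3` the next value
  obtain ⟨P₀, h₀⟩ := exists_exec_copy (r := b) (s := ins 0) (t := b + 3) (by omega)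
    (by have := hins 0; omega)
  obtain ⟨P₁, h₁⟩ := hf (fun i => ins i.succ) (b + 2) (b + 4)
    (fun i => (hins _).trans (by omega)) (by omega)
  obtain ⟨P₂, h₂⟩ := hg (Fin.cons (b + 1) (Fin.cons (b + 2) fun i => ins i.succ)) (b + 3) (b + 4)
    (Fin.cases (by simp) (Fin.cases (by simp) fun i => by
      simp only [Fin.cons_succ]; exact (hins _).trans (by omega))) (by omega)
  obtain ⟨P₃, h₃⟩ := exists_exec_copy (r := b + 2) (s := b + 3) (t := b + 4) (by omega) (by omega)
  obtain ⟨P₄, h₄⟩ := exists_exec_copy (r := out) (s := b + 2) (t := b + 3) (by omega) (by omega)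
  obtain ⟨P₅, h₅⟩ := exists_exec_clear_range (b + 1) 2
  let body := Prog.seq (.dec b) (.seq P₂ (.seq P₃ (.seq (.clear (b + 3)) (.inc (b + 1)))))
  refine ⟨.seq P₀ (.seq P₁ (.seq (.loop b body) (.seq P₄ P₅))), fun v hv => ?_⟩
  let T : List.Vector ℕ n := List.Vector.ofFn fun i => v (ins i.succ)
  let F : ℕ → ℕ := fun k => k.rec (f T) fun y IH => g (y ::ᵥ IH ::ᵥ T)
  let s : ℕ → ℕ → ℕ := fun i x =>
    if x = b then v (ins 0) - i else if x = b + 1 then i else if x = b + 2 then F i else v x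
  have hins' : ∀ i, ins i ≠ b ∧ ins i ≠ b + 1 ∧ ins i ≠ b + 2 ∧ ins i ≠ b + 3 := fun i => by
    have := hins i
    omega
  have hs : ∀ i j, s i (ins j) = v (ins j) := fun i j => by simp [s, hins']
  have e₁ : Exec (.seq P₀ P₁) v (s 0) := by
    refine ((h₀ v (hv _ (by omega))).seq (h₁ _ fun r hr => ?_)).congr ?_
    · rw [Function.update_of_ne (by omega), hv r (by omega)]
    · have h1 : ∀ i : Fin n, Function.update v b (v (ins 0)) (ins i.succ) = v (ins i.succ) :=
        fun i => Function.update_of_ne (hins' _).1 _ _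
      have h2 : v (b + 1) = 0 := hv _ (by omega)
      have h3 : F 0 = f T := rfl
      simp only [h1]
      funext x
      simp only [Function.update_apply, s, h3, T]
      grind
  have e₂ : ∀ i < v (ins 0), s i b ≠ 0 ∧ Exec body (s i) (s (i + 1)) := by
    intro i hi
    refine ⟨by simp only [s, if_true]; omega, ?_⟩
    have h0 : ∀ r, b + 3 ≤ r → Function.update (s i) b (s i b - 1) r = 0 := fun r hr => by
      rw [Function.update_of_ne (by omega)]
      simp only [s]
      rw [if_neg (by omega), if_neg (by omega), if_neg (by omega), hv r (by omega)]
    refine ((Exec.dec _ _).seq ((h₂ _ fun r hr => h0 r (by omega)).seq ((h₃ _ ?_).seq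
      ((exec_clear _ _).seq (Exec.inc _ _))))).congr ?_
    · rw [Function.update_of_ne (by omega), h0 _ (by omega)]
    · have hF : F (i + 1) = g (i ::ᵥ F i ::ᵥ T) := rfl
      have hvec : (List.Vector.ofFn fun j : Fin (n + 2) => Function.update (s i) b (s i b - 1)
          ((Fin.cons (b + 1) (Fin.cons (b + 2) fun i => ins i.succ) : Fin (n + 2) → ℕ) j)) =
          i ::ᵥ F i ::ᵥ T := by
        simp only [List.Vector.ofFn, Fin.cons_zero, Fin.cons_succ]
        congr 1
        · simp [s]
        congr 1
        · simp [s]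
        · simp only [T]
          congr 1
          funext j
          rw [Function.update_of_ne (hins' _).1, hs]
      have h3 : v (b + 3) = 0 := hv _ (by omega)
      simp only [hvec, ← hF]
      funext x
      simp only [Function.update_apply, s]
      grind
  have e₃ := exec_loop (P := body) (v (ins 0)) s e₂ (by simp [s])
  have e₄ : Exec (.seq P₄ P₅) (s (v (ins 0))) (Function.update v out (F (v (ins 0)))) := by
    refine ((h₄ _ ?_).seq (h₅ _)).congr ?_
    · simp [s, hv (b + 3)]
    · have h0 : v b = 0 := hv _ (by omega)
      have h1 : v (b + 1) = 0 := hv _ (by omega)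
      have h2 : v (b + 2) = 0 := hv _ (by omega)
      funext x
      simp only [Function.update_apply, s]
      grind
  cases e₁ with
  | seq e₁ e₁' =>
    refine (e₁.seq (e₁'.seq (e₃.seq e₄))).congr ?_
    simp [F, T, List.Vector.ofFn]

theorem computed_of_primrec' {n : ℕ} {f : List.Vector ℕ n → ℕ} (hf : Nat.Primrec' f) :
    Computed f := by
  induction hf with
  | zero => exact fun ins out b _ _ => ⟨.clear out, fun v _ => exec_clear out v⟩
  | succ =>
    intro ins out b hins hout
    have := hins 0
    obtain ⟨P, hP⟩ := exists_exec_copy (r := b) (s := ins 0) (t := b + 1) (by omega) (by omega)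
    obtain ⟨Q, hQ⟩ := exists_exec_copy (r := out) (s := b) (t := b + 1) (by omega) (by omega)
    refine ⟨.seq P (.seq (.inc b) (.seq Q (.clear b))), fun v hv =>
      ((hP v (hv _ (by omega))).seq ((Exec.inc _ _).seq ((hQ _ ?_).seq (exec_clear _ _)))).congr
        ?_⟩
    · simp [hv]
    · have h0 : v b = 0 := hv _ le_rfl
      funext x
      simp only [Function.update_apply, List.Vector.ofFn, List.Vector.head_cons]
      grind
  | get i =>
    intro ins out b hins hout
    have := hins i
    obtain ⟨P, hP⟩ := exists_exec_copy (r := out) (s := ins i) (t := b) (by omega) (by omega)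
    exact ⟨P, fun v hv => (hP v (hv b le_rfl)).congr (by simp)⟩
  | comp g _ _ ihf ihg => exact ihf.comp ihg
  | prec _ _ ihf ihg => exact ihf.prec ihg

end HilbertTenth

namespace HilbertTenth

open Encodable Relation

/-! ### Hardness of termination of Minsky machines -/

/-- The registers of a machine with `N + 1` registers: register `r` of a structured program is
register `r + 1`, and register `0`, which always holds `0`, serves for unconditional jumps. -/
def machineRegs (N : ℕ) (v : ℕ → ℕ) : Fin (N + 1) → ℕ := fun i => Nat.casesOn i.val 0 v

/-- Register `r` of a structured program, as a register of the machine. -/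
def machineReg (N r : ℕ) : Fin (N + 1) := Fin.ofNat (N + 1) (r + 1)

theorem machineReg_val {N r : ℕ} (h : r < N) : (machineReg N r).val = r + 1 := by
  rw [machineReg, Fin.val_ofNat, Nat.mod_eq_of_lt (by omega)]

theorem machineRegs_machineReg {N r : ℕ} (h : r < N) (v : ℕ → ℕ) :
    machineRegs N v (machineReg N r) = v r := by
  rw [machineRegs, machineReg_val h]

theorem machineRegs_zero (N : ℕ) (v : ℕ → ℕ) : machineRegs N v 0 = 0 := rfl

theorem machineRegs_update {N r : ℕ} (h : r < N) (v : ℕ → ℕ) (x : ℕ) :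
    machineRegs N (Function.update v r x) =
      Function.update (machineRegs N v) (machineReg N r) x := by
  funext i
  have hi : i = machineReg N r ↔ i.val = r + 1 := by rw [Fin.ext_iff, machineReg_val h]
  rw [Function.update_apply]
  simp only [hi]
  obtain ⟨i, hi'⟩ := i
  cases i <;> simp [machineRegs, Function.update_apply]

namespace Prog

/-- A strict upper bound of the registers used. -/
def bound : Prog → ℕ
  | inc r => r + 1
  | dec r => r + 1
  | seq P Q => P.bound + Q.bound
  | loop r P => r + 1 + P.bound

/-- The code of a structured program, to be placed at label `s`. -/
def compile (N : ℕ) : Prog → ℕ → List (MMInstr (N + 1))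
  | inc r, _ => [.inc (machineReg N r)]
  | dec r, s => [.dec (machineReg N r) (s + 1)]
  | seq P Q, s => P.compile N s ++ Q.compile N (s + (P.compile N s).length)
  | loop r P, s =>
    .dec (machineReg N r) (s + (P.compile N (s + 2)).length + 3) :: .inc (machineReg N r) ::
      (P.compile N (s + 2) ++ [.dec 0 s])

theorem compile_no_self_loop {N : ℕ} (P : Prog) (s j : ℕ) (a : Fin (N + 1)) (p : ℕ)
    (h : (P.compile N s)[j]? = some (.dec a p)) : p ≠ s + j := by
  induction P generalizing s j with
  | inc r =>
    cases j <;> simp [compile] at h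
  | dec r =>
    cases j with
    | zero =>
      simp only [compile, List.getElem?_cons_zero, Option.some.injEq, MMInstr.dec.injEq] at h
      omega
    | succ j => simp [compile] at h
  | seq P Q hP hQ =>
    rw [compile, List.getElem?_append] at h
    split_ifs at h with hj
    · exact hP s j h
    · have := hQ _ _ h
      omega
  | loop r P hP =>
    rw [compile] at h
    match j with
    | 0 =>
      simp only [List.getElem?_cons_zero, Option.some.injEq, MMInstr.dec.injEq] at h
      omega
    | 1 => simp at h
    | j + 2 =>
      simp only [List.getElem?_cons_succ, List.getElem?_append] at h
      split_ifs at h with hj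
      · have := hP _ _ h
        omega
      · rcases Nat.eq_zero_or_pos (j - (P.compile N (s + 2)).length) with h0 | h0
        · simp only [h0, List.getElem?_cons_zero, Option.some.injEq, MMInstr.dec.injEq] at h
          omega
        · rw [List.getElem?_eq_none (by simp only [List.length_singleton]; exact h0)] at h
          exact absurd h (by simp)

end Prog

section

variable {n : ℕ}

theorem MMStep.of_inc {A B : List (MMInstr n)} {a : Fin n} (v : Fin n → ℕ) :
    MMStep 1 (A ++ .inc a :: B) (1 + A.length, v)
      (1 + A.length + 1, Function.update v a (v a + 1)) :=
  .inc _ _ _ (by simp)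

theorem MMStep.of_dec_pos {A B : List (MMInstr n)} {a : Fin n} {p : ℕ} {v : Fin n → ℕ}
    (h : v a ≠ 0) :
    MMStep 1 (A ++ .dec a p :: B) (1 + A.length, v)
      (1 + A.length + 1, Function.update v a (v a - 1)) :=
  .dec_succ _ _ p _ _ (by simp) (by omega)

theorem MMStep.of_dec_zero {A B : List (MMInstr n)} {a : Fin n} {p : ℕ} {v : Fin n → ℕ}
    (h : v a = 0) : MMStep 1 (A ++ .dec a p :: B) (1 + A.length, v) (p, v) :=
  .dec_zero _ _ _ _ (by simp) h

end

/-- A complete round through a loop takes at least one step. -/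
theorem transGen_loop {N r : ℕ} {P : Prog} {v w : ℕ → ℕ} (hr : r < N) (h0 : v r ≠ 0)
    (hP : ∀ A B : List (MMInstr (N + 1)),
      ReflTransGen (MMStep 1 (A ++ P.compile N (1 + A.length) ++ B)) (1 + A.length, machineRegs N v)
        (1 + A.length + (P.compile N (1 + A.length)).length, machineRegs N w))
    (A B : List (MMInstr (N + 1))) :
    TransGen (MMStep 1 (A ++ (Prog.loop r P).compile N (1 + A.length) ++ B))
      (1 + A.length, machineRegs N v) (1 + A.length, machineRegs N w) := by
  set body := P.compile N (1 + A.length + 2) with hbody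
  set I₁ : MMInstr (N + 1) := .dec (machineReg N r) (1 + A.length + body.length + 3) with hI₁
  set I₂ : MMInstr (N + 1) := .inc (machineReg N r) with hI₂
  set I₃ : MMInstr (N + 1) := .dec 0 (1 + A.length) with hI₃
  have hC : A ++ (Prog.loop r P).compile N (1 + A.length) ++ B =
      A ++ I₁ :: I₂ :: (body ++ I₃ :: B) := by
    simp [Prog.compile, hbody, hI₁, hI₂, hI₃]
  rw [hC]
  have h1 : MMStep 1 (A ++ I₁ :: I₂ :: (body ++ I₃ :: B)) (1 + A.length, machineRegs N v)
      (1 + A.length + 1, machineRegs N (Function.update v r (v r - 1))) := by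
    rw [machineRegs_update hr, ← machineRegs_machineReg hr v]
    exact MMStep.of_dec_pos (by rwa [machineRegs_machineReg hr])
  have h2 : MMStep 1 (A ++ I₁ :: I₂ :: (body ++ I₃ :: B))
      (1 + A.length + 1, machineRegs N (Function.update v r (v r - 1)))
      (1 + A.length + 2, machineRegs N v) := by
    have := MMStep.of_inc (A := A ++ [I₁]) (B := body ++ I₃ :: B) (a := machineReg N r)
      (machineRegs N (Function.update v r (v r - 1)))
    rw [← machineRegs_update hr, machineRegs_machineReg hr, Function.update_self,
      Function.update_idem, Nat.sub_add_cancel (Nat.pos_of_ne_zero h0),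
      Function.update_eq_self] at this
    simpa [← add_assoc] using this
  have h3 := hP (A ++ [I₁, I₂]) (I₃ :: B)
  simp only [List.length_append, List.length_cons, List.length_nil, zero_add, List.append_assoc,
    List.cons_append, List.nil_append, Nat.reduceAdd, ← add_assoc, ← hbody] at h3
  have h4 : MMStep 1 (A ++ I₁ :: I₂ :: (body ++ I₃ :: B))
      (1 + A.length + 2 + body.length, machineRegs N w) (1 + A.length, machineRegs N w) := by
    have := MMStep.of_dec_zero (A := A ++ I₁ :: I₂ :: body) (B := B) (a := 0)
      (p := 1 + A.length) (machineRegs_zero N w)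
    simp only [List.length_append, List.length_cons, List.append_assoc, List.cons_append] at this
    convert! this using 2
    omega
  exact (TransGen.head h1 (TransGen.head' h2 h3)).tail h4

/-- The code of a structured program simulates it. -/
theorem Exec.reflTransGen {N : ℕ} {P : Prog} {v w : ℕ → ℕ} (h : Exec P v w) (hN : P.bound ≤ N)
    (A B : List (MMInstr (N + 1))) :
    ReflTransGen (MMStep 1 (A ++ P.compile N (1 + A.length) ++ B))
      (1 + A.length, machineRegs N v)
      (1 + A.length + (P.compile N (1 + A.length)).length, machineRegs N w) := by
  induction h generalizing A B with
  | inc r v =>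
    rw [machineRegs_update hN, ← machineRegs_machineReg hN v]
    refine .single ?_
    simpa [Prog.compile] using
      MMStep.of_inc (A := A) (B := B) (a := machineReg N r) (machineRegs N v)
  | dec r v =>
    refine .single ?_
    simp only [Prog.compile, List.append_assoc, List.cons_append, List.nil_append]
    by_cases h0 : v r = 0
    · have : Function.update v r (v r - 1) = v := by rw [h0, Function.update_eq_self_iff, h0]
      rw [this]
      exact MMStep.of_dec_zero (by rw [machineRegs_machineReg hN, h0])
    · rw [machineRegs_update hN, ← machineRegs_machineReg hN v]
      exact MMStep.of_dec_pos (by rwa [machineRegs_machineReg hN])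
  | @seq P Q u v w _ _ hP hQ =>
    simp only [Prog.bound] at hN
    have h1 := hP (by omega) A
      (Q.compile N (1 + A.length + (P.compile N (1 + A.length)).length) ++ B)
    have h2 := hQ (by omega) (A ++ P.compile N (1 + A.length)) B
    simp only [List.length_append, ← add_assoc, List.append_assoc] at h1 h2
    simp only [Prog.compile, List.length_append, ← add_assoc, List.append_assoc]
    exact h1.trans h2
  | @loop_zero r P v h0 =>
    refine .single ?_
    have h1 : 1 + A.length + (Prog.compile N (.loop r P) (1 + A.length)).length =
        1 + A.length + (P.compile N (1 + A.length + 2)).length + 3 := by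
      simp only [Prog.compile, List.length_cons, List.length_append, List.length_nil]
      omega
    rw [h1]
    simp only [Prog.compile, List.append_assoc, List.cons_append]
    refine MMStep.of_dec_zero ?_
    rw [machineRegs_machineReg (by simp only [Prog.bound] at hN; omega), h0]
  | @loop_succ r P u v w h0 _ _ hP hL =>
    have hN' := hN
    simp only [Prog.bound] at hN'
    exact (transGen_loop (by omega) h0 (hP (by omega)) A B).to_reflTransGen.trans (hL hN A B)

/-- In a deterministic system, a state from which a terminal state can be reached starts no infinite
computation. -/
theorem acc_of_reflTransGen {σ : Type} {R : σ → σ → Prop} (hR : ∀ a b c, R a b → R a c → b = c)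
    {a d : σ} (h : ReflTransGen R a d) (hd : ∀ b, ¬ R d b) : Acc (flip R) a := by
  induction h using ReflTransGen.head_induction_on with
  | refl => exact ⟨_, fun b hb => absurd hb (hd b)⟩
  | @head a c hac _ ih => exact ⟨_, fun b hb => hR _ _ _ hac hb ▸ ih⟩

/-- The effect of an instruction on a state. -/
def MMInstr.next {n : ℕ} (c : ℕ × (Fin n → ℕ)) : MMInstr n → ℕ × (Fin n → ℕ)
  | .inc a => (c.1 + 1, Function.update c.2 a (c.2 a + 1))
  | .dec a p => if c.2 a = 0 then (p, c.2) else (c.1 + 1, Function.update c.2 a (c.2 a - 1))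

theorem mmStep_iff {n s : ℕ} {C : List (MMInstr n)} {c d : ℕ × (Fin n → ℕ)} :
    MMStep s C c d ↔ ∃ j I, c.1 = s + j ∧ C[j]? = some I ∧ d = I.next c := by
  constructor
  · rintro (⟨j, a, v, h⟩ | ⟨j, a, p, k, v, h, hv⟩ | ⟨j, a, p, v, h, hv⟩)
    · exact ⟨j, _, rfl, h, rfl⟩
    · exact ⟨j, _, rfl, h, by simp [MMInstr.next, hv]⟩
    · exact ⟨j, _, rfl, h, by simp [MMInstr.next, hv]⟩
  · obtain ⟨pc, v⟩ := c
    rintro ⟨j, I, rfl, h, rfl⟩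
    cases I with
    | inc a => exact .inc _ _ _ h
    | dec a p =>
      by_cases hv : v a = 0
      · simpa [MMInstr.next, hv] using MMStep.dec_zero (s := s) j a p v h hv
      · simpa [MMInstr.next, hv] using
          MMStep.dec_succ (s := s) j a p (v a - 1) v h (by omega)

theorem MMStep.deterministic {n s : ℕ} {C : List (MMInstr n)} (a b c : ℕ × (Fin n → ℕ))
    (hb : MMStep s C a b) (hc : MMStep s C a c) : b = c := by
  obtain ⟨j, I, h1, h2, rfl⟩ := mmStep_iff.1 hb
  obtain ⟨j', I', h1', h2', rfl⟩ := mmStep_iff.1 hc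
  obtain rfl : j = j' := by omega
  rw [h2, Option.some.injEq] at h2'
  rw [h2']

/-- A state is terminal if and only if its label is outside of the code. -/
theorem forall_not_mmStep_iff {n s : ℕ} {C : List (MMInstr n)} {c : ℕ × (Fin n → ℕ)} :
    (∀ d, ¬ MMStep s C c d) ↔ c.1 < s ∨ C.length + s ≤ c.1 := by
  constructor
  · intro h
    by_contra hc
    refine h _ (mmStep_iff.2 ⟨c.1 - s, C[c.1 - s], by omega, List.getElem?_eq_getElem _, rfl⟩)
  · rintro hc d hd
    obtain ⟨j, I, h1, h2, -⟩ := mmStep_iff.1 hd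
    have := (List.getElem?_eq_some_iff.1 h2).1
    omega

/-- Every recursively enumerable predicate is the halting problem of a Minsky machine, which
searches for a witness. No instruction of the machine jumps to itself. -/
theorem IsSigmaOne.exists_mm {p : ℕ → Prop} (hp : IsSigmaOne p) :
    ∃ (n : ℕ) (C : List (MMInstr n)) (i : Fin n),
      (∀ j a q, C[j]? = some (.dec a q) → q ≠ 1 + j) ∧
      (∀ x, p x → ∃ w, ReflTransGen (MMStep 1 C) (1, Pi.single i x) (1 + C.length, w)) ∧
      ∀ x, MMTerminates 1 C (1, Pi.single i x) → p x := by
  obtain ⟨f, hf, h⟩ := hp.exists_primrec'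
  -- the input is in register `0`, the candidate in `1`, the value of `f` in `2`
  obtain ⟨P, hP⟩ := computed_of_primrec' hf ![0, 1] 2 3
    (by intro i; fin_cases i <;> simp) (by omega)
  let F : ℕ → ℕ → ℕ := fun x k => f (List.Vector.ofFn ![x, k])
  let σ : ℕ → ℕ → ℕ → ℕ := fun x k r =>
    if r = 0 then x else if r = 1 then k else if r = 2 then F x k else 0
  have hP' : ∀ x k (v : ℕ → ℕ), v 0 = x → v 1 = k → (∀ r, 3 ≤ r → v r = 0) →
      Exec P v (σ x k) := fun x k v h0 h1 hv => by
    refine (hP v hv).congr ?_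
    have : (fun i => v (![0, 1] i)) = ![x, k] := by
      funext i
      fin_cases i <;> simp [h0, h1]
    rw [this]
    funext r
    simp only [Function.update_apply, σ, F]
    have := hv r
    grind
  let body := Prog.seq (.inc 1) P
  have hbody : ∀ x k, Exec body (σ x k) (σ x (k + 1)) := fun x k =>
    (Exec.inc _ _).seq (hP' x (k + 1) _ (by simp [σ]) (by simp [σ])
      fun r hr => by simp [σ, show r ≠ 0 by omega, show r ≠ 1 by omega, show r ≠ 2 by omega])
  let M := Prog.seq P (.loop 2 body)
  let N := M.bound
  have hN : P.bound + (3 + body.bound) = N := rfl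
  let C := M.compile N 1
  have hinput : ∀ x, Pi.single (machineReg N 0) x =
      machineRegs N fun r => if r = 0 then x else 0 := fun x => by
    have h0 : (fun r => if r = 0 then x else 0) = Function.update (fun _ => 0) 0 x := by
      funext r
      simp [Function.update_apply]
    have h1 : (0 : Fin (N + 1) → ℕ) = machineRegs N fun _ => 0 := by
      funext i
      obtain ⟨i, hi⟩ := i
      cases i <;> rfl
    rw [h0, machineRegs_update (by omega), ← h1]
    rfl
  have hstart : ∀ x, Exec P (fun r => if r = 0 then x else 0) (σ x 0) := fun x =>
    hP' x 0 _ (by simp) (by simp) fun r hr => by simp [show r ≠ 0 by omega]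
  refine ⟨N + 1, C, machineReg N 0, M.compile_no_self_loop 1, fun x => ?_, fun x => ?_⟩ <;>
    rw [h, hinput]
  · intro hk
    classical
    have hloop : Exec (.loop 2 body) (σ x 0) (σ x (Nat.find hk)) :=
      exec_loop (Nat.find hk) (σ x) (fun i hi => ⟨Nat.find_min hk hi, hbody x i⟩)
        (Nat.find_spec hk)
    have := ((hstart x).seq hloop).reflTransGen (N := N) le_rfl [] []
    simp only [List.nil_append, List.append_nil, List.length_nil, add_zero] at this
    exact ⟨_, this⟩
  · rintro ⟨d, hd, hout⟩
    by_contra hk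
    push Not at hk
    have hacc := acc_of_reflTransGen MMStep.deterministic hd (forall_not_mmStep_iff.2 hout)
    -- every time the loop is reached there is a further round
    have h1 := (hstart x).reflTransGen (N := N) (by omega) [] ((Prog.loop 2 body).compile N
      (1 + (P.compile N 1).length))
    simp only [List.nil_append, List.length_nil, add_zero] at h1
    have h2 : ∀ k, TransGen (MMStep 1 C)
        (1 + (P.compile N 1).length, machineRegs N (σ x k))
        (1 + (P.compile N 1).length, machineRegs N (σ x (k + 1))) := fun k => by
      have := transGen_loop (N := N) (r := 2) (P := body) (by omega) (hk k)
        ((hbody x k).reflTransGen (by omega)) (P.compile N 1) []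
      rwa [List.append_nil] at this
    have hacc' : ∀ c, Acc (TransGen (flip (MMStep 1 C))) c →
        ∀ k, c ≠ (1 + (P.compile N 1).length, machineRegs N (σ x k)) := by
      intro c hc
      induction hc with
      | intro c _ ih =>
        rintro k rfl
        exact ih _ (transGen_swap.2 (h2 k)) (k + 1) rfl
    have h3 : ∀ c, ReflTransGen (MMStep 1 C) (1, machineRegs N fun r => if r = 0 then x else 0) c →
        Acc (flip (MMStep 1 C)) c := fun c hc => by
      induction hc with
      | refl => exact hacc
      | tail _ hbc ih => exact ih.inv hbc
    exact hacc' _ (h3 _ h1).transGen 0 rfl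

theorem mm_hard : RecEnumHard MM := by
  intro p hp
  obtain ⟨n, C, i, -, h, h'⟩ := hp.exists_mm
  refine ⟨fun x => ⟨n, C, Pi.single i x⟩, ?_, fun x => ⟨fun hx => ?_, h' x⟩⟩
  · refine ((Primrec.encode.comp (Primrec.pair (Primrec.const n)
      (Primrec.pair (Primrec.const (C.map MMInstr.code)) (Primrec.list_ofFn
        (f := fun (a : Fin n) (x : ℕ × ℕ) => (Pi.single i x.1 : Fin n → ℕ) a)
        fun a => ?_)))).to_comp : Computable _)
    by_cases ha : a = i
    · simpa [ha] using Primrec.fst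
    · simpa [ha] using Primrec.const 0
  · obtain ⟨w, hw⟩ := h x hx
    exact ⟨_, hw, Or.inr (Nat.add_comm _ _).le⟩

end HilbertTenth

namespace HilbertTenth

open Encodable Relation

/-! ### Hardness of FRACTRAN -/

theorem nth_prime_dvd_nth_prime {i j : ℕ} :
    Nat.nth Nat.Prime i ∣ Nat.nth Nat.Prime j ↔ i = j :=
  (Nat.prime_dvd_prime_iff_eq (Nat.prime_nth_prime i) (Nat.prime_nth_prime j)).trans
    (Nat.nth_injective Nat.infinite_setOfPred_prime).eq_iff

/-- The number of a state `(L, v)` of a machine with `n` registers: the exponents of the first `n`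
primes are the values of the registers, and one further prime marks the label. -/
noncomputable def fractranCode {n : ℕ} (c : ℕ × (Fin n → ℕ)) : ℕ :=
  Nat.nth Nat.Prime (n + c.1) * ∏ a : Fin n, Nat.nth Nat.Prime a ^ c.2 a

section

variable {n : ℕ}

theorem prime_reg_dvd_prod (a : Fin n) (v : Fin n → ℕ) :
    Nat.nth Nat.Prime a ∣ ∏ b : Fin n, Nat.nth Nat.Prime b ^ v b ↔ v a ≠ 0 := by
  rw [(Nat.prime_nth_prime a).prime.dvd_finsetProd_iff]
  constructor
  · rintro ⟨b, -, hb⟩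
    have h := nth_prime_dvd_nth_prime.1 ((Nat.prime_nth_prime a).dvd_of_dvd_pow hb)
    obtain rfl := Fin.ext h
    rintro h0
    rw [h0, pow_zero] at hb
    exact (Nat.prime_nth_prime a).one_lt.ne' (Nat.dvd_one.1 hb)
  · exact fun h => ⟨a, Finset.mem_univ a, dvd_pow_self _ h⟩

theorem prime_label_dvd_fractranCode (L : ℕ) (c : ℕ × (Fin n → ℕ)) :
    Nat.nth Nat.Prime (n + L) ∣ fractranCode c ↔ c.1 = L := by
  rw [fractranCode, (Nat.prime_nth_prime _).dvd_mul, nth_prime_dvd_nth_prime,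
    (Nat.prime_nth_prime _).prime.dvd_finsetProd_iff]
  constructor
  · rintro (h | ⟨b, -, hb⟩)
    · omega
    · have h := nth_prime_dvd_nth_prime.1 ((Nat.prime_nth_prime _).dvd_of_dvd_pow hb)
      omega
  · rintro rfl
    exact Or.inl rfl

theorem prod_update_succ (a : Fin n) (v : Fin n → ℕ) :
    ∏ b : Fin n, Nat.nth Nat.Prime b ^ Function.update v a (v a + 1) b =
      Nat.nth Nat.Prime a * ∏ b : Fin n, Nat.nth Nat.Prime b ^ v b := by
  have h : ∀ b : Fin n, Nat.nth Nat.Prime b ^ Function.update v a (v a + 1) b =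
      (if b = a then Nat.nth Nat.Prime a else 1) * Nat.nth Nat.Prime b ^ v b := fun b => by
    by_cases hb : b = a
    · subst hb
      simp [pow_succ, mul_comm]
    · simp [hb]
  rw [Finset.prod_congr rfl fun b _ => h b, Finset.prod_mul_distrib]
  simp

/-- The fractions that simulate the instruction with label `L`. -/
noncomputable def MMInstr.fractions (L : ℕ) : MMInstr n → List (ℕ × ℕ)
  | .inc a => [(Nat.nth Nat.Prime (n + (L + 1)) * Nat.nth Nat.Prime a, Nat.nth Nat.Prime (n + L))]
  | .dec a p => [(Nat.nth Nat.Prime (n + (L + 1)), Nat.nth Nat.Prime (n + L) * Nat.nth Nat.Prime a),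
      (Nat.nth Nat.Prime (n + p), Nat.nth Nat.Prime (n + L))]

/-- The FRACTRAN program for the machine whose instructions are labelled `s, s + 1, …`. -/
noncomputable def fractranProgram : ℕ → List (MMInstr n) → List (ℕ × ℕ)
  | _, [] => []
  | s, I :: C => I.fractions s ++ fractranProgram (s + 1) C

theorem fractranStep_nil {x y : ℕ} : ¬ FractranStep [] x y := by
  rintro ⟨⟩

theorem fractranStep_cons {p q : ℕ} {Q : List (ℕ × ℕ)} {x y : ℕ} :
    FractranStep ((p, q) :: Q) x y ↔ q * y = p * x ∨ ¬ q ∣ p * x ∧ FractranStep Q x y := by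
  constructor
  · rintro (⟨_, _, _, _, _, h⟩ | ⟨_, _, _, _, _, h, hQ⟩)
    · exact Or.inl h
    · exact Or.inr ⟨h, hQ⟩
  · rintro (h | ⟨h, hQ⟩)
    · exact .head _ _ _ _ _ h
    · exact .tail _ _ _ _ _ h hQ

theorem fractranStep_cons_of_not_dvd {p q : ℕ} {Q : List (ℕ × ℕ)} {x y : ℕ} (h : ¬ q ∣ p * x) :
    FractranStep ((p, q) :: Q) x y ↔ FractranStep Q x y := by
  rw [fractranStep_cons]
  exact ⟨fun h' => h'.elim (fun h' => absurd ⟨y, h'.symm⟩ h) And.right, fun h' => Or.inr ⟨h, h'⟩⟩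

theorem fractranStep_cons_of_eq {p q : ℕ} {Q : List (ℕ × ℕ)} {x y z : ℕ} (hq : q ≠ 0)
    (h : q * z = p * x) : FractranStep ((p, q) :: Q) x y ↔ y = z := by
  rw [fractranStep_cons]
  constructor
  · rintro (h' | ⟨h', -⟩)
    · exact Nat.eq_of_mul_eq_mul_left (Nat.pos_of_ne_zero hq) (h'.trans h.symm)
    · exact absurd ⟨z, h.symm⟩ h'
  · rintro rfl
    exact Or.inl h

theorem not_prime_label_dvd {L M : ℕ} {k : ℕ} {c : ℕ × (Fin n → ℕ)} (hM : L ≠ M) (hc : c.1 ≠ L)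
    (hk : ¬ Nat.nth Nat.Prime (n + L) ∣ k) :
    ¬ Nat.nth Nat.Prime (n + L) ∣ Nat.nth Nat.Prime (n + M) * k * fractranCode c := by
  rw [(Nat.prime_nth_prime _).dvd_mul, (Nat.prime_nth_prime _).dvd_mul, nth_prime_dvd_nth_prime,
    prime_label_dvd_fractranCode]
  omega

theorem fractranStep_fractions_of_ne {L : ℕ} {I : MMInstr n} {c : ℕ × (Fin n → ℕ)}
    (hI : ∀ a p, I = .dec a p → p ≠ L) (hc : c.1 ≠ L) (Q : List (ℕ × ℕ)) (y : ℕ) :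
    FractranStep (I.fractions L ++ Q) (fractranCode c) y ↔
      FractranStep Q (fractranCode c) y := by
  cases I with
  | inc a =>
    refine fractranStep_cons_of_not_dvd (not_prime_label_dvd (by omega) hc ?_)
    rw [nth_prime_dvd_nth_prime]
    omega
  | dec a p =>
    have hp := hI a p rfl
    have h1 : ¬ Nat.nth Nat.Prime (n + L) ∣ 1 := (Nat.prime_nth_prime _).not_dvd_one
    refine (fractranStep_cons_of_not_dvd fun h => ?_).trans (fractranStep_cons_of_not_dvd ?_)
    · exact not_prime_label_dvd (M := L + 1) (by omega) hc h1
        (by rw [mul_one]; exact (Dvd.intro _ rfl).trans h)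
    · have := not_prime_label_dvd (M := p) (Ne.symm hp) hc h1
      rwa [mul_one] at this

theorem fractranStep_fractions_of_eq {I : MMInstr n} {c : ℕ × (Fin n → ℕ)} (Q : List (ℕ × ℕ))
    (y : ℕ) :
    FractranStep (I.fractions c.1 ++ Q) (fractranCode c) y ↔ y = fractranCode (I.next c) := by
  have hpos : ∀ i, Nat.nth Nat.Prime i ≠ 0 := fun i => (Nat.prime_nth_prime i).ne_zero
  obtain ⟨L, v⟩ := c
  cases I with
  | inc a =>
    refine fractranStep_cons_of_eq (hpos _) ?_
    simp only [fractranCode, MMInstr.next, prod_update_succ]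
    ring
  | dec a p =>
    by_cases hv : v a = 0
    · refine (fractranStep_cons_of_not_dvd ?_).trans (fractranStep_cons_of_eq (hpos _) ?_)
      · rw [fractranCode, mul_left_comm, Nat.mul_dvd_mul_iff_left (Nat.pos_of_ne_zero (hpos _)),
          (Nat.prime_nth_prime _).dvd_mul, nth_prime_dvd_nth_prime, prime_reg_dvd_prod]
        simp only [hv]
        omega
      · simp only [fractranCode, MMInstr.next, hv, if_true]
        ring
    · refine fractranStep_cons_of_eq (mul_ne_zero (hpos _) (hpos _)) ?_
      have h := prod_update_succ a (Function.update v a (v a - 1))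
      rw [Function.update_self, Function.update_idem, Nat.sub_add_cancel (Nat.pos_of_ne_zero hv),
        Function.update_eq_self] at h
      simp only [fractranCode, MMInstr.next, hv, if_false, h]
      ring

theorem mmStep_cons {s : ℕ} {I : MMInstr n} {C : List (MMInstr n)} {c d : ℕ × (Fin n → ℕ)} :
    MMStep s (I :: C) c d ↔ c.1 = s ∧ d = I.next c ∨ MMStep (s + 1) C c d := by
  simp only [mmStep_iff]
  constructor
  · rintro ⟨j, J, h1, h2, h3⟩
    cases j with
    | zero =>
      obtain rfl : I = J := by simpa using h2
      exact Or.inl ⟨h1, h3⟩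
    | succ j => exact Or.inr ⟨j, J, by omega, by simpa using h2, h3⟩
  · rintro (⟨h1, h2⟩ | ⟨j, J, h1, h2, h3⟩)
    · exact ⟨0, I, h1, by simp, h2⟩
    · exact ⟨j + 1, J, by omega, by simpa using h2, h3⟩

/-- The FRACTRAN program simulates the machine step by step. An instruction `DEC` that jumps to
itself would give a fraction with equal numerator and denominator, which applies to every number. -/
theorem fractranStep_iff {s : ℕ} {C : List (MMInstr n)}
    (hC : ∀ j a p, C[j]? = some (.dec a p) → p ≠ s + j) (c : ℕ × (Fin n → ℕ)) (y : ℕ) :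
    FractranStep (fractranProgram s C) (fractranCode c) y ↔
      ∃ d, MMStep s C c d ∧ y = fractranCode d := by
  induction C generalizing s with
  | nil => simp [fractranProgram, fractranStep_nil, mmStep_iff]
  | cons I C ih =>
    simp only [fractranProgram, mmStep_cons]
    by_cases hc : c.1 = s
    · subst hc
      rw [fractranStep_fractions_of_eq]
      constructor
      · rintro rfl
        exact ⟨_, Or.inl ⟨rfl, rfl⟩, rfl⟩
      · rintro ⟨d, ⟨-, rfl⟩ | h, rfl⟩
        · rfl
        · obtain ⟨j, J, h, -⟩ := mmStep_iff.1 h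
          omega
    · rw [fractranStep_fractions_of_ne (I := I) (L := s)
        (fun a p h => hC 0 a p (by simp [h])) hc, ih]
      · simp [hc]
      · intro j a p h
        have := hC (j + 1) a p (by simpa using h)
        omega

theorem fractranTerminates_iff {s : ℕ} {C : List (MMInstr n)}
    (hC : ∀ j a p, C[j]? = some (.dec a p) → p ≠ s + j) (c : ℕ × (Fin n → ℕ)) :
    FractranTerminates (fractranProgram s C) (fractranCode c) ↔ MMTerminates s C c := by
  constructor
  · rintro ⟨x, hx, hterm⟩
    have : ∃ d, ReflTransGen (MMStep s C) c d ∧ x = fractranCode d := by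
      clear hterm
      induction hx with
      | refl => exact ⟨c, .refl, rfl⟩
      | tail _ h ih =>
        obtain ⟨d, hd, rfl⟩ := ih
        obtain ⟨e, he, rfl⟩ := (fractranStep_iff hC _ _).1 h
        exact ⟨e, hd.tail he, rfl⟩
    obtain ⟨d, hd, rfl⟩ := this
    exact ⟨d, hd, forall_not_mmStep_iff.1 fun e he =>
      hterm _ ((fractranStep_iff hC _ _).2 ⟨e, he, rfl⟩)⟩
  · rintro ⟨d, hd, hout⟩
    refine ⟨fractranCode d, hd.lift _ fun a b h => (fractranStep_iff hC _ _).2 ⟨b, h, rfl⟩,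
      fun y hy => ?_⟩
    obtain ⟨e, he, -⟩ := (fractranStep_iff hC _ _).1 hy
    exact forall_not_mmStep_iff.2 hout e he

theorem fractranProgram_regular (s : ℕ) (C : List (MMInstr n)) :
    FractranRegular (fractranProgram s C) := by
  have hpos : ∀ i, Nat.nth Nat.Prime i ≠ 0 := fun i => (Nat.prime_nth_prime i).ne_zero
  induction C generalizing s with
  | nil => simp [fractranProgram, FractranRegular]
  | cons I C ih =>
    intro f hf
    rcases List.mem_append.1 hf with hf | hf
    · cases I <;> simp only [MMInstr.fractions, List.mem_cons, List.not_mem_nil, or_false] at hf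
      · rw [hf]
        exact hpos _
      · rcases hf with rfl | rfl
        · exact mul_ne_zero (hpos _) (hpos _)
        · exact hpos _
    · exact ih _ f hf

end

theorem fractranReg_hard : RecEnumHard FRACTRAN_REG := by
  intro p hp
  obtain ⟨n, C, i, hC, h, h'⟩ := hp.exists_mm
  refine ⟨fun x => (⟨fractranProgram 1 C, fractranProgram_regular 1 C⟩,
    fractranCode (1, Pi.single i x)), ?_, fun x => ?_⟩
  · have hB : ∀ x, fractranCode (1, Pi.single i x) =
        (fun y => Nat.nth Nat.Prime i * y)^[x] (Nat.nth Nat.Prime (n + 1)) := fun x => by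
      rw [mul_left_iterate, fractranCode, mul_comm]
      simp [Pi.single_apply, pow_ite]
    have hc : Primrec fun x => fractranCode (1, Pi.single i x) :=
      (Primrec.nat_iterate (f := fun x : ℕ => x) (h := fun _ y => Nat.nth Nat.Prime i * y)
        Primrec.id (Primrec.const (Nat.nth Nat.Prime (n + 1)))
        (Primrec.nat_mul.comp (Primrec.const (Nat.nth Nat.Prime i)) Primrec.snd)).of_eq
        fun x => (hB x).symm
    exact (Primrec₂.natPair.comp (Primrec.const (encode (fractranProgram 1 C)))
      (hc.comp Primrec.fst)).to_comp
  · refine Iff.trans ⟨fun hx => ?_, h' x⟩ (fractranTerminates_iff hC _).symm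
    obtain ⟨w, hw⟩ := h x hx
    exact ⟨_, hw, Or.inr (Nat.add_comm _ _).le⟩

/-- Regular programs are programs, and the inclusion does not change codes. -/
theorem fractranReg_reduces : Reduces FRACTRAN_REG FRACTRAN := by
  refine ⟨fun I => (I.1.1, I.2), ⟨fun l _ => l.head?, Primrec.list_head?.to_comp.comp
    Computable.fst, fun I m => ⟨fun k y hy => ?_, 1, ?_⟩⟩, fun I => Iff.rfl⟩
  · cases k with
    | zero => simp at hy
    | succ k =>
      rw [List.range_succ_eq_map] at hy
      simp only [List.map_cons, List.head?_cons, Option.some.injEq] at hy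
      exact hy.symm
  · simp [List.range_succ_eq_map]

end HilbertTenth

namespace HilbertTenth

open Encodable Relation

/-! ### Queue systems that simulate Minsky machines -/

/-- The letters of the words that represent the states of a machine with `n` registers. -/
inductive Letter (n : ℕ) : Type
  /-- a marker that occurs once -/
  | hash
  /-- a unit of the register `a` -/
  | reg (a : Fin n)
  /-- the machine is at label `L` -/
  | run (L : ℕ)
  /-- the machine is testing whether register `a` is zero, and if so goes to label `p` -/
  | test (a : Fin n) (p : ℕ)
  /-- the machine has terminated -/
  | halt
  /-- occurs only at the end of a match -/
  | finish
  /-- occurs only at the beginning of a match -/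
  | start

namespace Letter

variable {n : ℕ}

/-- The letters other than state letters. -/
def passive (n : ℕ) : List (Letter n) := hash :: (List.finRange n).map reg

theorem mem_passive {x : Letter n} : x ∈ passive n ↔ x = hash ∨ ∃ a, x = reg a := by
  simp [passive, eq_comm]

/-- An injective code of letters. -/
def code : Letter n → ℕ × ℕ × ℕ
  | hash => (0, 0, 0)
  | reg a => (1, a, 0)
  | run L => (2, L, 0)
  | test a p => (3, a, p)
  | halt => (4, 0, 0)
  | finish => (5, 0, 0)
  | start => (6, 0, 0)

theorem code_injective : Function.Injective (code (n := n)) := by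
  intro x y h
  cases x <;> cases y <;> simp_all [code, Fin.ext_iff]

end Letter

section

variable {n : ℕ}

open Letter

/-- The bag of letters for the values of the registers. -/
noncomputable def regBag (v : Fin n → ℕ) : Multiset (Letter n) :=
  ∑ a, Multiset.replicate (v a) (reg a)

theorem mem_regBag {v : Fin n → ℕ} {x : Letter n} :
    x ∈ regBag v ↔ ∃ a, x = reg a ∧ v a ≠ 0 := by
  simp only [regBag, Multiset.mem_sum, Finset.mem_univ, true_and, Multiset.mem_replicate]
  exact exists_congr fun a => and_comm

theorem regBag_update_succ (v : Fin n → ℕ) (a : Fin n) :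
    regBag (Function.update v a (v a + 1)) = reg a ::ₘ regBag v := by
  have h : ∀ b, Multiset.replicate (Function.update v a (v a + 1) b) (reg b) =
      (if b = a then {reg a} else 0) + Multiset.replicate (v b) (reg b) := fun b => by
    by_cases hb : b = a
    · subst hb
      simp [Multiset.replicate_succ]
    · simp [hb]
  rw [regBag, Finset.sum_congr rfl fun b _ => h b, Finset.sum_add_distrib]
  simp [regBag]

theorem regBag_eq_cons {v : Fin n → ℕ} {a : Fin n} (h : v a ≠ 0) :
    regBag v = reg a ::ₘ regBag (Function.update v a (v a - 1)) := by
  have := regBag_update_succ (Function.update v a (v a - 1)) a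
  rwa [Function.update_self, Function.update_idem, Nat.sub_add_cancel (Nat.pos_of_ne_zero h),
    Function.update_eq_self] at this

theorem regBag_single (i : Fin n) (x : ℕ) : regBag (Pi.single i x) = Multiset.replicate x (reg i) := by
  rw [regBag, Finset.sum_eq_single i] <;> simp +contextual

/-- A rule `(u, v)` acts on words as on queues: it removes the prefix `u` and appends `v`. These are
the rules for the instruction with label `L`. A test for zero moves the state letter once around
the queue, from the marker to the marker. -/
def MMInstr.rules (L : ℕ) : MMInstr n → List (List (Letter n) × List (Letter n))
  | .inc a => [([run L], [reg a, run (L + 1)])]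
  | .dec a p =>
    [([run L, reg a], [run (L + 1)]), ([run L, hash], [hash, test a p]),
      ([test a p, hash], [hash, run p])] ++
    (passive n).map (fun b => ([run L, b], [b, run L])) ++
    ((List.finRange n).filter (· ≠ a)).map fun b => ([test a p, reg b], [reg b, test a p])

/-- The rules for a machine that terminates at the label behind its code. The passive letters may be
rotated at any time; the halting letter consumes them one by one. The rule that removes the final
halting letter is needed only to end a match of cards. -/
def queueRules (C : List (MMInstr n)) : List (List (Letter n) × List (Letter n)) :=
  [([run (1 + C.length)], [halt]), ([halt, finish], [finish])] ++
    (passive n).map (fun b => ([b], [b])) ++ (passive n).map (fun b => ([halt, b], [halt])) ++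
    C.zipIdx.flatMap fun I => I.1.rules (1 + I.2)

theorem mem_queueRules {C : List (MMInstr n)} {r : List (Letter n) × List (Letter n)} :
    r ∈ queueRules C ↔ r = ([run (1 + C.length)], [halt]) ∨ r = ([halt, finish], [finish]) ∨
      (∃ b ∈ passive n, r = ([b], [b])) ∨ (∃ b ∈ passive n, r = ([halt, b], [halt])) ∨
      ∃ j I, C[j]? = some I ∧ r ∈ MMInstr.rules (1 + j) I := by
  simp only [queueRules, List.mem_append, List.mem_cons, List.not_mem_nil, or_false, List.mem_map,
    List.mem_flatMap, List.mem_zipIdx_iff_getElem?, Prod.exists, or_assoc, @eq_comm _ _ r]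
  have : (∃ a b, C[b]? = some a ∧ r ∈ MMInstr.rules (1 + b) a) ↔
      ∃ j I, C[j]? = some I ∧ r ∈ MMInstr.rules (1 + j) I := exists_comm
  rw [this]

theorem mem_rules_dec {L p : ℕ} {a : Fin n} {r : List (Letter n) × List (Letter n)} :
    r ∈ (MMInstr.dec a p).rules L ↔ r = ([run L, reg a], [run (L + 1)]) ∨
      r = ([run L, hash], [hash, test a p]) ∨ r = ([test a p, hash], [hash, run p]) ∨
      (∃ b ∈ passive n, r = ([run L, b], [b, run L])) ∨
      ∃ b, b ≠ a ∧ r = ([test a p, reg b], [reg b, test a p]) := by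
  simp [MMInstr.rules, @eq_comm _ _ r]

/-- One step of the queue. -/
def QueueStep (C : List (MMInstr n)) (r r' : List (Letter n)) : Prop :=
  ∃ u v w, (u, v) ∈ queueRules C ∧ r = u ++ w ∧ r' = w ++ v

theorem queue_rotate (C : List (MMInstr n)) (w w' : List (Letter n)) (hw : ∀ b ∈ w, b ∈ passive n) :
    ReflTransGen (QueueStep C) (w ++ w') (w' ++ w) := by
  induction w generalizing w' with
  | nil => simpa using ReflTransGen.refl
  | cons b w ih =>
    have h := ih (w' ++ [b]) fun c hc => hw c (List.mem_cons_of_mem _ hc)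
    rw [← List.append_assoc, List.append_assoc w', List.singleton_append] at h
    refine .head ⟨[b], [b], w ++ w', ?_, rfl, rfl⟩ h
    exact mem_queueRules.2 (.inr (.inr (.inl ⟨b, hw b List.mem_cons_self, rfl⟩)))

/-- A state letter that is not next to a required letter is moved past the other letters. -/
theorem queue_swap {C : List (MMInstr n)} {j p : ℕ} {a : Fin n} (h : C[j]? = some (.dec a p))
    (w w' : List (Letter n)) (hw : ∀ b ∈ w ++ w', b ∈ passive n) :
    ReflTransGen (QueueStep C) (run (1 + j) :: (w ++ w')) (run (1 + j) :: (w' ++ w)) := by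
  induction w generalizing w' with
  | nil => simpa using ReflTransGen.refl
  | cons b w ih =>
    have hb := hw b (by simp)
    have h1 : QueueStep C (run (1 + j) :: (b :: w ++ w')) ((w ++ w') ++ [b, run (1 + j)]) :=
      ⟨[run (1 + j), b], [b, run (1 + j)], w ++ w',
        mem_queueRules.2 (.inr (.inr (.inr (.inr ⟨j, _, h, mem_rules_dec.2
          (.inr (.inr (.inr (.inl ⟨b, hb, rfl⟩))))⟩)))), rfl, rfl⟩
    have h2 := queue_rotate C (w ++ w' ++ [b]) [run (1 + j)] fun c hc => hw c (by
      simp only [List.mem_append, List.mem_cons, List.not_mem_nil] at hc ⊢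
      tauto)
    have h3 := ih (w' ++ [b]) fun c hc => hw c (by
      simp only [List.mem_append, List.mem_cons, List.not_mem_nil] at hc ⊢
      tauto)
    simp only [List.append_assoc, List.cons_append, List.nil_append] at h1 h2 h3 ⊢
    exact (ReflTransGen.head h1 h2).trans h3

/-- The sweep of a test for zero. -/
theorem queue_test {C : List (MMInstr n)} {j p : ℕ} {a : Fin n} (h : C[j]? = some (.dec a p))
    (w w' : List (Letter n)) (hw : ∀ b ∈ w, ∃ c, c ≠ a ∧ b = reg c)
    (hw' : ∀ b ∈ w', b ∈ passive n) :
    ReflTransGen (QueueStep C) (test a p :: (w ++ hash :: w')) (run p :: (w' ++ w ++ [hash])) := by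
  induction w generalizing w' with
  | nil =>
    refine ReflTransGen.head ⟨[test a p, hash], [hash, run p], w', mem_queueRules.2
      (.inr (.inr (.inr (.inr ⟨j, _, h, mem_rules_dec.2 (.inr (.inr (.inl rfl)))⟩)))),
      rfl, rfl⟩ ?_
    have := queue_rotate C (w' ++ [hash]) [run p] fun c hc => by
      rcases List.mem_append.1 hc with hc | hc
      · exact hw' c hc
      · exact mem_passive.2 (.inl (List.mem_singleton.1 hc))
    simpa using this
  | cons b w ih =>
    obtain ⟨c, hc, rfl⟩ := hw b List.mem_cons_self
    have hreg : ∀ c, reg c ∈ passive n := fun c => mem_passive.2 (.inr ⟨c, rfl⟩)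
    have hw0 : ∀ b ∈ w, ∃ c, c ≠ a ∧ b = reg c := fun b hb => hw b (List.mem_cons_of_mem _ hb)
    have h1 : QueueStep C (test a p :: (reg c :: w ++ hash :: w'))
        ((w ++ hash :: w') ++ [reg c, test a p]) :=
      ⟨[test a p, reg c], [reg c, test a p], w ++ hash :: w',
        mem_queueRules.2 (.inr (.inr (.inr (.inr ⟨j, _, h, mem_rules_dec.2
          (.inr (.inr (.inr (.inr ⟨c, hc, rfl⟩))))⟩)))), rfl, rfl⟩
    have h2 := queue_rotate C (w ++ hash :: w' ++ [reg c]) [test a p] fun d hd => by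
      simp only [List.mem_append, List.mem_cons, List.not_mem_nil, or_false] at hd
      rcases hd with (hd | rfl | hd) | rfl
      · obtain ⟨e, -, rfl⟩ := hw0 d hd
        exact hreg e
      · exact mem_passive.2 (.inl rfl)
      · exact hw' d hd
      · exact hreg c
    have h3 := ih (w' ++ [reg c]) hw0 fun d hd => by
      rcases List.mem_append.1 hd with hd | hd
      · exact hw' d hd
      · exact List.mem_singleton.1 hd ▸ hreg c
    simp only [List.append_assoc, List.cons_append, List.nil_append] at h1 h2 h3 ⊢
    exact (ReflTransGen.head h1 h2).trans h3

theorem passive_of_bag {w : List (Letter n)} {v : Fin n → ℕ}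
    (hw : (w : Multiset (Letter n)) = hash ::ₘ regBag v) : ∀ b ∈ w, b ∈ passive n := by
  intro b hb
  rw [← Multiset.mem_coe, hw, Multiset.mem_cons, mem_regBag] at hb
  rw [mem_passive]
  rcases hb with hb | ⟨a, ha, -⟩
  · exact .inl hb
  · exact .inr ⟨a, ha⟩

/-- The queue simulates a step of the machine, whatever the order of the passive letters. -/
theorem queue_of_mmStep {C : List (MMInstr n)} {c d : ℕ × (Fin n → ℕ)} (h : MMStep 1 C c d)
    {w : List (Letter n)} (hw : (w : Multiset (Letter n)) = hash ::ₘ regBag c.2) :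
    ∃ w' : List (Letter n), (w' : Multiset (Letter n)) = hash ::ₘ regBag d.2 ∧
      ReflTransGen (QueueStep C) (run c.1 :: w) (run d.1 :: w') := by
  have hp := passive_of_bag hw
  obtain ⟨j, I, h1, h2, rfl⟩ := mmStep_iff.1 h
  obtain ⟨L, v⟩ := c
  simp only at h1 hw
  subst h1
  cases I with
  | inc a =>
    refine ⟨w ++ [reg a], ?_, ?_⟩
    · simp only [MMInstr.next, regBag_update_succ, ← Multiset.coe_add, hw]
      rw [Multiset.cons_swap, ← Multiset.singleton_add (reg a), add_comm]
      rfl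
    · refine ReflTransGen.head ⟨[run (1 + j)], [reg a, run (1 + j + 1)], w, mem_queueRules.2
        (.inr (.inr (.inr (.inr ⟨j, _, h2, by simp [MMInstr.rules]⟩)))), rfl, rfl⟩ ?_
      have := queue_rotate C (w ++ [reg a]) [run (1 + j + 1)] fun b hb => by
        rcases List.mem_append.1 hb with hb | hb
        · exact hp b hb
        · exact mem_passive.2 (.inr ⟨a, List.mem_singleton.1 hb⟩)
      simpa [MMInstr.next] using this
  | dec a p =>
    by_cases hv : v a = 0
    · have hmem : hash ∈ w := by
        rw [← Multiset.mem_coe, hw]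
        exact Multiset.mem_cons_self _ _
      obtain ⟨w₁, w₂, rfl⟩ := List.append_of_mem hmem
      have hw' : ((w₂ ++ w₁ : List (Letter n)) : Multiset (Letter n)) = regBag v := by
        rw [← Multiset.cons_inj_right hash, ← hw, Multiset.cons_coe, Multiset.coe_eq_coe]
        exact (List.perm_append_comm (l₁ := hash :: w₂) (l₂ := w₁))
      refine ⟨w₂ ++ w₁ ++ [hash], ?_, ?_⟩
      · rw [← Multiset.coe_add, hw', add_comm]
        simp [MMInstr.next, hv]
      · have hu : ∀ b ∈ w₂ ++ w₁, ∃ c, c ≠ a ∧ b = reg c := fun b hb => by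
          rw [← Multiset.mem_coe, hw', mem_regBag] at hb
          obtain ⟨c, rfl, hc⟩ := hb
          exact ⟨c, fun h => hc (h ▸ hv), rfl⟩
        have e1 := queue_swap h2 w₁ (hash :: w₂) hp
        have e2 : QueueStep C (run (1 + j) :: (hash :: w₂ ++ w₁))
            ((w₂ ++ w₁) ++ [hash, test a p]) :=
          ⟨[run (1 + j), hash], [hash, test a p], w₂ ++ w₁, mem_queueRules.2
            (.inr (.inr (.inr (.inr ⟨j, _, h2, mem_rules_dec.2 (.inr (.inl rfl))⟩)))), rfl, rfl⟩
        have e3 := queue_rotate C (w₂ ++ w₁ ++ [hash]) [test a p] fun b hb => hp b (by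
          simp only [List.mem_append, List.mem_cons, List.not_mem_nil] at hb ⊢
          tauto)
        have e4 := queue_test h2 (w₂ ++ w₁) [] hu (by simp)
        simp only [List.append_assoc, List.cons_append, List.nil_append] at e1 e2 e3 e4
        simpa [MMInstr.next, hv] using (e1.tail e2).trans (e3.trans e4)
    · have hmem : reg a ∈ w := by
        rw [← Multiset.mem_coe, hw]
        exact Multiset.mem_cons_of_mem (mem_regBag.2 ⟨a, rfl, hv⟩)
      obtain ⟨w₁, w₂, rfl⟩ := List.append_of_mem hmem
      refine ⟨w₂ ++ w₁, ?_, ?_⟩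
      · rw [← Multiset.cons_inj_right (reg a)]
        simp only [MMInstr.next, hv, if_false]
        rw [Multiset.cons_swap, ← regBag_eq_cons hv, ← hw, Multiset.cons_coe, Multiset.coe_eq_coe]
        exact (List.perm_append_comm (l₁ := reg a :: w₂) (l₂ := w₁))
      · have e1 := queue_swap h2 w₁ (reg a :: w₂) hp
        have e2 : QueueStep C (run (1 + j) :: (reg a :: w₂ ++ w₁))
            ((w₂ ++ w₁) ++ [run (1 + j + 1)]) :=
          ⟨[run (1 + j), reg a], [run (1 + j + 1)], w₂ ++ w₁, mem_queueRules.2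
            (.inr (.inr (.inr (.inr ⟨j, _, h2, mem_rules_dec.2 (.inl rfl)⟩)))), rfl, rfl⟩
        have e3 := queue_rotate C (w₂ ++ w₁) [run (1 + j + 1)] fun b hb => hp b (by
          simp only [List.mem_append, List.mem_cons] at hb ⊢
          tauto)
        simpa [MMInstr.next, hv] using (e1.tail e2).trans e3

theorem queue_halt {C : List (MMInstr n)} {w : List (Letter n)} (hw : ∀ b ∈ w, b ∈ passive n) :
    ReflTransGen (QueueStep C) (halt :: w) [halt] := by
  induction w with
  | nil => exact .refl
  | cons b w ih =>
    have hw' : ∀ c ∈ w, c ∈ passive n := fun c hc => hw c (List.mem_cons_of_mem _ hc)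
    refine (ReflTransGen.head ⟨[halt, b], [halt], w, mem_queueRules.2
      (.inr (.inr (.inr (.inl ⟨b, hw b List.mem_cons_self, rfl⟩)))), rfl, rfl⟩ ?_).trans (ih hw')
    exact queue_rotate C w [halt] hw'

theorem queue_of_terminates {C : List (MMInstr n)} {v v' : Fin n → ℕ} {w : List (Letter n)}
    (hw : (w : Multiset (Letter n)) = hash ::ₘ regBag v)
    (h : ReflTransGen (MMStep 1 C) (1, v) (1 + C.length, v')) :
    ReflTransGen (QueueStep C) (run 1 :: w) [halt] := by
  have : ∀ d, ReflTransGen (MMStep 1 C) (1, v) d → ∃ w' : List (Letter n),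
      (w' : Multiset (Letter n)) = hash ::ₘ regBag d.2 ∧
      ReflTransGen (QueueStep C) (run 1 :: w) (run d.1 :: w') := by
    intro d hd
    induction hd with
    | refl => exact ⟨w, hw, .refl⟩
    | tail _ h ih =>
      obtain ⟨w₁, h1, h2⟩ := ih
      obtain ⟨w₂, h3, h4⟩ := queue_of_mmStep h h1
      exact ⟨w₂, h3, h2.trans h4⟩
  obtain ⟨w', h1, h2⟩ := this _ h
  have hp := passive_of_bag h1
  refine (h2.tail ⟨[run (1 + C.length)], [halt], w', mem_queueRules.2 (.inl rfl), rfl, rfl⟩).trans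
    ((queue_rotate C w' [halt] hp).trans (queue_halt hp))

end

end HilbertTenth

namespace HilbertTenth

open Encodable Relation Letter

/-! ### Correctness of the queue systems -/

theorem eq_of_cons_isRotated_cons {α : Type} {x : α} {s t : List α} (h : (x :: s) ~r (x :: t))
    (hx : x ∉ t) : s = t := by
  obtain ⟨k, hk⟩ := h
  rw [← List.rotate_mod] at hk
  have hlt := Nat.mod_lt k (show 0 < (x :: s).length by simp)
  rw [List.rotate_eq_drop_append_take hlt.le] at hk
  rcases Nat.eq_zero_or_pos (k % (x :: s).length) with h0 | h0
  · rw [h0] at hk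
    simpa using hk
  · obtain ⟨m, hm⟩ := Nat.exists_eq_succ_of_ne_zero h0.ne'
    rw [hm] at hk hlt
    simp only [Nat.succ_eq_add_one, List.drop_succ_cons, List.take_succ_cons] at hk
    rcases hd : s.drop m with _ | ⟨y, l⟩
    · rw [List.drop_eq_nil_iff] at hd
      simp only [List.length_cons] at hlt
      omega
    · rw [hd, List.cons_append, List.cons.injEq] at hk
      exact absurd (hk.2 ▸ by simp) hx

theorem isRotated_append_singleton {α : Type} (x : α) (s : List α) : (s ++ [x]) ~r (x :: s) :=
  List.IsRotated.symm ⟨1, by simp⟩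

variable {n : ℕ}

/-- The words that occur in the queue while a machine runs that was started on the registers `v₀`.
Within a test for zero the letters between the marker and the state letter have been tested. -/
inductive QueueState (C : List (MMInstr n)) (v₀ : Fin n → ℕ) (r : List (Letter n)) : Prop
  | run {L : ℕ} {v : Fin n → ℕ} (h : ReflTransGen (MMStep 1 C) (1, v₀) (L, v))
      (hr : (r : Multiset (Letter n)) = run L ::ₘ hash ::ₘ regBag v)
  | test {j p : ℕ} {a : Fin n} {v : Fin n → ℕ} {w w' : List (Letter n)}
      (h : ReflTransGen (MMStep 1 C) (1, v₀) (1 + j, v)) (hj : C[j]? = some (.dec a p))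
      (hr : r ~r (hash :: (w ++ test a p :: w'))) (hw : reg a ∉ w)
      (hv : ((w ++ w' : List (Letter n)) : Multiset (Letter n)) = regBag v)

theorem QueueState.mem {C : List (MMInstr n)} {v₀ : Fin n → ℕ} {r : List (Letter n)}
    (h : QueueState C v₀ r) {x : Letter n} (hx : x ∈ r) :
    x ∈ passive n ∨ (∃ L, x = Letter.run L) ∨ ∃ a p, x = Letter.test a p := by
  rcases h with ⟨-, hr⟩ | @⟨j, p, a, v, w, w', -, -, hr, -, hv⟩
  · rw [← Multiset.mem_coe, hr, Multiset.mem_cons, Multiset.mem_cons, mem_regBag] at hx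
    rw [mem_passive]
    rcases hx with hx | hx | ⟨a, hx, -⟩
    · exact .inr (.inl ⟨_, hx⟩)
    · exact .inl (.inl hx)
    · exact .inl (.inr ⟨a, hx⟩)
  · have hw : ∀ y ∈ w ++ w', y ∈ passive n := fun y hy => by
      rw [← Multiset.mem_coe, hv, mem_regBag] at hy
      obtain ⟨b, hb, -⟩ := hy
      exact mem_passive.2 (.inr ⟨b, hb⟩)
    rw [hr.mem_iff] at hx
    simp only [List.mem_cons, List.mem_append] at hx hw
    rcases hx with hx | hx | hx | hx
    · exact .inl (mem_passive.2 (.inl hx))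
    · exact .inl (hw _ (.inl hx))
    · exact .inr (.inr ⟨a, p, hx⟩)
    · exact .inl (hw _ (.inr hx))

theorem QueueState.two_le_length {C : List (MMInstr n)} {v₀ : Fin n → ℕ} {r : List (Letter n)}
    (h : QueueState C v₀ r) : 2 ≤ r.length := by
  rcases h with ⟨-, hr⟩ | ⟨-, -, hr, -, -⟩
  · have := congrArg Multiset.card hr
    simp only [Multiset.coe_card, Multiset.card_cons] at this
    omega
  · have := hr.perm.length_eq
    simp only [List.length_cons, List.length_append] at this
    omega

theorem coe_append_pair {α : Type} (w : List α) (x y : α) :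
    ((w ++ [x, y] : List α) : Multiset α) = y ::ₘ x ::ₘ (w : Multiset α) := by
  rw [Multiset.cons_coe, Multiset.cons_coe, Multiset.coe_eq_coe]
  exact List.perm_append_comm.trans (List.Perm.swap y x w)

theorem coe_append_single {α : Type} (w : List α) (x : α) :
    ((w ++ [x] : List α) : Multiset α) = x ::ₘ (w : Multiset α) := by
  rw [Multiset.cons_coe, Multiset.coe_eq_coe]
  exact List.perm_append_comm

/-- A rule for an instruction, applied while no test for zero is running. -/
theorem QueueState.step_run {C : List (MMInstr n)} {v₀ vr : Fin n → ℕ} {L j : ℕ} {I : MMInstr n}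
    {u v w : List (Letter n)} (h : ReflTransGen (MMStep 1 C) (1, v₀) (L, vr))
    (hr : ((u ++ w : List (Letter n)) : Multiset (Letter n)) = Letter.run L ::ₘ hash ::ₘ regBag vr)
    (hj : C[j]? = some I) (huv : (u, v) ∈ I.rules (1 + j)) : QueueState C v₀ (w ++ v) := by
  have hmem : ∀ x ∈ u ++ w, x = Letter.run L ∨ x = hash ∨ ∃ a, x = reg a ∧ vr a ≠ 0 :=
    fun x hx => by
      rwa [← Multiset.mem_coe, hr, Multiset.mem_cons, Multiset.mem_cons, mem_regBag] at hx
  have hL : Letter.run (1 + j) ∈ u → L = 1 + j := fun hx => by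
    have := hmem _ (List.mem_append_left _ hx)
    simpa [eq_comm] using this
  have ht : ∀ a p, Letter.test a p ∉ u := fun a p hx => by
    have := hmem _ (List.mem_append_left _ hx)
    simp at this
  have hstep : L = 1 + j → ReflTransGen (MMStep 1 C) (1, v₀) (I.next (L, vr)) := fun e =>
    h.tail (mmStep_iff.2 ⟨j, I, e, hj, rfl⟩)
  cases I with
  | inc a =>
    obtain ⟨rfl, rfl⟩ := Prod.mk.inj (List.mem_singleton.1 huv)
    obtain rfl := hL (by simp)
    rw [List.singleton_append, ← Multiset.cons_coe, Multiset.cons_inj_right] at hr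
    refine .run (hstep rfl) ?_
    rw [coe_append_pair, hr, regBag_update_succ, Multiset.cons_swap (reg a)]
  | dec a p =>
    rcases mem_rules_dec.1 huv with e | e | e | ⟨b, -, e⟩ | ⟨b, hb, e⟩ <;>
      obtain ⟨rfl, rfl⟩ := Prod.mk.inj e
    · obtain rfl := hL (by simp)
      have hva : vr a ≠ 0 := by simpa using hmem (reg a) (by simp)
      simp only [List.cons_append, List.nil_append] at hr
      rw [← Multiset.cons_coe, ← Multiset.cons_coe, Multiset.cons_inj_right, regBag_eq_cons hva,
        Multiset.cons_swap, Multiset.cons_inj_right] at hr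
      have := hstep rfl
      simp only [MMInstr.next, hva, if_false] at this
      exact .run this (by rw [coe_append_single, hr])
    · obtain rfl := hL (by simp)
      simp only [List.cons_append, List.nil_append] at hr
      rw [← Multiset.cons_coe, ← Multiset.cons_coe, Multiset.cons_inj_right,
        Multiset.cons_inj_right] at hr
      refine .test (w := []) (w' := w) h hj ?_ (by simp) (by simpa using hr)
      have := List.IsRotated.symm (l := hash :: Letter.test a p :: w) (l' := w ++ [hash, Letter.test a p]) ⟨2, by
        simp [List.rotate_cons_succ]⟩
      simpa using this
    · exact absurd (by simp) (ht a p)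
    · refine .run h (Eq.trans ?_ hr)
      rw [coe_append_pair]
      rfl
    · exact absurd (by simp) (ht a p)

/-- A rule for an instruction, applied during a test for zero. -/
theorem QueueState.step_test {C : List (MMInstr n)} {v₀ vr : Fin n → ℕ} {i j p : ℕ} {a : Fin n}
    {I : MMInstr n} {u v w w₁ w₂ : List (Letter n)}
    (h : ReflTransGen (MMStep 1 C) (1, v₀) (1 + i, vr)) (hi : C[i]? = some (.dec a p))
    (hr : (u ++ w) ~r (hash :: (w₁ ++ Letter.test a p :: w₂))) (hw : reg a ∉ w₁)
    (hv : ((w₁ ++ w₂ : List (Letter n)) : Multiset (Letter n)) = regBag vr)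
    (hj : C[j]? = some I) (huv : (u, v) ∈ I.rules (1 + j)) : QueueState C v₀ (w ++ v) := by
  have hreg : ∀ x ∈ w₁ ++ w₂, ∃ b, x = reg b ∧ vr b ≠ 0 := fun x hx => by
    rwa [← Multiset.mem_coe, hv, mem_regBag] at hx
  have hmem : ∀ x ∈ u ++ w, x = hash ∨ x = Letter.test a p ∨ ∃ b, x = reg b := fun x hx => by
    rw [hr.mem_iff, List.mem_cons, List.mem_append, List.mem_cons] at hx
    rcases hx with hx | hx | hx | hx
    · exact .inl hx
    · obtain ⟨b, hb, -⟩ := hreg x (List.mem_append_left _ hx)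
      exact .inr (.inr ⟨b, hb⟩)
    · exact .inr (.inl hx)
    · obtain ⟨b, hb, -⟩ := hreg x (List.mem_append_right _ hx)
      exact .inr (.inr ⟨b, hb⟩)
  have hL : ∀ L, Letter.run L ∉ u := fun L hx => by
    have := hmem _ (List.mem_append_left _ hx)
    simp at this
  have ht : ∀ a' p', Letter.test a' p' ∈ u → a' = a ∧ p' = p := fun a' p' hx => by
    have := hmem _ (List.mem_append_left _ hx)
    simpa using this
  -- the word, read from the state letter on
  have hrot : (hash :: (w₁ ++ Letter.test a p :: w₂)) ~r (Letter.test a p :: (w₂ ++ hash :: w₁)) := by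
    have := List.isRotated_append (l := hash :: w₁) (l' := Letter.test a p :: w₂)
    simpa using this
  have hnot : Letter.test a p ∉ w₂ ++ hash :: w₁ := fun hx => by
    have : Letter.test a p ∈ w₁ ++ w₂ := by
      simp only [List.mem_append, List.mem_cons, reduceCtorEq, false_or] at hx ⊢
      exact hx.symm
    obtain ⟨b, hb, -⟩ := hreg _ this
    simp at hb
  cases I with
  | inc b =>
    obtain ⟨rfl, rfl⟩ := Prod.mk.inj (List.mem_singleton.1 huv)
    exact absurd (by simp) (hL (1 + j))
  | dec b q =>
    rcases mem_rules_dec.1 huv with e | e | e | ⟨c, -, e⟩ | ⟨c, hc, e⟩ <;>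
      obtain ⟨rfl, rfl⟩ := Prod.mk.inj e
    · exact absurd (by simp) (hL (1 + j))
    · exact absurd (by simp) (hL (1 + j))
    · obtain ⟨rfl, rfl⟩ := ht b q (by simp)
      simp only [List.cons_append, List.nil_append] at hr
      have heq := eq_of_cons_isRotated_cons (hr.trans hrot) hnot
      cases w₂ with
      | cons x w₂ =>
        simp only [List.cons_append, List.cons.injEq] at heq
        obtain ⟨d, hd, -⟩ := hreg x (by simp)
        rw [← heq.1] at hd
        simp at hd
      | nil =>
        simp only [List.nil_append, List.cons.injEq, true_and] at heq
        subst heq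
        have hvb : vr b = 0 := by
          by_contra hne
          rw [List.append_nil] at hv
          exact hw (by rw [← Multiset.mem_coe, hv, mem_regBag]; exact ⟨b, rfl, hne⟩)
        refine .run (L := q) (h.tail (.dec_zero i b q vr hi hvb)) ?_
        rw [coe_append_pair, ← hv, List.append_nil]
    · exact absurd (by simp) (hL (1 + j))
    · obtain ⟨rfl, rfl⟩ := ht b q (by simp)
      simp only [List.cons_append, List.nil_append] at hr
      have heq := eq_of_cons_isRotated_cons (hr.trans hrot) hnot
      cases w₂ with
      | nil => simp at heq
      | cons x w₂ =>
        simp only [List.cons_append, List.cons.injEq] at heq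
        obtain ⟨rfl, rfl⟩ := heq
        refine .test (w := w₁ ++ [reg c]) (w' := w₂) h hi ?_ ?_ (by simpa using hv)
        · have := List.isRotated_append (l := w₂) (l' := hash :: (w₁ ++ [reg c, Letter.test b q]))
          simpa using this
        · simpa [Ne.symm hc] using hw

/-- A step of the queue preserves the states of the queue, unless the machine has terminated. -/
theorem QueueState.step {C : List (MMInstr n)} {v₀ : Fin n → ℕ} {u v w : List (Letter n)}
    (h : QueueState C v₀ (u ++ w)) (huv : (u, v) ∈ queueRules C) :
    QueueState C v₀ (w ++ v) ∨ MMTerminates 1 C (1, v₀) := by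
  have hmem : ∀ x ∈ u, x ∈ passive n ∨ (∃ L, x = Letter.run L) ∨ ∃ a p, x = Letter.test a p :=
    fun x hx => h.mem (List.mem_append_left _ hx)
  rcases mem_queueRules.1 huv with huv | huv | ⟨b, hb, huv⟩ | ⟨b, hb, huv⟩ | ⟨j, I, hj, huv⟩
  · obtain ⟨rfl, rfl⟩ := Prod.mk.inj huv
    rcases h with ⟨h, hr⟩ | @⟨j, p, a, v, w₁, w₂, h, hj, hr, hw, hv⟩
    · right
      have h1 : Letter.run (1 + C.length) ∈ [Letter.run (1 + C.length)] ++ w := by simp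
      rw [← Multiset.mem_coe, hr] at h1
      simp only [Multiset.mem_cons, Letter.run.injEq, mem_regBag] at h1
      simp only [reduceCtorEq, false_and, exists_false, or_false] at h1
      subst h1
      exact ⟨_, h, .inr (Nat.add_comm _ _).le⟩
    · have h1 := hr.mem_iff.1 (show Letter.run (1 + C.length) ∈ [Letter.run (1 + C.length)] ++ w by simp)
      have h2 : Letter.run (1 + C.length) ∈ w₁ ++ w₂ := by simpa using h1
      rw [← Multiset.mem_coe, hv, mem_regBag] at h2
      obtain ⟨b, hb, -⟩ := h2
      simp at hb
  · obtain ⟨rfl, rfl⟩ := Prod.mk.inj huv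
    simpa [mem_passive] using hmem halt
  · obtain ⟨rfl, rfl⟩ := Prod.mk.inj huv
    left
    have hrot : (w ++ [b]) ~r ([b] ++ w) := isRotated_append_singleton b w
    rcases h with ⟨h, hr⟩ | ⟨h, hj, hr, hw, hv⟩
    · exact .run h ((Multiset.coe_eq_coe.2 hrot.perm).trans hr)
    · exact .test h hj (hrot.trans hr) hw hv
  · obtain ⟨rfl, rfl⟩ := Prod.mk.inj huv
    simpa [mem_passive] using hmem halt
  · left
    rcases h with ⟨h, hr⟩ | ⟨h, hi, hr, hw, hv⟩
    · exact .step_run h hr hj huv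
    · exact .step_test h hi hr hw hv hj huv

end HilbertTenth

namespace HilbertTenth

open Encodable Relation Letter

/-! ### Hardness of the Post correspondence problem -/

/-- The matching problem of `PCP` does not depend on the names of the letters. -/
theorem pcp_map_iff {α : Type} {f : α → ℕ} (hf : Function.Injective f)
    (C : List (List α × List α)) :
    PCP (C.map (Prod.map (List.map f) (List.map f))) ↔
      ∃ A : List (List α × List α), A ≠ [] ∧ (∀ c ∈ A, c ∈ C) ∧
        (A.map Prod.fst).flatten = (A.map Prod.snd).flatten := by
  have key : ∀ A : List (List α × List α),
      ((A.map (Prod.map (List.map f) (List.map f))).map Prod.fst).flatten =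
        ((A.map Prod.fst).flatten).map f ∧
      ((A.map (Prod.map (List.map f) (List.map f))).map Prod.snd).flatten =
        ((A.map Prod.snd).flatten).map f := fun A => by
    constructor <;> induction A with
    | nil => rfl
    | cons c A ih => simpa using ih
  constructor
  · rintro ⟨A, hA, hC, h⟩
    have hex : ∃ B : List (List α × List α), (∀ c ∈ B, c ∈ C) ∧
        B.map (Prod.map (List.map f) (List.map f)) = A := by
      clear hA h
      induction A with
      | nil => exact ⟨[], by simp, rfl⟩
      | cons c A ih =>
        obtain ⟨B, hB, rfl⟩ := ih fun d hd => hC d (List.mem_cons_of_mem _ hd)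
        obtain ⟨d, hd, rfl⟩ := List.mem_map.1 (hC c List.mem_cons_self)
        exact ⟨d :: B, by simpa using ⟨hd, fun a b => hB (a, b)⟩, rfl⟩
    obtain ⟨B, hB, rfl⟩ := hex
    refine ⟨B, fun e => hA (by simp [e]), hB, List.map_injective_iff.2 hf ?_⟩
    rw [← (key B).1, ← (key B).2, h]
  · rintro ⟨A, hA, hC, h⟩
    refine ⟨A.map (Prod.map (List.map f) (List.map f)), by simpa using hA, fun c hc => ?_, ?_⟩
    · obtain ⟨d, hd, rfl⟩ := List.mem_map.1 hc
      exact List.mem_map_of_mem (hC d hd)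
    · rw [(key A).1, (key A).2, h]

/-- All ways to colour the letters of a word with two colours. -/
def colorings {α : Type} : List α → List (List (α × Bool))
  | [] => [[]]
  | a :: l => (colorings l).flatMap fun w => [(a, false) :: w, (a, true) :: w]

theorem mem_colorings {α : Type} {l : List α} {w : List (α × Bool)} :
    w ∈ colorings l ↔ w.map Prod.fst = l := by
  induction l generalizing w with
  | nil => simp [colorings]
  | cons a l ih =>
    simp only [colorings, List.mem_flatMap, ih, List.mem_cons, List.not_mem_nil, or_false]
    constructor
    · rintro ⟨s, rfl, rfl | rfl⟩ <;> rfl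
    · intro h
      cases w with
      | nil => simp at h
      | cons x w =>
        obtain ⟨b, c⟩ := x
        simp only [List.map_cons, List.cons.injEq] at h
        obtain ⟨rfl, h⟩ := h
        exact ⟨w, h, by cases c <;> simp⟩

/-- The cards for a rule: the letters that are removed may have any colours, and the letters that
are appended have the colour opposite to that of the first letter that is removed. So no match can
begin with such a card. -/
def ruleCards {α : Type} : List α × List α → List (List (α × Bool) × List (α × Bool))
  | ([], _) => []
  | (a :: u, v) => (colorings u).flatMap fun t =>
      [false, true].map fun c => ((a, c) :: t, v.map fun b => (b, !c))

theorem mem_ruleCards {α : Type} {u v : List α} {s t : List (α × Bool)} :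
    (s, t) ∈ ruleCards (u, v) ↔
      ∃ a c l, s = (a, c) :: l ∧ s.map Prod.fst = u ∧ t = v.map fun b => (b, !c) := by
  cases u with
  | nil =>
    simp only [ruleCards, List.not_mem_nil, false_iff, not_exists]
    rintro a c l ⟨rfl, h, -⟩
    simp at h
  | cons a u =>
    simp only [ruleCards, List.mem_flatMap, mem_colorings, List.mem_map, Prod.mk.injEq]
    constructor
    · rintro ⟨l, rfl, c, -, rfl, rfl⟩
      exact ⟨a, c, l, rfl, rfl, rfl⟩
    · rintro ⟨b, c, l, rfl, h, rfl⟩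
      simp only [List.map_cons, List.cons.injEq] at h
      obtain ⟨rfl, h⟩ := h
      exact ⟨l, h, c, by cases c <;> simp, rfl, rfl⟩

variable {n : ℕ}

/-- The card that begins a match, for the word `r` in the queue at the beginning. -/
def startCard (r : List (Letter n)) : List (Letter n × Bool) × List (Letter n × Bool) :=
  ([(start, true)], (start, true) :: r.map fun a => (a, true))

/-- The cards that simulate the queue. -/
def queueCards (C : List (MMInstr n)) : List (List (Letter n × Bool) × List (Letter n × Bool)) :=
  (queueRules C).flatMap ruleCards

theorem mem_queueCards {C : List (MMInstr n)} {s t : List (Letter n × Bool)} :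
    (s, t) ∈ queueCards C ↔ ∃ u v, (u, v) ∈ queueRules C ∧
      ∃ a c l, s = (a, c) :: l ∧ s.map Prod.fst = u ∧ t = v.map fun b => (b, !c) := by
  simp only [queueCards, List.mem_flatMap, Prod.exists, mem_ruleCards]

theorem ne_nil_of_mem_queueRules {C : List (MMInstr n)} {u v : List (Letter n)}
    (h : (u, v) ∈ queueRules C) : u ≠ [] ∧ u.length ≤ 2 ∧ v ≠ [] := by
  rcases mem_queueRules.1 h with h | h | ⟨b, hb, h⟩ | ⟨b, hb, h⟩ | ⟨j, I, hj, h⟩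
  rotate_right
  · cases I with
    | inc a =>
      obtain ⟨rfl, rfl⟩ := Prod.mk.inj (List.mem_singleton.1 h)
      simp
    | dec a p =>
      rcases mem_rules_dec.1 h with e | e | e | ⟨b, -, e⟩ | ⟨b, hb, e⟩ <;>
        obtain ⟨rfl, rfl⟩ := Prod.mk.inj e <;> simp
  all_goals
    obtain ⟨rfl, rfl⟩ := Prod.mk.inj h
    simp

/-- A match of the remaining cards, for the word `r` in the queue, shows that the machine
terminates. -/
theorem terminates_of_cards {C : List (MMInstr n)} {v₀ : Fin n → ℕ} {r₀ : List (Letter n)}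
    (B : List (List (Letter n × Bool) × List (Letter n × Bool)))
    (hB : ∀ c ∈ B, c ∈ startCard r₀ :: queueCards C) (r : List (Letter n × Bool))
    (hr : QueueState C v₀ (r.map Prod.fst))
    (h : (B.map Prod.fst).flatten = r ++ (B.map Prod.snd).flatten) :
    MMTerminates 1 C (1, v₀) := by
  induction B generalizing r with
  | nil =>
    have := hr.two_le_length
    have h0 : r = [] := by simpa using h.symm
    simp [h0] at this
  | cons c B ih =>
    have hlen := hr.two_le_length
    rw [List.length_map] at hlen
    rcases List.mem_cons.1 (hB c List.mem_cons_self) with rfl | hc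
    · -- the start letter does not occur in the queue
      cases r with
      | nil => simp at hlen
      | cons x r =>
        simp only [startCard, List.map_cons, List.flatten_cons, List.cons_append,
          List.cons.injEq] at h
        have := hr.mem (x := start) (by simp [← h.1])
        simp [mem_passive] at this
    · obtain ⟨s, t⟩ := c
      obtain ⟨u, v, huv, a, c, l, hs, rfl, rfl⟩ := mem_queueCards.1 hc
      have hu := (ne_nil_of_mem_queueRules huv).2.1
      rw [List.length_map] at hu
      simp only [List.map_cons, List.flatten_cons] at h
      have hp : s <+: r := List.prefix_of_prefix_length_le (List.prefix_append _ _)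
        (h.symm ▸ List.prefix_append r _) (hu.trans hlen)
      obtain ⟨w, rfl⟩ := hp
      rw [List.append_assoc, List.append_cancel_left_eq, ← List.append_assoc] at h
      rw [List.map_append] at hr
      rcases hr.step huv with h1 | h1
      · refine ih (fun d hd => hB d (List.mem_cons_of_mem _ hd)) _ ?_ h
        simpa [Function.comp_def] using h1
      · exact h1

/-- The cards for a run of the queue down to the halting letter, with a last card that removes
it. -/
theorem cards_of_queue {C : List (MMInstr n)} {r : List (Letter n)}
    (h : ReflTransGen (QueueStep C) r [halt]) (s : List (Letter n × Bool))
    (hs : s.map Prod.fst = r) :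
    ∃ B : List (List (Letter n × Bool) × List (Letter n × Bool)), (∀ c ∈ B, c ∈ queueCards C) ∧
      (B.map Prod.fst).flatten = s ++ (B.map Prod.snd).flatten := by
  induction h using ReflTransGen.head_induction_on generalizing s with
  | refl =>
    obtain ⟨⟨x, c⟩, l, rfl, rfl, hl⟩ := List.map_eq_cons_iff.1 hs
    obtain rfl := List.map_eq_nil_iff.1 hl
    refine ⟨[([(halt, c), (finish, !c)], [(finish, !c)])], ?_, by simp⟩
    simp only [List.mem_singleton, forall_eq]
    exact mem_queueCards.2 ⟨[halt, finish], [finish], mem_queueRules.2 (.inr (.inl rfl)),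
      halt, c, _, rfl, rfl, rfl⟩
  | head h1 h2 ih =>
    obtain ⟨u, v, w, huv, rfl, rfl⟩ := h1
    obtain ⟨s, t, rfl, hu, hw⟩ := List.map_eq_append_iff.1 hs
    cases s with
    | nil => exact absurd hu.symm (ne_nil_of_mem_queueRules huv).1
    | cons x s =>
      obtain ⟨B, hB, h⟩ := ih (t ++ v.map fun b => (b, !x.2)) (by simp [hw, Function.comp_def])
      refine ⟨(x :: s, v.map fun b => (b, !x.2)) :: B, fun c hc => ?_, ?_⟩
      · rcases List.mem_cons.1 hc with rfl | hc
        · exact mem_queueCards.2 ⟨u, v, huv, x.1, x.2, s, rfl, hu, rfl⟩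
        · exact hB c hc
      · simp only [List.map_cons, List.flatten_cons, h, List.append_assoc]

/-- If the machine can terminate only at the label behind its code, the cards have a match if and
only if it terminates. -/
theorem exists_match_iff {C : List (MMInstr n)} (i : Fin n) (x : ℕ)
    (hterm : MMTerminates 1 C (1, Pi.single i x) →
      ∃ v, ReflTransGen (MMStep 1 C) (1, Pi.single i x) (1 + C.length, v)) :
    (∃ A : List (List (Letter n × Bool) × List (Letter n × Bool)), A ≠ [] ∧
      (∀ c ∈ A, c ∈ startCard (run 1 :: hash :: List.replicate x (reg i)) :: queueCards C) ∧
        (A.map Prod.fst).flatten = (A.map Prod.snd).flatten) ↔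
      MMTerminates 1 C (1, Pi.single i x) := by
  have hbag : ((hash :: List.replicate x (reg i) : List (Letter n)) : Multiset (Letter n)) =
      hash ::ₘ regBag (Pi.single i x) := by
    rw [regBag_single, ← Multiset.cons_coe, Multiset.coe_replicate]
  constructor
  · rintro ⟨A, hA, hC, h⟩
    cases A with
    | nil => exact absurd rfl hA
    | cons c B =>
      have hB := fun d hd => hC d (List.mem_cons_of_mem _ hd)
      rcases List.mem_cons.1 (hC c List.mem_cons_self) with rfl | hc
      · refine terminates_of_cards B hB _ (.run .refl ?_) (List.cons.inj h).2
        rw [List.map_map, Function.comp_def, List.map_id', ← Multiset.cons_coe, hbag]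
      · -- both words of a card for a rule are non-empty, and begin with letters of opposite colours
        obtain ⟨s, t⟩ := c
        obtain ⟨u, v, huv, a, c, l, rfl, -, rfl⟩ := mem_queueCards.1 hc
        cases v with
        | nil => exact absurd rfl (ne_nil_of_mem_queueRules huv).2.2
        | cons b v =>
          simp only [List.map_cons, List.flatten_cons, List.cons_append, List.cons.injEq,
            Prod.mk.injEq] at h
          simp at h
  · intro h
    obtain ⟨v, hv⟩ := hterm h
    obtain ⟨B, hB, h⟩ := cards_of_queue (queue_of_terminates hbag hv)
      ((run 1 :: hash :: List.replicate x (reg i)).map fun a => (a, true))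
      (by rw [List.map_map, Function.comp_def, List.map_id'])
    refine ⟨startCard (run 1 :: hash :: List.replicate x (reg i)) :: B, by simp, fun c hc => ?_, ?_⟩
    · rcases List.mem_cons.1 hc with rfl | hc
      · exact List.mem_cons_self
      · exact List.mem_cons_of_mem _ (hB c hc)
    · rw [List.map_cons, List.flatten_cons, h]
      simp [startCard]

theorem pcp_hard : RecEnumHard PCP := by
  intro p hp
  obtain ⟨n, C, i, -, h1, h2⟩ := hp.exists_mm
  let f : Letter n × Bool → ℕ := fun x => encode (x.1.code, x.2)
  have hf : Function.Injective f := fun x y h => by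
    have := encode_injective h
    simp only [Prod.mk.injEq] at this
    exact Prod.ext (code_injective this.1) this.2
  refine ⟨fun x => (startCard (run 1 :: hash :: List.replicate x (reg i)) :: queueCards C).map
    (Prod.map (List.map f) (List.map f)), ?_, fun x => ?_⟩
  · have h : Primrec fun x : ℕ => ([f (start, true)], f (start, true) :: f (run 1, true) ::
        f (hash, true) :: (List.range x).map fun _ => f (reg i, true)) ::
        (queueCards C).map (Prod.map (List.map f) (List.map f)) := by
      refine Primrec.list_cons.comp (Primrec.pair (Primrec.const _) ?_) (Primrec.const _)
      refine Primrec.list_cons.comp (Primrec.const _) (Primrec.list_cons.comp (Primrec.const _)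
        (Primrec.list_cons.comp (Primrec.const _) ?_))
      exact Primrec.list_map Primrec.list_range (Primrec.const _).to₂
    refine ((Primrec.encode.comp h).comp Primrec.fst).to_comp.of_eq fun q => ?_
    simp [Named.name, startCard]
  · rw [pcp_map_iff hf, exists_match_iff i x fun h => h1 x (h2 x h)]
    exact ⟨fun h => let ⟨w, hw⟩ := h1 x h; ⟨_, hw, .inr (Nat.add_comm _ _).le⟩, h2 x⟩

end HilbertTenth

namespace HilbertTenth

open Encodable Relation

/-! ### Derivations and reachability are recursively enumerable -/

theorem IsSigmaOne.comp {α β : Type} [Primcodable α] [Primcodable β] {p : β → Prop}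
    (hp : IsSigmaOne p) {f : α → β} (hf : Primrec f) : IsSigmaOne fun a => p (f a) := by
  obtain ⟨R, hR, h⟩ := hp
  exact ⟨fun a => R (f a), hR.comp (hf.comp Primrec.fst) Primrec.snd, fun a => h _⟩

theorem _root_.PrimrecPred.isSigmaOne {α : Type} [Primcodable α] {p : α → Prop}
    (hp : PrimrecPred p) : IsSigmaOne p :=
  ⟨fun a _ => p a, hp.comp Primrec.fst, fun _ => (exists_const ℕ).symm⟩

theorem IsSigmaOne.and {α : Type} [Primcodable α] {p q : α → Prop} (hp : IsSigmaOne p)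
    (hq : IsSigmaOne q) : IsSigmaOne fun a => p a ∧ q a := by
  obtain ⟨R, hR, h⟩ := hp
  obtain ⟨S, hS, h'⟩ := hq
  refine IsSigmaOne.of_exists (β := ℕ × ℕ) (R := fun a n => R a n.1 ∧ S a n.2) ?_ fun a => ?_
  · exact (hR.comp Primrec.fst (Primrec.fst.comp Primrec.snd)).and
      (hS.comp Primrec.fst (Primrec.snd.comp Primrec.snd))
  · rw [h, h', Prod.exists, exists_and_exists_comm]

theorem IsSigmaOne.exists {α β : Type} [Primcodable α] [Primcodable β] {p : α × β → Prop}
    (hp : IsSigmaOne p) : IsSigmaOne fun a => ∃ b, p (a, b) := by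
  obtain ⟨R, hR, h⟩ := hp
  refine IsSigmaOne.of_exists (β := β × ℕ) (R := fun a q => R (a, q.1) q.2) ?_ fun a => ?_
  · exact hR.comp (Primrec.pair Primrec.fst (Primrec.fst.comp Primrec.snd))
      (Primrec.snd.comp Primrec.snd)
  · simp only [h, Prod.exists]

/-- `b` has a derivation with the rules `R`, where `R t b` says that `b` can be inferred from the
members of `t`. -/
inductive Derives {β : Type} (R : List β → β → Prop) : β → Prop
  | intro (t : List β) (b : β) (ht : ∀ c ∈ t, Derives R c) (hb : R t b) : Derives R b

/-- Each member of the list can be inferred from those behind it. -/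
def IsDerivation {β : Type} (R : List β → β → Prop) : List β → Prop
  | [] => True
  | b :: t => R t b ∧ IsDerivation R t

section

variable {β : Type} {R : List β → β → Prop}

theorem IsDerivation.derives {l : List β} (h : IsDerivation R l) : ∀ b ∈ l, Derives R b := by
  induction l with
  | nil => simp
  | cons b l ih =>
    have := ih h.2
    simp only [List.mem_cons, forall_eq_or_imp]
    exact ⟨.intro l b this h.1, this⟩

theorem IsDerivation.append (hR : ∀ s t b, s ⊆ t → R s b → R t b) {l l' : List β}
    (h : IsDerivation R l) (h' : IsDerivation R l') : IsDerivation R (l ++ l') := by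
  induction l with
  | nil => exact h'
  | cons b l ih => exact ⟨hR _ _ b (List.subset_append_left _ _) h.1, ih h.2⟩

theorem Derives.exists_isDerivation (hR : ∀ s t b, s ⊆ t → R s b → R t b) {b : β}
    (h : Derives R b) : ∃ l, IsDerivation R l ∧ b ∈ l := by
  induction h with
  | intro t b _ hb ih =>
    have : ∃ l, IsDerivation R l ∧ t ⊆ l := by
      clear hb
      induction t with
      | nil => exact ⟨[], trivial, by simp⟩
      | cons c t iht =>
        obtain ⟨l, hl, htl⟩ := iht (fun d hd => ‹∀ c ∈ _, Derives R c› d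
          (List.mem_cons_of_mem _ hd)) fun d hd => ih d (List.mem_cons_of_mem _ hd)
        obtain ⟨l', hl', hcl⟩ := ih c List.mem_cons_self
        refine ⟨l' ++ l, hl'.append hR hl, ?_⟩
        simp only [List.cons_subset, List.mem_append]
        exact ⟨.inl hcl, fun d hd => List.mem_append_right _ (htl hd)⟩
    obtain ⟨l, hl, htl⟩ := this
    exact ⟨b :: l, ⟨hR _ _ b htl hb, hl⟩, List.mem_cons_self⟩

end

/-- What can be derived with primitive recursive rules is recursively enumerable. -/
theorem IsSigmaOne.derives {α β : Type} [Primcodable α] [Primcodable β]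
    {R : α → List β → β → Prop} (hR : PrimrecPred fun q : α × List β × β => R q.1 q.2.1 q.2.2)
    (hmono : ∀ a s t b, s ⊆ t → R a s b → R a t b) :
    IsSigmaOne fun q : α × β => Derives (R q.1) q.2 := by
  classical
  refine IsSigmaOne.of_exists (β := List β) (R := fun q l => IsDerivation (R q.1) l ∧ q.2 ∈ l)
    (PrimrecPred.and ?_ ?_) fun q => ?_
  · have h : Primrec fun q : (α × β) × List β => (List.recOn q.2 true fun b t ih =>
        decide (R q.1.1 t b) && ih : Bool) := by
      refine Primrec.list_rec (h := fun (q : (α × β) × List β) (x : β × List β × Bool) =>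
        decide (R q.1.1 x.2.1 x.1) && x.2.2) Primrec.snd (Primrec.const true)
        (Primrec.and.comp (PrimrecPred.decide (hR.comp (f := fun x : ((α × β) × List β) ×
          β × List β × Bool => (x.1.1.1, x.2.2.1, x.2.1)) ?_)) ?_)
      · exact Primrec.pair (Primrec.fst.comp (Primrec.fst.comp Primrec.fst))
          (Primrec.pair (Primrec.fst.comp (Primrec.snd.comp Primrec.snd))
            (Primrec.fst.comp Primrec.snd))
      · exact Primrec.snd.comp (Primrec.snd.comp Primrec.snd)
    refine (Primrec.primrecPred_eq_true h).of_eq fun q => ?_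
    obtain ⟨q, l⟩ := q
    induction l with
    | nil => simp [IsDerivation]
    | cons b l ih => simpa [IsDerivation] using fun _ => ih
  · refine ((Primrec.eq (α := β)).exists_mem_list.comp Primrec.snd
      (Primrec.snd.comp Primrec.fst)).of_eq fun q => ?_
    simp
  · exact ⟨fun h => h.exists_isDerivation (hmono _), fun ⟨l, hl, h⟩ => hl.derives _ h⟩

/-- Reachability for a primitive recursive step relation is recursively enumerable. -/
theorem IsSigmaOne.reflTransGen {α β : Type} [Primcodable α] [Primcodable β]
    {S : α → β → β → Prop} (hS : PrimrecPred fun q : α × β × β => S q.1 q.2.1 q.2.2) :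
    IsSigmaOne fun q : α × β × β => ReflTransGen (S q.1) q.2.1 q.2.2 := by
  have h1 : PrimrecPred fun q : (α × β) × List β × β =>
      q.2.2 = q.1.2 ∨ ∃ c ∈ q.2.1, S q.1.1 c q.2.2 := by
    have h : PrimrecRel fun (c : β) (q : α × β) => S q.1 c q.2 :=
      hS.comp (Primrec.pair (Primrec.fst.comp Primrec.snd)
        (Primrec.pair Primrec.fst (Primrec.snd.comp Primrec.snd)))
    refine (Primrec.eq.comp (Primrec.snd.comp Primrec.snd) (Primrec.snd.comp Primrec.fst)).or
      (h.exists_mem_list.comp (Primrec.fst.comp Primrec.snd) (Primrec.pair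
        (Primrec.fst.comp Primrec.fst) (Primrec.snd.comp Primrec.snd)))
  have h2 := IsSigmaOne.derives (R := fun (a : α × β) (t : List β) (b : β) =>
    b = a.2 ∨ ∃ c ∈ t, S a.1 c b) h1 fun a s t b hst => Or.imp_right
      fun ⟨c, hc, h⟩ => ⟨c, hst hc, h⟩
  have h3 := h2.comp (f := fun q : α × β × β => ((q.1, q.2.1), q.2.2)) (Primrec.pair
    (Primrec.pair Primrec.fst (Primrec.fst.comp Primrec.snd)) (Primrec.snd.comp Primrec.snd))
  convert h3 using 2 with q
  obtain ⟨a, b, c⟩ := q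
  refine ⟨fun h => ?_, fun h => ?_⟩
  · simp only at h
    induction h with
    | refl => exact .intro [] b (by simp) (.inl rfl)
    | @tail d e _ hde ih => exact .intro [d] e (by simpa using ih) (.inr ⟨d, by simp, hde⟩)
  · simp only at h
    induction h with
    | intro t d _ hd ih =>
      rcases hd with rfl | ⟨e, he, h⟩
      · exact .refl
      · exact (ih e he).tail h

/-- Systems that simulate each other reach corresponding states. -/
theorem exists_reflTransGen_iff {γ β : Type} {T : γ → γ → Prop} {S : β → β → Prop}
    {r : γ → β → Prop} (h1 : ∀ c b d, r c b → T c d → ∃ b', S b b' ∧ r d b')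
    (h2 : ∀ c b b', r c b → S b b' → ∃ d, T c d ∧ r d b') {P : γ → Prop} {Q : β → Prop}
    (hPQ : ∀ c b, r c b → (P c ↔ Q b)) {c : γ} {b : β} (h : r c b) :
    (∃ d, ReflTransGen T c d ∧ P d) ↔ ∃ b', ReflTransGen S b b' ∧ Q b' := by
  constructor
  · rintro ⟨d, hd, hP⟩
    have : ∃ b', ReflTransGen S b b' ∧ r d b' := by
      clear hP
      induction hd with
      | refl => exact ⟨b, .refl, h⟩
      | tail _ hT ih =>
        obtain ⟨b₁, hb, hr⟩ := ih
        obtain ⟨b₂, hS, hr'⟩ := h1 _ _ _ hr hT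
        exact ⟨b₂, hb.tail hS, hr'⟩
    obtain ⟨b', hb', hr⟩ := this
    exact ⟨b', hb', (hPQ _ _ hr).1 hP⟩
  · rintro ⟨b', hb', hQ⟩
    have : ∃ d, ReflTransGen T c d ∧ r d b' := by
      clear hQ
      induction hb' with
      | refl => exact ⟨c, .refl, h⟩
      | tail _ hS ih =>
        obtain ⟨c₁, hc, hr⟩ := ih
        obtain ⟨c₂, hT, hr'⟩ := h2 _ _ _ hr hS
        exact ⟨c₂, hc.tail hT, hr'⟩
    obtain ⟨d, hd, hr⟩ := this
    exact ⟨d, hd, (hPQ _ _ hr).2 hQ⟩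

/-! ### Recursive enumerability of the problems -/

theorem pcp_re : RecEnum PCP := by
  refine RecEnum.of_code (p := PCP) ?_ id (fun _ => rfl) fun _ => Iff.rfl
  refine IsSigmaOne.of_exists (β := List (List ℕ × List ℕ)) (R := fun C A => A ≠ [] ∧
    (∀ c ∈ A, ∃ d ∈ C, d = c) ∧ (A.map Prod.fst).flatten = (A.map Prod.snd).flatten) ?_ fun C => ?_
  · refine PrimrecPred.and (Primrec.eq.comp Primrec.snd (Primrec.const [])).not
      (PrimrecPred.and ?_ ?_)
    · have h : PrimrecRel fun (c : List ℕ × List ℕ) (C : List (List ℕ × List ℕ)) =>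
          ∃ d ∈ C, d = c :=
        (Primrec.eq (α := List ℕ × List ℕ)).exists_mem_list.comp Primrec.snd Primrec.fst
      exact h.forall_mem_list.comp Primrec.snd Primrec.fst
    · exact Primrec.eq.comp
        (Primrec.list_flatten.comp (Primrec.list_map Primrec.snd (Primrec.fst.comp Primrec.snd).to₂))
        (Primrec.list_flatten.comp (Primrec.list_map Primrec.snd (Primrec.snd.comp Primrec.snd).to₂))
  · simp [PCP]

/-- A step of a program as a decidable condition. A denominator `0` divides only `0`, and
`m % 0 = m`, so the remainder decides divisibility in this case too. -/
theorem fractranStep_iff_foldr (Q : List (ℕ × ℕ)) (x y : ℕ) :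
    FractranStep Q x y ↔ Q.foldr (fun f b => (f.2 * y = f.1 * x) ∨
      (f.1 * x % f.2 ≠ 0 ∧ b)) False := by
  induction Q with
  | nil => simp [fractranStep_nil]
  | cons f Q ih =>
    obtain ⟨p, q⟩ := f
    rw [List.foldr_cons, ← ih, fractranStep_cons, Nat.dvd_iff_mod_eq_zero]

theorem forall_not_fractranStep_iff {Q : List (ℕ × ℕ)} {x : ℕ} :
    (∀ y, ¬ FractranStep Q x y) ↔ ∀ f ∈ Q, f.1 * x % f.2 ≠ 0 := by
  induction Q with
  | nil => simp [fractranStep_nil]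
  | cons f Q ih =>
    obtain ⟨p, q⟩ := f
    simp only [List.mem_cons, forall_eq_or_imp, ← ih, fractranStep_cons, not_or, not_and,
      Nat.dvd_iff_mod_eq_zero]
    constructor
    · intro h
      have h0 : p * x % q ≠ 0 := fun h0 => by
        obtain ⟨y, hy⟩ := Nat.dvd_of_mod_eq_zero h0
        exact (h y).1 hy.symm
      exact ⟨h0, fun y => (h y).2 h0⟩
    · rintro ⟨h0, h⟩ y
      exact ⟨fun hy => h0 (Nat.mod_eq_zero_of_dvd ⟨y, hy.symm⟩), fun _ => h y⟩

theorem fractran_re : RecEnum FRACTRAN := by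
  classical
  refine RecEnum.of_code (p := FRACTRAN) ?_ id (fun _ => rfl) fun _ => Iff.rfl
  have hS : PrimrecPred fun q : List (ℕ × ℕ) × ℕ × ℕ => FractranStep q.1 q.2.1 q.2.2 := by
    have h : Primrec fun q : List (ℕ × ℕ) × ℕ × ℕ => q.1.foldr (fun f b =>
        decide (f.2 * q.2.2 = f.1 * q.2.1) || (decide (f.1 * q.2.1 % f.2 ≠ 0) && b)) false := by
      refine Primrec.list_foldr (h := fun (q : List (ℕ × ℕ) × ℕ × ℕ) (x : (ℕ × ℕ) × Bool) =>
        decide (x.1.2 * q.2.2 = x.1.1 * q.2.1) || (decide (x.1.1 * q.2.1 % x.1.2 ≠ 0) && x.2)) Primrec.fst (Primrec.const false) ?_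
      have f1 : Primrec fun x : (List (ℕ × ℕ) × ℕ × ℕ) × (ℕ × ℕ) × Bool => x.2.1.1 :=
        Primrec.fst.comp (Primrec.fst.comp Primrec.snd)
      have f2 : Primrec fun x : (List (ℕ × ℕ) × ℕ × ℕ) × (ℕ × ℕ) × Bool => x.2.1.2 :=
        Primrec.snd.comp (Primrec.fst.comp Primrec.snd)
      have hx : Primrec fun x : (List (ℕ × ℕ) × ℕ × ℕ) × (ℕ × ℕ) × Bool => x.1.2.1 :=
        Primrec.fst.comp (Primrec.snd.comp Primrec.fst)
      have hy : Primrec fun x : (List (ℕ × ℕ) × ℕ × ℕ) × (ℕ × ℕ) × Bool => x.1.2.2 :=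
        Primrec.snd.comp (Primrec.snd.comp Primrec.fst)
      refine Primrec.or.comp (PrimrecPred.decide (Primrec.eq.comp (Primrec.nat_mul.comp f2 hy)
        (Primrec.nat_mul.comp f1 hx))) (Primrec.and.comp (PrimrecPred.decide
        (Primrec.eq.comp (Primrec.nat_mod.comp (Primrec.nat_mul.comp f1 hx) f2)
          (Primrec.const 0)).not) (Primrec.snd.comp Primrec.snd))
    refine (Primrec.primrecPred_eq_true h).of_eq fun q => ?_
    rw [fractranStep_iff_foldr]
    obtain ⟨Q, x, y⟩ := q
    induction Q with
    | nil => simp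
    | cons f Q ih =>
      simp only at ih
      simp [← ih]
  have h1 := IsSigmaOne.reflTransGen hS
  have h2 : PrimrecPred fun q : List (ℕ × ℕ) × ℕ × ℕ => ∀ f ∈ q.1, f.1 * q.2.2 % f.2 ≠ 0 := by
    have h : PrimrecRel fun (f : ℕ × ℕ) (x : ℕ) => f.1 * x % f.2 ≠ 0 :=
      (Primrec.eq.comp (Primrec.nat_mod.comp (Primrec.nat_mul.comp
        (Primrec.fst.comp Primrec.fst) Primrec.snd) (Primrec.snd.comp Primrec.fst))
        (Primrec.const 0)).not
    exact h.forall_mem_list.comp Primrec.fst (Primrec.snd.comp Primrec.snd)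
  have h3 := ((h1.and h2.isSigmaOne).comp (f := fun q : (List (ℕ × ℕ) × ℕ) × ℕ =>
    (q.1.1, q.1.2, q.2)) (Primrec.pair (Primrec.fst.comp Primrec.fst)
    (Primrec.pair (Primrec.snd.comp Primrec.fst) Primrec.snd))).exists
  convert h3 using 2 with I
  simp only [FRACTRAN, FractranTerminates, forall_not_fractranStep_iff]

end HilbertTenth

namespace HilbertTenth

open Encodable Relation

/-- `MMInstr.next` for coded instructions and states. -/
def codedNext (c : ℕ × List ℕ) : ℕ ⊕ (ℕ × ℕ) → ℕ × List ℕ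
  | .inl a => (c.1 + 1, c.2.set a (c.2.getD a 0 + 1))
  | .inr (a, p) =>
    if c.2.getD a 0 = 0 then (p, c.2) else (c.1 + 1, c.2.set a (c.2.getD a 0 - 1))

theorem primrec_codedNext : Primrec₂ codedNext := by
  have hget : Primrec₂ fun (l : List ℕ) (a : ℕ) => l.getD a 0 := Primrec.list_getD 0
  have h1 : Primrec₂ fun (c : (ℕ × List ℕ) × (ℕ ⊕ (ℕ × ℕ))) (a : ℕ) =>
      (c.1.1 + 1, c.1.2.set a (c.1.2.getD a 0 + 1)) := by
    have hv : Primrec fun q : ((ℕ × List ℕ) × (ℕ ⊕ (ℕ × ℕ))) × ℕ => q.1.1.2 :=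
      Primrec.snd.comp (Primrec.fst.comp Primrec.fst)
    exact Primrec.pair (Primrec.succ.comp (Primrec.fst.comp (Primrec.fst.comp Primrec.fst)))
      (Primrec.list_set.comp hv (Primrec.pair Primrec.snd
        (Primrec.succ.comp (hget.comp hv Primrec.snd))))
  have h2 : Primrec₂ fun (c : (ℕ × List ℕ) × (ℕ ⊕ (ℕ × ℕ))) (x : ℕ × ℕ) =>
      if c.1.2.getD x.1 0 = 0 then (x.2, c.1.2)
        else (c.1.1 + 1, c.1.2.set x.1 (c.1.2.getD x.1 0 - 1)) := by
    have hv : Primrec fun q : ((ℕ × List ℕ) × (ℕ ⊕ (ℕ × ℕ))) × ℕ × ℕ => q.1.1.2 :=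
      Primrec.snd.comp (Primrec.fst.comp Primrec.fst)
    have ha : Primrec fun q : ((ℕ × List ℕ) × (ℕ ⊕ (ℕ × ℕ))) × ℕ × ℕ => q.2.1 :=
      Primrec.fst.comp Primrec.snd
    refine Primrec.ite (Primrec.eq.comp (hget.comp hv ha) (Primrec.const 0))
      (Primrec.pair (Primrec.snd.comp Primrec.snd) hv) ?_
    exact Primrec.pair (Primrec.succ.comp (Primrec.fst.comp (Primrec.fst.comp Primrec.fst)))
      (Primrec.list_set.comp hv (Primrec.pair ha
        (Primrec.nat_sub.comp (hget.comp hv ha) (Primrec.const 1))))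
  refine (Primrec.sumCasesOn Primrec.snd h1 h2).of_eq fun q => ?_
  obtain ⟨c, a | ⟨a, p⟩⟩ := q <;> rfl

theorem set_ofFn {n : ℕ} (v : Fin n → ℕ) (a : Fin n) (x : ℕ) :
    (List.ofFn v).set a x = List.ofFn (Function.update v a x) := by
  refine List.ext_getElem (by simp) fun i h1 h2 => ?_
  simp only [List.length_ofFn] at h2
  simp only [List.getElem_set, List.getElem_ofFn, Function.update_apply, Fin.ext_iff, eq_comm]

theorem codedNext_code {n : ℕ} (c : ℕ × (Fin n → ℕ)) (I : MMInstr n) :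
    codedNext (c.1, List.ofFn c.2) I.code = ((I.next c).1, List.ofFn (I.next c).2) := by
  have hget : ∀ a : Fin n, (List.ofFn c.2).getD a 0 = c.2 a := fun a => by simp
  cases I with
  | inc a => simp only [MMInstr.code, codedNext, MMInstr.next, hget, set_ofFn]
  | dec a p =>
    simp only [MMInstr.code, codedNext, MMInstr.next, hget, set_ofFn]
    split_ifs <;> rfl

theorem mm_re : RecEnum MM := by
  have hS : PrimrecPred fun q : List (ℕ ⊕ (ℕ × ℕ)) × (ℕ × List ℕ) × (ℕ × List ℕ) =>
      q.2.1.1 ≠ 0 ∧ (q.1[q.2.1.1 - 1]?).map (codedNext q.2.1) = some q.2.2 := by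
    refine (Primrec.eq.comp (Primrec.fst.comp (Primrec.fst.comp Primrec.snd))
      (Primrec.const 0)).not.and (Primrec.eq.comp (Primrec.option_map (Primrec.list_getElem?.comp
        Primrec.fst (Primrec.nat_sub.comp (Primrec.fst.comp (Primrec.fst.comp Primrec.snd))
          (Primrec.const 1))) ?_) (Primrec.option_some.comp (Primrec.snd.comp Primrec.snd)))
    exact primrec_codedNext.comp (Primrec.fst.comp (Primrec.snd.comp Primrec.fst)) Primrec.snd
  have h1 := IsSigmaOne.reflTransGen (S := fun (C : List (ℕ ⊕ (ℕ × ℕ))) (b b' : ℕ × List ℕ) =>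
    b.1 ≠ 0 ∧ (C[b.1 - 1]?).map (codedNext b) = some b') hS
  have h2 : PrimrecPred fun q : List (ℕ ⊕ (ℕ × ℕ)) × (ℕ × List ℕ) × (ℕ × List ℕ) =>
      q.2.2.1 < 1 ∨ q.1.length + 1 ≤ q.2.2.1 := by
    have hpc : Primrec fun q : List (ℕ ⊕ (ℕ × ℕ)) × (ℕ × List ℕ) × (ℕ × List ℕ) => q.2.2.1 :=
      Primrec.fst.comp (Primrec.snd.comp Primrec.snd)
    exact (Primrec.nat_lt.comp hpc (Primrec.const 1)).or
      (Primrec.nat_le.comp (Primrec.succ.comp (Primrec.list_length.comp Primrec.fst)) hpc)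
  have h3 := ((h1.and h2.isSigmaOne).comp (f := fun q : (ℕ × List (ℕ ⊕ (ℕ × ℕ)) × List ℕ) ×
    (ℕ × List ℕ) => (q.1.2.1, (1, q.1.2.2), q.2)) (Primrec.pair
      (Primrec.fst.comp (Primrec.snd.comp Primrec.fst)) (Primrec.pair (Primrec.pair
        (Primrec.const 1) (Primrec.snd.comp (Primrec.snd.comp Primrec.fst))) Primrec.snd))).exists
  refine RecEnum.of_code h3 MMInstance.code (fun _ => rfl) fun I => ?_
  refine exists_reflTransGen_iff (c := (1, I.input)) (b := (1, List.ofFn I.input))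
    (T := MMStep 1 I.program)
    (S := fun b b' => b.1 ≠ 0 ∧ (I.code.2.1[b.1 - 1]?).map (codedNext b) = some b')
    (P := fun d => d.1 < 1 ∨ I.program.length + 1 ≤ d.1)
    (Q := fun b => b.1 < 1 ∨ I.code.2.1.length + 1 ≤ b.1)
    (r := fun c b => b = (c.1, List.ofFn c.2)) ?_ ?_ ?_ rfl
  · rintro c _ d rfl h
    obtain ⟨j, J, hj, hJ, rfl⟩ := mmStep_iff.1 h
    refine ⟨_, ⟨by simp [hj], ?_⟩, rfl⟩
    simp only [MMInstance.code, hj, Nat.add_sub_cancel_left, List.getElem?_map, hJ,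
      Option.map_some, ← codedNext_code]
  · rintro c _ b rfl ⟨hpc, h⟩
    simp only [MMInstance.code, List.getElem?_map, Option.map_map, Option.map_eq_some_iff,
      Function.comp_apply, codedNext_code] at h
    obtain ⟨J, hJ, rfl⟩ := h
    exact ⟨_, mmStep_iff.2 ⟨c.1 - 1, J, by simp only at hpc; omega, hJ, rfl⟩, rfl⟩
  · rintro c _ rfl
    simp [MMInstance.code]

/-- The effect of an entry of the transition table of a Turing machine on a coded configuration. -/
def codedMove (c : ℕ × List ℕ × List ℕ) : ℕ × (Bool ⊕ ℕ) → ℕ × List ℕ × List ℕ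
  | (q, .inl false) => (q, c.2.1.tail, c.2.1.headI :: c.2.2)
  | (q, .inl true) => (q, c.2.2.headI :: c.2.1, c.2.2.tail)
  | (q, .inr a) => (q, c.2.1, a :: c.2.2.tail)

theorem primrec_codedMove : Primrec₂ codedMove := by
  have h1 : Primrec₂ fun (x : (ℕ × List ℕ × List ℕ) × (ℕ × (Bool ⊕ ℕ))) (d : Bool) =>
      bif d then (x.2.1, x.1.2.2.headI :: x.1.2.1, x.1.2.2.tail)
        else (x.2.1, x.1.2.1.tail, x.1.2.1.headI :: x.1.2.2) := by
    have hq : Primrec fun y : ((ℕ × List ℕ × List ℕ) × (ℕ × (Bool ⊕ ℕ))) × Bool => y.1.2.1 :=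
      Primrec.fst.comp (Primrec.snd.comp Primrec.fst)
    have hl : Primrec fun y : ((ℕ × List ℕ × List ℕ) × (ℕ × (Bool ⊕ ℕ))) × Bool => y.1.1.2.1 :=
      Primrec.fst.comp (Primrec.snd.comp (Primrec.fst.comp Primrec.fst))
    have hr : Primrec fun y : ((ℕ × List ℕ × List ℕ) × (ℕ × (Bool ⊕ ℕ))) × Bool => y.1.1.2.2 :=
      Primrec.snd.comp (Primrec.snd.comp (Primrec.fst.comp Primrec.fst))
    exact Primrec.cond Primrec.snd
      (hq.pair ((Primrec.list_cons.comp (Primrec.list_headI.comp hr) hl).pair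
        (Primrec.list_tail.comp hr)))
      (hq.pair ((Primrec.list_tail.comp hl).pair
        (Primrec.list_cons.comp (Primrec.list_headI.comp hl) hr)))
  have h2 : Primrec₂ fun (x : (ℕ × List ℕ × List ℕ) × (ℕ × (Bool ⊕ ℕ))) (a : ℕ) =>
      (x.2.1, x.1.2.1, a :: x.1.2.2.tail) :=
    Primrec.pair (Primrec.fst.comp (Primrec.snd.comp Primrec.fst)) (Primrec.pair
      (Primrec.fst.comp (Primrec.snd.comp (Primrec.fst.comp Primrec.fst)))
      (Primrec.list_cons.comp Primrec.snd (Primrec.list_tail.comp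
        (Primrec.snd.comp (Primrec.snd.comp (Primrec.fst.comp Primrec.fst))))))
  refine (Primrec.sumCasesOn (Primrec.snd.comp Primrec.snd) h1 h2).of_eq fun x => ?_
  obtain ⟨c, q, (_ | _) | a⟩ := x <;> rfl

/-- The entry of the transition table that applies to a coded configuration. -/
def codedEntry (T : List (List (Option (ℕ × (Bool ⊕ ℕ))))) (c : ℕ × List ℕ × List ℕ) :
    Option (ℕ × (Bool ⊕ ℕ)) :=
  (T.getD c.1 []).getD c.2.2.headI none

theorem primrec_codedEntry : Primrec₂ codedEntry :=
  (Primrec.list_getD none).comp ((Primrec.list_getD []).comp Primrec.fst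
    (Primrec.fst.comp Primrec.snd)) (Primrec.list_headI.comp
      (Primrec.snd.comp (Primrec.snd.comp Primrec.snd)))

theorem headI_map_val {k : ℕ} (l : List (Fin (k + 1))) :
    (l.map Fin.val).headI = (l.headI : Fin (k + 1)).val := by
  cases l <;> rfl

theorem codedEntry_tableCode {s k : ℕ} (M : Turing.TM0.Machine (Fin (k + 1)) (Fin (s + 1)))
    (q : Fin (s + 1)) (L : List ℕ) (R : List (Fin (k + 1))) :
    codedEntry (tableCode M) (q, L, R.map Fin.val) =
      (M q R.headI).map fun t => (t.1.val, stmtCode t.2) := by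
  simp [codedEntry, tableCode, headI_map_val, -List.ofFn_succ, Nat.lt_succ_iff.1 q.isLt,
    Nat.lt_succ_iff.1 R.headI.isLt]

/-- A coded configuration consists of the state and of lists of symbols that describe the tape to
the left of the head and from the head onwards. -/
def IsCfgCode {s k : ℕ} (c : Turing.TM0.Cfg (Fin (k + 1)) (Fin (s + 1)))
    (b : ℕ × List ℕ × List ℕ) : Prop :=
  ∃ L R : List (Fin (k + 1)), c.Tape = Turing.Tape.mk₂ L R ∧
    b = (c.q.val, L.map Fin.val, R.map Fin.val)

theorem step_isCfgCode {s k : ℕ} (M : Turing.TM0.Machine (Fin (k + 1)) (Fin (s + 1)))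
    {c : Turing.TM0.Cfg (Fin (k + 1)) (Fin (s + 1))} {b : ℕ × List ℕ × List ℕ}
    (h : IsCfgCode c b) : Option.Rel IsCfgCode (Turing.TM0.step M c)
      ((codedEntry (tableCode M) b).map (codedMove b)) := by
  obtain ⟨q, T⟩ := c
  obtain ⟨L, R, hT, rfl⟩ := h
  simp only at hT
  subst hT
  rw [codedEntry_tableCode]
  change Option.Rel IsCfgCode ((M q (Turing.Tape.mk₂ L R).1).map _) _
  rw [show (Turing.Tape.mk₂ L R).1 = R.headI from rfl]
  cases M q R.headI with
  | none => exact .none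
  | some t =>
    obtain ⟨q', (_ | _) | a⟩ := t
    · refine .some ⟨L.tail, L.headI :: R, ?_, ?_⟩
      · simp [Turing.Tape.mk₂]
      · simp [codedMove, stmtCode, headI_map_val]
    · refine .some ⟨R.headI :: L, R.tail, ?_, ?_⟩
      · simp [Turing.Tape.mk₂]
      · simp [codedMove, stmtCode, headI_map_val]
    · refine .some ⟨L, a :: R.tail, ?_, ?_⟩
      · simp [Turing.Tape.mk₂]
      · simp [codedMove, stmtCode]

theorem halt_re : RecEnum Halt := by
  have hS : PrimrecPred fun q : List (List (Option (ℕ × (Bool ⊕ ℕ)))) ×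
      (ℕ × List ℕ × List ℕ) × (ℕ × List ℕ × List ℕ) =>
      (codedEntry q.1 q.2.1).map (codedMove q.2.1) = some q.2.2 := by
    refine Primrec.eq.comp (Primrec.option_map (primrec_codedEntry.comp Primrec.fst
      (Primrec.fst.comp Primrec.snd)) ?_) (Primrec.option_some.comp (Primrec.snd.comp Primrec.snd))
    exact primrec_codedMove.comp (Primrec.fst.comp (Primrec.snd.comp Primrec.fst)) Primrec.snd
  have h1 := IsSigmaOne.reflTransGen (S := fun T (b b' : ℕ × List ℕ × List ℕ) =>
    (codedEntry T b).map (codedMove b) = some b') hS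
  have h2 : PrimrecPred fun q : List (List (Option (ℕ × (Bool ⊕ ℕ)))) ×
      (ℕ × List ℕ × List ℕ) × (ℕ × List ℕ × List ℕ) => codedEntry q.1 q.2.2 = none :=
    Primrec.eq.comp (primrec_codedEntry.comp Primrec.fst (Primrec.snd.comp Primrec.snd))
      (Primrec.const none)
  have h3 := ((h1.and h2.isSigmaOne).comp (f := fun q : (ℕ × ℕ ×
    List (List (Option (ℕ × (Bool ⊕ ℕ)))) × List ℕ × List ℕ) × (ℕ × List ℕ × List ℕ) =>
    (q.1.2.2.1, (0, q.1.2.2.2), q.2)) (Primrec.pair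
      (Primrec.fst.comp (Primrec.snd.comp (Primrec.snd.comp Primrec.fst))) (Primrec.pair
        (Primrec.pair (Primrec.const 0) (Primrec.snd.comp (Primrec.snd.comp
          (Primrec.snd.comp Primrec.fst)))) Primrec.snd))).exists
  refine RecEnum.of_code h3 HaltInstance.code (fun _ => rfl) fun I => ?_
  refine exists_reflTransGen_iff (c := ⟨0, Turing.Tape.mk₂ I.left I.right⟩)
    (b := (0, I.left.map Fin.val, I.right.map Fin.val))
    (T := fun c d => d ∈ Turing.TM0.step I.machine c)
    (S := fun b b' => (codedEntry I.code.2.2.1 b).map (codedMove b) = some b')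
    (P := fun c => Turing.TM0.step I.machine c = none)
    (Q := fun b => codedEntry I.code.2.2.1 b = none) (r := IsCfgCode) ?_ ?_ ?_
    ⟨I.left, I.right, rfl, rfl⟩
  · intro c b d hr h
    have := step_isCfgCode I.machine hr
    rw [show Turing.TM0.step I.machine c = some d from h] at this
    rcases hb : (codedEntry (tableCode I.machine) b).map (codedMove b) with _ | b'
    · rw [hb] at this
      cases this
    · rw [hb] at this
      cases this with
      | some h => exact ⟨b', hb, h⟩
  · intro c b b' hr h
    have := step_isCfgCode I.machine hr
    rw [show (codedEntry (tableCode I.machine) b).map (codedMove b) = some b' from h] at this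
    rcases hd : Turing.TM0.step I.machine c with _ | d
    · rw [hd] at this
      cases this
    · rw [hd] at this
      cases this with
      | some h => exact ⟨d, rfl, h⟩
  · intro c b hr
    have := step_isCfgCode I.machine hr
    rw [show (HaltInstance.code I).2.2.1 = tableCode I.machine from rfl,
      ← Option.map_eq_none_iff (f := codedMove b)]
    generalize Turing.TM0.step I.machine c = x at this ⊢
    generalize (codedEntry (tableCode I.machine) b).map (codedMove b) = y at this ⊢
    cases this <;> simp

end HilbertTenth

namespace HilbertTenth

open Encodable Relation

theorem namePrefix_eq_cons {X : Type} [Encodable X] (x : X × (ℕ → ℕ)) :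
    namePrefix x = encode x.1 :: (List.range (encode x.1 + 1)).map x.2 := by
  rw [namePrefix, List.range_succ_eq_map, List.map_cons, List.map_map]
  rfl

theorem getD_map_range (ν : ℕ → ℕ) {N i : ℕ} (h : i < N) :
    ((List.range N).map ν).getD i 0 = ν i := by
  simp [h]

theorem primrecRel_mem {β : Type} [Primcodable β] :
    PrimrecRel fun (b : β) (t : List β) => b ∈ t :=
  ((Primrec.eq (α := β)).exists_mem_list.comp Primrec.snd Primrec.fst).of_eq fun q => by simp

theorem primrec_getD_zero : Primrec₂ fun (l : List ℕ) (i : ℕ) => l.getD i 0 :=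
  Primrec.list_getD 0

theorem primrec_unpair_fst : Primrec fun n : ℕ => n.unpair.1 := Primrec.fst.comp Primrec.unpair

theorem primrec_unpair_snd : Primrec fun n : ℕ => n.unpair.2 := Primrec.snd.comp Primrec.unpair

/-! ### Recursive enumerability of the Diophantine problems -/

/-- Rules to infer that a formula, given by its code, holds under a valuation, given by a list of
its first values (the other values are zero). -/
def formRules (t : List (ℕ × List ℕ)) (b : ℕ × List ℕ) : Prop :=
  (b.1.unpair.1 = 0 ∧ b.2.getD b.1.unpair.2.unpair.1 0 = b.1.unpair.2.unpair.2) ∨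
  (b.1.unpair.1 = 1 ∧
    b.2.getD b.1.unpair.2.unpair.1 0 = b.2.getD b.1.unpair.2.unpair.2 0) ∨
  (b.1.unpair.1 = 2 ∧ b.2.getD b.1.unpair.2.unpair.1 0 =
    b.2.getD b.1.unpair.2.unpair.2.unpair.1 0 + b.2.getD b.1.unpair.2.unpair.2.unpair.2 0) ∨
  (b.1.unpair.1 = 3 ∧ b.2.getD b.1.unpair.2.unpair.1 0 =
    b.2.getD b.1.unpair.2.unpair.2.unpair.1 0 * b.2.getD b.1.unpair.2.unpair.2.unpair.2 0) ∨
  (b.1.unpair.1 = 4 ∧ (b.1.unpair.2.unpair.1, b.2) ∈ t ∧ (b.1.unpair.2.unpair.2, b.2) ∈ t) ∨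
  (b.1.unpair.1 = 5 ∧ ((b.1.unpair.2.unpair.1, b.2) ∈ t ∨ (b.1.unpair.2.unpair.2, b.2) ∈ t)) ∨
  (b.1.unpair.1 = 6 ∧ ∃ c ∈ t, c = (b.1.unpair.2, c.2.headI :: b.2))

theorem primrec_formRules :
    PrimrecPred fun q : Unit × List (ℕ × List ℕ) × ℕ × List ℕ => formRules q.2.1 q.2.2 := by
  have ht : Primrec fun q : Unit × List (ℕ × List ℕ) × ℕ × List ℕ => q.2.1 :=
    Primrec.fst.comp Primrec.snd
  have he : Primrec fun q : Unit × List (ℕ × List ℕ) × ℕ × List ℕ => q.2.2.2 :=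
    Primrec.snd.comp (Primrec.snd.comp Primrec.snd)
  have hc : Primrec fun q : Unit × List (ℕ × List ℕ) × ℕ × List ℕ => q.2.2.1 :=
    Primrec.fst.comp (Primrec.snd.comp Primrec.snd)
  have hk := primrec_unpair_fst.comp hc
  have hx := primrec_unpair_snd.comp hc
  have h1 := primrec_unpair_fst.comp hx
  have h2 := primrec_unpair_snd.comp hx
  have g1 := primrec_getD_zero.comp he h1
  have g2 := primrec_getD_zero.comp he h2
  have g21 := primrec_getD_zero.comp he (primrec_unpair_fst.comp h2)
  have g22 := primrec_getD_zero.comp he (primrec_unpair_snd.comp h2)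
  have m1 := primrecRel_mem.comp (h1.pair he) ht
  have m2 := primrecRel_mem.comp (h2.pair he) ht
  have hex : PrimrecRel fun (c b : ℕ × List ℕ) => c = (b.1.unpair.2, c.2.headI :: b.2) :=
    Primrec.eq.comp Primrec.fst ((primrec_unpair_snd.comp (Primrec.fst.comp Primrec.snd)).pair
      (Primrec.list_cons.comp (Primrec.list_headI.comp (Primrec.snd.comp Primrec.fst))
        (Primrec.snd.comp Primrec.snd)))
  have k := fun n : ℕ => Primrec.eq.comp hk (Primrec.const n)
  exact ((k 0).and (Primrec.eq.comp g1 h2)).or <| ((k 1).and (Primrec.eq.comp g1 g2)).or <|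
    ((k 2).and (Primrec.eq.comp g1 (Primrec.nat_add.comp g21 g22))).or <|
    ((k 3).and (Primrec.eq.comp g1 (Primrec.nat_mul.comp g21 g22))).or <|
    ((k 4).and (m1.and m2)).or <| ((k 5).and (m1.or m2)).or <|
    (k 6).and (hex.exists_mem_list.comp ht (Primrec.snd.comp Primrec.snd))

theorem formRules_mono {s t : List (ℕ × List ℕ)} {b : ℕ × List ℕ} (h : s ⊆ t)
    (hb : formRules s b) : formRules t b := by
  have key : ∀ c, c ∈ s → c ∈ t := fun c hc => h hc
  unfold formRules at hb ⊢
  rcases hb with hb | hb | hb | hb | ⟨hk, h1, h2⟩ | ⟨hk, hb⟩ | ⟨hk, c, hc, hb⟩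
  · exact .inl hb
  · exact .inr (.inl hb)
  · exact .inr (.inr (.inl hb))
  · exact .inr (.inr (.inr (.inl hb)))
  · exact .inr (.inr (.inr (.inr (.inl ⟨hk, key _ h1, key _ h2⟩))))
  · exact .inr (.inr (.inr (.inr (.inr (.inl ⟨hk, hb.imp (key _) (key _)⟩)))))
  · exact .inr (.inr (.inr (.inr (.inr (.inr ⟨hk, c, key _ hc, hb⟩)))))

theorem liftVal_getD (e : List ℕ) (n : ℕ) :
    liftVal (fun i => e.getD i 0) n = fun i => (n :: e).getD i 0 := by
  funext i
  cases i <;> rfl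

theorem derives_formRules_iff (A : DioForm) (e : List ℕ) :
    Derives formRules (A.code, e) ↔ A.Holds fun i => e.getD i 0 := by
  constructor
  · suffices ∀ b, Derives formRules b → ∀ A : DioForm, A.code = b.1 →
        A.Holds fun i => b.2.getD i 0 from fun h => this _ h A rfl
    intro b h
    induction h with
    | intro t b _ hb ih =>
      intro A hA
      unfold formRules at hb
      rw [← hA] at hb
      cases A <;> simp only [DioForm.code, Nat.unpair_pair, Nat.reduceEqDiff, false_and, true_and,
        or_false, false_or, OfNat.zero_ne_ofNat, OfNat.one_ne_ofNat,
        OfNat.ofNat_ne_zero, OfNat.ofNat_ne_one, zero_ne_one, one_ne_zero] at hb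
      · exact hb
      · exact hb
      · exact hb
      · exact hb
      · exact ⟨ih _ hb.1 _ rfl, ih _ hb.2 _ rfl⟩
      · exact hb.elim (fun h => .inl (ih _ h _ rfl)) (fun h => .inr (ih _ h _ rfl))
      · obtain ⟨c, hc, h⟩ := hb
        have := ih c hc _ (congrArg Prod.fst h).symm
        rw [h] at this
        exact ⟨c.2.headI, by rwa [liftVal_getD]⟩
  · induction A generalizing e with
    | const i n => exact fun h => .intro [] _ (by simp) (by
        simpa [formRules, DioForm.code, DioForm.Holds] using h)
    | var i j => exact fun h => .intro [] _ (by simp) (by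
        simpa [formRules, DioForm.code, DioForm.Holds] using h)
    | add i j k => exact fun h => .intro [] _ (by simp) (by
        simpa [formRules, DioForm.code, DioForm.Holds] using h)
    | mul i j k => exact fun h => .intro [] _ (by simp) (by
        simpa [formRules, DioForm.code, DioForm.Holds] using h)
    | and A B hA hB =>
      exact fun h => .intro [(A.code, e), (B.code, e)] _
        (by simpa using ⟨hA e h.1, hB e h.2⟩) (by simp [formRules, DioForm.code])
    | or A B hA hB =>
      rintro (h | h)
      · exact .intro [(A.code, e)] _ (by simpa using hA e h) (by simp [formRules, DioForm.code])
      · exact .intro [(B.code, e)] _ (by simpa using hB e h) (by simp [formRules, DioForm.code])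
    | ex A hA =>
      rintro ⟨n, h⟩
      rw [liftVal_getD] at h
      exact .intro [(A.code, n :: e)] _ (by simpa using hA (n :: e) h)
        (by simp [formRules, DioForm.code])

/-- A formula depends only on variables with indices up to its code. -/
theorem DioForm.holds_congr (A : DioForm) {ν μ : ℕ → ℕ} (h : ∀ i ≤ A.code, ν i = μ i) :
    A.Holds ν ↔ A.Holds μ := by
  have l := Nat.left_le_pair
  have r := Nat.right_le_pair
  induction A generalizing ν μ with
  | const i n => simp only [Holds, h i ((l i n).trans (r 0 _))]
  | var i j => simp only [Holds, h i ((l i j).trans (r 1 _)), h j ((r i j).trans (r 1 _))]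
  | add i j k | mul i j k =>
    simp only [Holds, h i ((l i _).trans (r _ _)), h j (((l j k).trans (r i _)).trans (r _ _)),
      h k (((r j k).trans (r i _)).trans (r _ _))]
  | and A B hA hB =>
    exact and_congr (hA fun i hi => h i (hi.trans ((l _ _).trans (r _ _))))
      (hB fun i hi => h i (hi.trans ((r _ _).trans (r _ _))))
  | or A B hA hB =>
    exact or_congr (hA fun i hi => h i (hi.trans ((l _ _).trans (r _ _))))
      (hB fun i hi => h i (hi.trans ((r _ _).trans (r _ _))))
  | ex A hA =>
    rw [Holds, Holds]
    refine exists_congr fun n => hA fun i hi => ?_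
    cases i with
    | zero => rfl
    | succ i => exact h i ((Nat.le_succ i).trans (hi.trans (r 6 _)))

/-- The values that the name prefix contains suffice to evaluate the formula. -/
theorem dioForm_re : RecEnum DIO_FORM := by
  have h1 := IsSigmaOne.derives (R := fun _ : Unit => formRules) primrec_formRules
    fun _ _ _ _ h hb => formRules_mono h hb
  have h2 := h1.comp (f := fun l : List ℕ => ((), (l.headI, l.tail)))
    ((Primrec.const ()).pair (Primrec.list_headI.pair Primrec.list_tail))
  refine RecEnum.of_namePrefix h2 fun I => ?_
  rw [namePrefix_eq_cons]
  refine Iff.trans ?_ (derives_formRules_iff I.1 _).symm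
  exact I.1.holds_congr fun i hi => (getD_map_range I.2 (Nat.lt_succ_of_le hi)).symm

/-- Does the constraint with the given code hold, for lists `x.1` and `x.2` of the values of the
parameters and of the existential variables? -/
def codedCstr (c : ℕ) (x : List ℕ × List ℕ) : Prop :=
  (c.unpair.1 = 0 ∧ x.2.getD c.unpair.2.unpair.1 0 = c.unpair.2.unpair.2) ∨
  (c.unpair.1 = 1 ∧ x.2.getD c.unpair.2.unpair.1 0 = x.2.getD c.unpair.2.unpair.2 0) ∨
  (c.unpair.1 = 2 ∧ x.2.getD c.unpair.2.unpair.1 0 = x.1.getD c.unpair.2.unpair.2 0) ∨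
  (c.unpair.1 = 3 ∧ x.2.getD c.unpair.2.unpair.1 0 =
    x.2.getD c.unpair.2.unpair.2.unpair.1 0 + x.2.getD c.unpair.2.unpair.2.unpair.2 0) ∨
  (c.unpair.1 = 4 ∧ x.2.getD c.unpair.2.unpair.1 0 =
    x.2.getD c.unpair.2.unpair.2.unpair.1 0 * x.2.getD c.unpair.2.unpair.2.unpair.2 0)

theorem primrec_codedCstr : PrimrecRel codedCstr := by
  have hν : Primrec fun q : ℕ × List ℕ × List ℕ => q.2.1 := Primrec.fst.comp Primrec.snd
  have hφ : Primrec fun q : ℕ × List ℕ × List ℕ => q.2.2 := Primrec.snd.comp Primrec.snd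
  have hc : Primrec fun q : ℕ × List ℕ × List ℕ => q.1 := Primrec.fst
  have hx := primrec_unpair_snd.comp hc
  have h2 := primrec_unpair_snd.comp hx
  have g1 := primrec_getD_zero.comp hφ (primrec_unpair_fst.comp hx)
  have g21 := primrec_getD_zero.comp hφ (primrec_unpair_fst.comp h2)
  have g22 := primrec_getD_zero.comp hφ (primrec_unpair_snd.comp h2)
  have k := fun n : ℕ => Primrec.eq.comp (primrec_unpair_fst.comp hc) (Primrec.const n)
  exact ((k 0).and (Primrec.eq.comp g1 h2)).or <|
    ((k 1).and (Primrec.eq.comp g1 (primrec_getD_zero.comp hφ h2))).or <|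
    ((k 2).and (Primrec.eq.comp g1 (primrec_getD_zero.comp hν h2))).or <|
    ((k 3).and (Primrec.eq.comp g1 (Primrec.nat_add.comp g21 g22))).or <|
    (k 4).and (Primrec.eq.comp g1 (Primrec.nat_mul.comp g21 g22))

theorem codedCstr_code (c : DioCstr) (ν φ : List ℕ) :
    codedCstr c.code (ν, φ) ↔ c.Holds (fun i => ν.getD i 0) fun i => φ.getD i 0 := by
  cases c <;> simp [codedCstr, DioCstr.code, DioCstr.Holds]

/-- A constraint depends only on variables and parameters with indices up to its code. -/
theorem DioCstr.holds_congr (c : DioCstr) {ν μ φ ψ : ℕ → ℕ} (h : ∀ i ≤ c.code, ν i = μ i)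
    (h' : ∀ i ≤ c.code, φ i = ψ i) : c.Holds ν φ ↔ c.Holds μ ψ := by
  have l := Nat.left_le_pair
  have r := Nat.right_le_pair
  cases c with
  | const u n => simp only [Holds, h' u ((l u n).trans (r 0 _))]
  | var u v => simp only [Holds, h' u ((l u v).trans (r 1 _)), h' v ((r u v).trans (r 1 _))]
  | param u i => simp only [Holds, h' u ((l u i).trans (r 2 _)), h i ((r u i).trans (r 2 _))]
  | add u v w | mul u v w =>
    simp only [Holds, h' u ((l u _).trans (r _ _)), h' v (((l v w).trans (r u _)).trans (r _ _)),
      h' w (((r v w).trans (r u _)).trans (r _ _))]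

theorem encode_le_encode_list {α : Type} [Encodable α] {a : α} {l : List α} (h : a ∈ l) :
    encode a ≤ encode l := by
  induction l with
  | nil => simp at h
  | cons b l ih =>
    rw [Encodable.encode_list_cons]
    rcases List.mem_cons.1 h with rfl | h
    · exact (Nat.left_le_pair _ _).trans (Nat.le_succ _)
    · exact (ih h).trans ((Nat.right_le_pair _ _).trans (Nat.le_succ _))

theorem encode_map_code (l : List DioCstr) : encode (l.map DioCstr.code) = encode l := by
  induction l with
  | nil => rfl
  | cons c l ih => rw [List.map_cons, Encodable.encode_list_cons, Encodable.encode_list_cons, ih]; rfl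

theorem dioElem_re : RecEnum DIO_ELEM := by
  have h : PrimrecRel fun (l : List ℕ) (x : List ℕ × List ℕ) =>
      encode x.1 = l.headI ∧ ∀ c ∈ x.1, codedCstr c (l.tail, x.2) := by
    refine PrimrecPred.and (Primrec.eq.comp (Primrec.encode.comp (Primrec.fst.comp Primrec.snd))
      (Primrec.list_headI.comp Primrec.fst)) ?_
    exact primrec_codedCstr.forall_mem_list.comp (Primrec.fst.comp Primrec.snd)
      ((Primrec.list_tail.comp Primrec.fst).pair (Primrec.snd.comp Primrec.snd))
  refine RecEnum.of_namePrefix (IsSigmaOne.of_exists h fun _ => Iff.rfl) fun I => ?_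
  rw [namePrefix_eq_cons]
  simp only [List.headI_cons, List.tail_cons]
  have key : ∀ c ∈ I.1, ∀ i ≤ c.code, i < encode I.1 + 1 := fun c hc i hi =>
    Nat.lt_succ_of_le (hi.trans (encode_le_encode_list hc))
  constructor
  · rintro ⟨φ, hφ⟩
    refine ⟨(I.1.map DioCstr.code, (List.range (encode I.1 + 1)).map φ), encode_map_code _, ?_⟩
    simp only [List.mem_map, forall_exists_index, and_imp, forall_apply_eq_imp_iff₂,
      codedCstr_code]
    intro c hc
    exact (c.holds_congr (fun i hi => getD_map_range I.2 (key c hc i hi))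
      fun i hi => getD_map_range φ (key c hc i hi)).2 (hφ c hc)
  · rintro ⟨⟨l, φ⟩, hl, h⟩
    obtain rfl : l = I.1.map DioCstr.code := encode_injective (hl.trans (encode_map_code _).symm)
    refine ⟨fun i => φ.getD i 0, fun c hc => ?_⟩
    have := h _ (List.mem_map_of_mem hc)
    rw [codedCstr_code] at this
    exact (c.holds_congr (fun i hi => getD_map_range I.2 (key c hc i hi)) fun _ _ => rfl).1 this

/-- Rules to infer the value of a polynomial, given by its code, for lists `x.1` and `x.2` of the
values of the parameters and of the variables. -/
def polyRules (x : List ℕ × List ℕ) (t : List (ℕ × ℕ)) (b : ℕ × ℕ) : Prop :=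
  (b.1.unpair.1 = 0 ∧ x.2.getD b.1.unpair.2 0 = b.2) ∨
  (b.1.unpair.1 = 1 ∧ x.1.getD b.1.unpair.2 0 = b.2) ∨
  (b.1.unpair.1 = 2 ∧ b.1.unpair.2 = b.2) ∨
  (b.1.unpair.1 = 3 ∧ ∃ c ∈ t, ∃ d ∈ t, c.1 = b.1.unpair.2.unpair.1 ∧
    d.1 = b.1.unpair.2.unpair.2 ∧ c.2 + d.2 = b.2) ∨
  (b.1.unpair.1 = 4 ∧ ∃ c ∈ t, ∃ d ∈ t, c.1 = b.1.unpair.2.unpair.1 ∧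
    d.1 = b.1.unpair.2.unpair.2 ∧ c.2 * d.2 = b.2)

theorem primrec_polyRules : PrimrecPred fun q : (List ℕ × List ℕ) × List (ℕ × ℕ) × ℕ × ℕ =>
    polyRules q.1 q.2.1 q.2.2 := by
  have hν : Primrec fun q : (List ℕ × List ℕ) × List (ℕ × ℕ) × ℕ × ℕ => q.1.1 :=
    Primrec.fst.comp Primrec.fst
  have hφ : Primrec fun q : (List ℕ × List ℕ) × List (ℕ × ℕ) × ℕ × ℕ => q.1.2 :=
    Primrec.snd.comp Primrec.fst
  have ht : Primrec fun q : (List ℕ × List ℕ) × List (ℕ × ℕ) × ℕ × ℕ => q.2.1 :=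
    Primrec.fst.comp Primrec.snd
  have hb : Primrec fun q : (List ℕ × List ℕ) × List (ℕ × ℕ) × ℕ × ℕ => q.2.2 :=
    Primrec.snd.comp Primrec.snd
  have hc := Primrec.fst.comp hb
  have hv := Primrec.snd.comp hb
  have hx := primrec_unpair_snd.comp hc
  have hop : ∀ f : ℕ → ℕ → ℕ, Primrec₂ f → PrimrecPred fun q : (List ℕ × List ℕ) ×
      List (ℕ × ℕ) × ℕ × ℕ => ∃ c ∈ q.2.1, ∃ d ∈ q.2.1, c.1 = q.2.2.1.unpair.2.unpair.1 ∧
        d.1 = q.2.2.1.unpair.2.unpair.2 ∧ f c.2 d.2 = q.2.2.2 := fun f hf => by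
    have h1 : PrimrecRel fun (d : ℕ × ℕ) (r : (ℕ × ℕ) × ℕ × ℕ) =>
        r.1.1 = r.2.1.unpair.2.unpair.1 ∧ d.1 = r.2.1.unpair.2.unpair.2 ∧ f r.1.2 d.2 = r.2.2 := by
      have hx : Primrec fun q : (ℕ × ℕ) × (ℕ × ℕ) × ℕ × ℕ => q.2.2.1.unpair.2 :=
        primrec_unpair_snd.comp (Primrec.fst.comp (Primrec.snd.comp Primrec.snd))
      exact (Primrec.eq.comp (Primrec.fst.comp (Primrec.fst.comp Primrec.snd))
        (primrec_unpair_fst.comp hx)).and ((Primrec.eq.comp (Primrec.fst.comp Primrec.fst)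
        (primrec_unpair_snd.comp hx)).and (Primrec.eq.comp (hf.comp (Primrec.snd.comp
          (Primrec.fst.comp Primrec.snd)) (Primrec.snd.comp Primrec.fst))
          (Primrec.snd.comp (Primrec.snd.comp Primrec.snd))))
    have h2 : PrimrecRel fun (c : ℕ × ℕ) (r : List (ℕ × ℕ) × ℕ × ℕ) => ∃ d ∈ r.1,
        c.1 = r.2.1.unpair.2.unpair.1 ∧ d.1 = r.2.1.unpair.2.unpair.2 ∧ f c.2 d.2 = r.2.2 :=
      h1.exists_mem_list.comp (Primrec.fst.comp Primrec.snd)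
        (Primrec.fst.pair (Primrec.snd.comp Primrec.snd))
    exact h2.exists_mem_list.comp ht (ht.pair hb)
  have k := fun n : ℕ => Primrec.eq.comp (primrec_unpair_fst.comp hc) (Primrec.const n)
  exact ((k 0).and (Primrec.eq.comp (primrec_getD_zero.comp hφ hx) hv)).or <|
    ((k 1).and (Primrec.eq.comp (primrec_getD_zero.comp hν hx) hv)).or <|
    ((k 2).and (Primrec.eq.comp hx hv)).or <| ((k 3).and (hop _ Primrec.nat_add)).or <|
    (k 4).and (hop _ Primrec.nat_mul)

theorem polyRules_mono {x : List ℕ × List ℕ} {s t : List (ℕ × ℕ)} {b : ℕ × ℕ} (h : s ⊆ t)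
    (hb : polyRules x s b) : polyRules x t b := by
  unfold polyRules at hb ⊢
  rcases hb with hb | hb | hb | ⟨hk, c, hc, d, hd, hb⟩ | ⟨hk, c, hc, d, hd, hb⟩
  · exact .inl hb
  · exact .inr (.inl hb)
  · exact .inr (.inr (.inl hb))
  · exact .inr (.inr (.inr (.inl ⟨hk, c, h hc, d, h hd, hb⟩)))
  · exact .inr (.inr (.inr (.inr ⟨hk, c, h hc, d, h hd, hb⟩)))

theorem derives_polyRules_iff (x : List ℕ × List ℕ) (p : DioPoly ℕ ℕ) (v : ℕ) :
    Derives (polyRules x) (p.code, v) ↔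
      p.eval (fun i => x.1.getD i 0) (fun i => x.2.getD i 0) = v := by
  constructor
  · suffices ∀ b, Derives (polyRules x) b → ∀ p : DioPoly ℕ ℕ, p.code = b.1 →
        p.eval (fun i => x.1.getD i 0) (fun i => x.2.getD i 0) = b.2 from fun h => this _ h p rfl
    intro b h
    induction h with
    | intro t b _ hb ih =>
      intro p hp
      unfold polyRules at hb
      rw [← hp] at hb
      cases p <;> simp only [DioPoly.code, Nat.unpair_pair, Nat.reduceEqDiff, false_and, true_and,
        or_false, false_or, OfNat.zero_ne_ofNat, OfNat.one_ne_ofNat,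
        OfNat.ofNat_ne_zero, OfNat.ofNat_ne_one, zero_ne_one, one_ne_zero, Encodable.encode_nat]
        at hb
      · exact hb
      · exact hb
      · exact hb
      · obtain ⟨c, hc, d, hd, h1, h2, h3⟩ := hb
        rw [DioPoly.eval, ih c hc _ h1.symm, ih d hd _ h2.symm, h3]
      · obtain ⟨c, hc, d, hd, h1, h2, h3⟩ := hb
        rw [DioPoly.eval, ih c hc _ h1.symm, ih d hd _ h2.symm, h3]
  · rintro rfl
    induction p with
    | var u => exact .intro [] _ (by simp) (by simp [polyRules, DioPoly.code, DioPoly.eval])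
    | param u => exact .intro [] _ (by simp) (by simp [polyRules, DioPoly.code, DioPoly.eval])
    | const u => exact .intro [] _ (by simp) (by simp [polyRules, DioPoly.code, DioPoly.eval])
    | add p q hp hq | mul p q hp hq =>
      refine .intro [(p.code, _), (q.code, _)] _ (by simpa using ⟨hp, hq⟩) ?_
      simp only [polyRules, DioPoly.code, Nat.unpair_pair, DioPoly.eval]
      simp only [Nat.reduceEqDiff, false_and, true_and, or_false, false_or,
        OfNat.ofNat_ne_zero, OfNat.ofNat_ne_one]
      exact ⟨_, List.mem_cons_self, _, List.mem_cons_of_mem _ List.mem_cons_self, rfl, rfl, rfl⟩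

/-- A polynomial depends only on variables and parameters with indices up to its code. -/
theorem DioPoly.eval_congr_code (p : DioPoly ℕ ℕ) {ν μ φ ψ : ℕ → ℕ}
    (h : ∀ i ≤ p.code, ν i = μ i) (h' : ∀ i ≤ p.code, φ i = ψ i) : p.eval ν φ = p.eval μ ψ := by
  have l := Nat.left_le_pair
  have r := Nat.right_le_pair
  induction p with
  | var u => exact h' u (r 0 u)
  | param u => exact h u (r 1 u)
  | const n => rfl
  | add p q hp hq | mul p q hp hq =>
    have h1 : p.code ≤ Nat.pair p.code q.code := l _ _
    have h2 : q.code ≤ Nat.pair p.code q.code := r _ _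
    simp only [eval, hp (fun i hi => h i ((hi.trans h1).trans (r _ _)))
      (fun i hi => h' i ((hi.trans h1).trans (r _ _))),
      hq (fun i hi => h i ((hi.trans h2).trans (r _ _)))
      (fun i hi => h' i ((hi.trans h2).trans (r _ _)))]

theorem dioSingle_re : RecEnum DIO_SINGLE := by
  have h1 := IsSigmaOne.derives primrec_polyRules fun _ _ _ _ h hb => polyRules_mono h hb
  have hx : Primrec fun q : List ℕ × List ℕ × ℕ => (q.1.tail, q.2.1) :=
    (Primrec.list_tail.comp Primrec.fst).pair (Primrec.fst.comp Primrec.snd)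
  have hv : Primrec fun q : List ℕ × List ℕ × ℕ => q.2.2 := Primrec.snd.comp Primrec.snd
  have hc : Primrec fun q : List ℕ × List ℕ × ℕ => q.1.headI := Primrec.list_headI.comp Primrec.fst
  have h2 := h1.comp (hx.pair ((primrec_unpair_fst.comp hc).pair hv))
  have h3 := h1.comp (hx.pair ((primrec_unpair_snd.comp hc).pair hv))
  refine RecEnum.of_namePrefix (h2.and h3).exists fun I => ?_
  obtain ⟨⟨p, q⟩, ν⟩ := I
  rw [namePrefix_eq_cons]
  have he : encode (p, q) = Nat.pair p.code q.code := rfl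
  simp only [List.headI_cons, List.tail_cons, he, Nat.unpair_pair, derives_polyRules_iff,
    Prod.exists]
  have hp : ∀ i ≤ p.code, i < Nat.pair p.code q.code + 1 := fun i hi =>
    Nat.lt_succ_of_le (hi.trans (Nat.left_le_pair _ _))
  have hq : ∀ i ≤ q.code, i < Nat.pair p.code q.code + 1 := fun i hi =>
    Nat.lt_succ_of_le (hi.trans (Nat.right_le_pair _ _))
  constructor
  · rintro ⟨φ, hφ⟩
    refine ⟨(List.range (Nat.pair p.code q.code + 1)).map φ, p.eval ν φ, ?_, ?_⟩
    · exact p.eval_congr_code (fun i hi => getD_map_range ν (hp i hi))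
        fun i hi => getD_map_range φ (hp i hi)
    · refine Eq.trans ?_ hφ.symm
      exact q.eval_congr_code (fun i hi => getD_map_range ν (hq i hi))
        fun i hi => getD_map_range φ (hq i hi)
  · rintro ⟨φ, v, h4, h5⟩
    refine ⟨fun i => φ.getD i 0, ?_⟩
    change p.eval ν _ = q.eval ν _
    rw [← p.eval_congr_code (fun i hi => getD_map_range ν (hp i hi)) fun _ _ => rfl,
      ← q.eval_congr_code (fun i hi => getD_map_range ν (hq i hi)) fun _ _ => rfl, h4, h5]

end HilbertTenth

theorem mainTheorem1 :
    HilbertTenth.Reduces HilbertTenth.Halt HilbertTenth.PCP ∧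
    HilbertTenth.Reduces HilbertTenth.PCP HilbertTenth.MM ∧
    HilbertTenth.Reduces HilbertTenth.MM HilbertTenth.FRACTRAN_REG ∧
    HilbertTenth.Reduces HilbertTenth.FRACTRAN_REG HilbertTenth.FRACTRAN ∧
    HilbertTenth.Reduces HilbertTenth.FRACTRAN HilbertTenth.DIO_FORM ∧
    HilbertTenth.Reduces HilbertTenth.DIO_FORM HilbertTenth.DIO_ELEM ∧
    HilbertTenth.Reduces HilbertTenth.DIO_ELEM HilbertTenth.DIO_SINGLE ∧
    HilbertTenth.Reduces HilbertTenth.DIO_SINGLE HilbertTenth.H10 ∧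
    ¬ HilbertTenth.AlgorithmicallyDecidable HilbertTenth.H10 := by
  exact ⟨HilbertTenth.halt_re.reduces HilbertTenth.pcp_hard,
    HilbertTenth.pcp_re.reduces HilbertTenth.mm_hard,
    HilbertTenth.mm_re.reduces HilbertTenth.fractranReg_hard,
    HilbertTenth.fractranReg_reduces,
    HilbertTenth.fractran_re.reduces HilbertTenth.dioForm_hard,
    HilbertTenth.dioForm_re.reduces HilbertTenth.dioElem_hard,
    HilbertTenth.dioElem_re.reduces HilbertTenth.dioSingle_hard,
    HilbertTenth.dioSingle_re.reduces HilbertTenth.h10_hard,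
    HilbertTenth.h10_hard.not_decidable⟩
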